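/- Let $k$ be a commutative ring, $\otimes=\otimes_k$. For a Hopf algebra $A$ over $k$ (product $m$, coproduct $\Delta(a)=a_1\otimes a_2$, counit $\varepsilon$) let $\mathrm{Reg}^1(A)$ be the group of convolution invertible linear maps $\mu:A\to k$ with $\mu(1)=1$, and $\mathrm{Reg}^2(A)$ the group of convolution invertible linear maps $\sigma:A\otimes A\to k$ with $\sigma(a,1)=\varepsilon(a)=\sigma(1,a)$. A left $2$-cocycle is a $\sigma\in\mathrm{Reg}^2(A)$ with $\sigma(a_1,b_1)\sigma(a_2b_2,c)=\sigma(b_1,c_1)\sigma(a,b_2c_2)$ for all $a,b,c\in A$. Call $\mu\in\mathrm{Reg}^1(A)$ lazy if $\mu(a_1)a_2=a_1\mu(a_2)$, and $\sigma\in\mathrm{Reg}^2(A)$ lazy if $\sigma(a_1,b_1)a_2b_2=\sigma(a_2,b_2)a_1b_1$. The lazy left $2$-cocycles form a group $Z^2_L(A)$ under convolution, the elements $\partial(\mu)(a,b)=\mu(a_1)\mu(b_1)\mu^{-1}(a_2b_2)$ with $\mu\in\mathrm{Reg}^1(A)$ lazy form a central subgroup $B^2_L(A)$, and $H^2_L(A)=Z^2_L(A)/B^2_L(A)$.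 For Hopf algebras $A$, $B$, an $A$-$B$-biGalois object is a non-zero algebra $Z$ with a left $A$-comodule algebra structure $z\mapsto z_{(-1)}\otimes z_{(0)}$ and a right $B$-comodule algebra structure $z\mapsto z_{(0)}\otimes z_{(1)}$ making $Z$ an $A$-$B$-bicomodule, such that ${}^{\mathrm{co}A}Z=k=Z^{\mathrm{co}B}$ and the maps $Z\otimes Z\to A\otimes Z$, $x\otimes y\mapsto x_{(-1)}\otimes x_{(0)}y$, and $Z\otimes Z\to Z\otimes B$, $x\otimes y\mapsto xy_{(0)}\otimes y_{(1)}$, are bijective. Let $A$ and $B$ be Hopf algebras over $k$ that are flat as $k$-modules. (1) If there exists an $A$-$B$-biGalois object that is faithfully flat as a $k$-module, then there is a group isomorphism $H^2_L(A)\cong H^2_L(B)$. (2) In particular, if the categories of right comodules $\mathrm{Comod}(A)$ and $\mathrm{Comod}(B)$ are equivalent as $k$-linear monoidal categories, then $H^2_L(A)\cong H^2_L(B)$ as groups. (3) In particular, if $B$ is isomorphic to a twist ${}_\omega A_{\omega^{-1}}$ of $A$ by a left $2$-cocycle $\omega$ of $A$ (the coalgebra $A$ with product $a\cdot b=\omega(a_1,b_1)\,a_2b_2\,\omega^{-1}(a_3,b_3)$),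 then $H^2_L(A)\cong H^2_L(B)$ as groups. -/

import Mathlib

open TensorProduct Coalgebra CategoryTheory

universe u v w z

noncomputable section

namespace LazyCohomology

/-! ### Convolution algebras -/

section Convolution

variable {k : Type u} [CommRing k]

/-- Precomposition with a coalgebra morphism `h : C → D`, as a morphism of convolution monoids
`Hom(D, R) → Hom(C, R)`. -/
def convPull {C : Type v} {D : Type w} [AddCommGroup C] [Module k C] [Coalgebra k C]
    [AddCommGroup D] [Module k D] [Coalgebra k D] (h : C →ₗc[k] D) :
    WithConv (D →ₗ[k] k) →* WithConv (C →ₗ[k] k) where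
  toFun f := WithConv.toConv (f.ofConv ∘ₗ h.toLinearMap)
  map_one' := by
    ext x
    simp [LinearMap.convOne_def]
  map_mul' f g := by
    apply WithConv.ext
    exact LinearMap.convMul_comp_coalgHom_distrib f g h

/-- A scalar valued linear form viewed as an `A`-valued one through the unit `k → A`, as a
morphism of convolution monoids `Hom(C, k) → Hom(C, A)`. -/
def convScalar (A : Type v) [Ring A] [Algebra k A] {C : Type w} [AddCommGroup C] [Module k C]
    [Coalgebra k C] : WithConv (C →ₗ[k] k) →* WithConv (C →ₗ[k] A) where
  toFun f := WithConv.toConv (Algebra.linearMap k A ∘ₗ f.ofConv)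
  map_one' := by
    ext x
    simp [LinearMap.convOne_def]
  map_mul' f g := by
    apply WithConv.ext
    exact LinearMap.algHom_comp_convMul_distrib (Algebra.ofId k A) f g

theorem convPull_apply {C : Type v} {D : Type w} [AddCommGroup C] [Module k C] [Coalgebra k C]
    [AddCommGroup D] [Module k D] [Coalgebra k D] (h : C →ₗc[k] D) (f : WithConv (D →ₗ[k] k))
    (x : C) : convPull h f x = f (h x) := rfl

theorem convScalar_apply (A : Type v) [Ring A] [Algebra k A] {C : Type w} [AddCommGroup C]
    [Module k C] [Coalgebra k C] (f : WithConv (C →ₗ[k] k)) (x : C) :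
    convScalar A f x = algebraMap k A (f x) := rfl

/-- The coalgebra morphism `id ⊗ ε : C ⊗ D → C`. -/
def fstHom (k : Type u) [CommRing k] (C : Type v) (D : Type w) [AddCommGroup C] [Module k C]
    [Coalgebra k C] [AddCommGroup D] [Module k D] [Coalgebra k D] : C ⊗[k] D →ₗc[k] C :=
  (Coalgebra.TensorProduct.rid k k C : C ⊗[k] k →ₗc[k] C).comp
    (Coalgebra.TensorProduct.map (CoalgHom.id k C) (counitCoalgHom k D))

/-- The coalgebra morphism `ε ⊗ id : C ⊗ D → D`. -/
def sndHom (k : Type u) [CommRing k] (C : Type v) (D : Type w) [AddCommGroup C] [Module k C]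
    [Coalgebra k C] [AddCommGroup D] [Module k D] [Coalgebra k D] : C ⊗[k] D →ₗc[k] D :=
  (Coalgebra.TensorProduct.lid k D : k ⊗[k] D →ₗc[k] D).comp
    (Coalgebra.TensorProduct.map (counitCoalgHom k C) (CoalgHom.id k D))

theorem fstHom_tmul {C : Type v} {D : Type w} [AddCommGroup C] [Module k C]
    [Coalgebra k C] [AddCommGroup D] [Module k D] [Coalgebra k D] (c : C) (d : D) :
    fstHom k C D (c ⊗ₜ d) = counit (R := k) d • c := by
  simp [fstHom]

theorem sndHom_tmul {C : Type v} {D : Type w} [AddCommGroup C] [Module k C]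
    [Coalgebra k C] [AddCommGroup D] [Module k D] [Coalgebra k D] (c : C) (d : D) :
    sndHom k C D (c ⊗ₜ d) = counit (R := k) c • d := by
  simp [sndHom]

theorem sum_smul_counit {D : Type w} [AddCommGroup D] [Module k D] [Coalgebra k D] (d : D) :
    ∑ j ∈ (ℛ k d).index, counit (R := k) ((ℛ k d).right j) • (ℛ k d).left j = d := by
  have h := congrArg (TensorProduct.rid k D) (sum_tmul_counit_eq (R := k) (ℛ k d))
  simpa only [map_sum, TensorProduct.rid_tmul, one_smul] using h

theorem convMul_tmul {C : Type v} {D : Type w} [AddCommGroup C] [Module k C]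
    [Coalgebra k C] [AddCommGroup D] [Module k D] [Coalgebra k D]
    (F G : WithConv (C ⊗[k] D →ₗ[k] k)) (c : C) (d : D) :
    (F * G) (c ⊗ₜ d) = ∑ i ∈ (ℛ k c).index, ∑ j ∈ (ℛ k d).index,
      F ((ℛ k c).left i ⊗ₜ (ℛ k d).left j) * G ((ℛ k c).right i ⊗ₜ (ℛ k d).right j) := by
  rw [LinearMap.convMul_apply, TensorProduct.comul_tmul]
  conv_lhs => rw [← (ℛ k c).eq, ← (ℛ k d).eq]
  simp [TensorProduct.sum_tmul, TensorProduct.tmul_sum]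
  try exact Finset.sum_comm

variable {A : Type v} [Ring A] [Bialgebra k A]

theorem commute_fst {C : Type w} [AddCommGroup C] [Module k C] [Coalgebra k C]
    {D : Type z} [AddCommGroup D] [Module k D] [Coalgebra k D] (g : C →ₗc[k] A)
    (ω : WithConv (C →ₗ[k] k))
    (hω : Commute (convScalar A ω) (WithConv.toConv g.toLinearMap))
    (f : WithConv (A ⊗[k] D →ₗ[k] k)) :
    Commute (convPull (fstHom k C D) ω)
      (convPull (Coalgebra.TensorProduct.map g (CoalgHom.id k D)) f) := by
  have key1 : ∀ (x : C) (d : D), (convPull (fstHom k C D) ω *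
      convPull (Coalgebra.TensorProduct.map g (CoalgHom.id k D)) f) (x ⊗ₜ d) =
      f ((convScalar A ω * WithConv.toConv g.toLinearMap) x ⊗ₜ d) := by
    intro x d
    have hd := Coalgebra.sum_counit_smul (ℛ k d)
    rw [convMul_tmul, (ℛ k x).convMul_apply, TensorProduct.sum_tmul, map_sum]
    refine Finset.sum_congr rfl fun i _ => ?_
    conv_rhs => rw [← hd]
    simp [convPull_apply, convScalar_apply, fstHom_tmul, TensorProduct.tmul_sum,
      ← Algebra.smul_def, ← TensorProduct.smul_tmul']
    refine Finset.sum_congr rfl fun j _ => ?_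
    ring
  have key2 : ∀ (x : C) (d : D), (convPull (Coalgebra.TensorProduct.map g (CoalgHom.id k D)) f *
      convPull (fstHom k C D) ω) (x ⊗ₜ d) =
      f ((WithConv.toConv g.toLinearMap * convScalar A ω) x ⊗ₜ d) := by
    intro x d
    have hd := sum_smul_counit (k := k) d
    rw [convMul_tmul, (ℛ k x).convMul_apply, TensorProduct.sum_tmul, map_sum]
    refine Finset.sum_congr rfl fun i _ => ?_
    conv_rhs => rw [← hd]
    simp [convPull_apply, convScalar_apply, fstHom_tmul, TensorProduct.tmul_sum,
      ← Algebra.commutes, ← Algebra.smul_def, ← TensorProduct.smul_tmul']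
    refine Finset.sum_congr rfl fun j _ => ?_
    ring
  apply WithConv.ext
  ext x d
  have h := (key1 x d).trans (Eq.trans (by rw [hω.eq]) (key2 x d).symm)
  exact h

theorem commute_snd {C : Type w} [AddCommGroup C] [Module k C] [Coalgebra k C]
    {D : Type z} [AddCommGroup D] [Module k D] [Coalgebra k D] (g : C →ₗc[k] A)
    (ω : WithConv (C →ₗ[k] k))
    (hω : Commute (convScalar A ω) (WithConv.toConv g.toLinearMap))
    (f : WithConv (D ⊗[k] A →ₗ[k] k)) :
    Commute (convPull (sndHom k D C) ω)
      (convPull (Coalgebra.TensorProduct.map (CoalgHom.id k D) g) f) := by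
  have key1 : ∀ (x : C) (d : D), (convPull (sndHom k D C) ω *
      convPull (Coalgebra.TensorProduct.map (CoalgHom.id k D) g) f) (d ⊗ₜ x) =
      f (d ⊗ₜ (convScalar A ω * WithConv.toConv g.toLinearMap) x) := by
    intro x d
    have hd := Coalgebra.sum_counit_smul (ℛ k d)
    rw [convMul_tmul, (ℛ k x).convMul_apply, TensorProduct.tmul_sum, map_sum, Finset.sum_comm]
    refine Finset.sum_congr rfl fun i _ => ?_
    conv_rhs => rw [← hd]
    simp [convPull_apply, convScalar_apply, sndHom_tmul, TensorProduct.sum_tmul,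
      ← Algebra.smul_def, ← TensorProduct.smul_tmul', Finset.mul_sum]
    refine Finset.sum_congr rfl fun j _ => ?_
    ring
  have key2 : ∀ (x : C) (d : D), (convPull (Coalgebra.TensorProduct.map (CoalgHom.id k D) g) f *
      convPull (sndHom k D C) ω) (d ⊗ₜ x) =
      f (d ⊗ₜ (WithConv.toConv g.toLinearMap * convScalar A ω) x) := by
    intro x d
    have hd := sum_smul_counit (k := k) d
    rw [convMul_tmul, (ℛ k x).convMul_apply, TensorProduct.tmul_sum, map_sum, Finset.sum_comm]
    refine Finset.sum_congr rfl fun i _ => ?_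
    conv_rhs => rw [← hd]
    simp [convPull_apply, convScalar_apply, sndHom_tmul, TensorProduct.sum_tmul,
      ← Algebra.commutes, ← Algebra.smul_def, ← TensorProduct.smul_tmul', Finset.mul_sum]
    refine Finset.sum_congr rfl fun j _ => ?_
    ring
  apply WithConv.ext
  ext d x
  have h := (key1 x d).trans (Eq.trans (by rw [hω.eq]) (key2 x d).symm)
  exact h

end Convolution

/-! ### Lazy cochains, lazy cocycles and the second lazy cohomology group -/

section Cohomology

variable (k : Type u) [CommRing k] (A : Type v) [Ring A] [Bialgebra k A]

/-- The group of convolution invertible linear forms on `A`. -/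
abbrev Conv1 : Type (max u v) := (WithConv (A →ₗ[k] k))ˣ

/-- The group of convolution invertible linear forms on `A ⊗ A`. -/
abbrev Conv2 : Type (max u v) := (WithConv (A ⊗[k] A →ₗ[k] k))ˣ

/-- The group of convolution invertible linear forms on `A ⊗ A ⊗ A`. -/
abbrev Conv3 : Type (max u v) := (WithConv ((A ⊗[k] A) ⊗[k] A →ₗ[k] k))ˣ

/-- `Reg¹(A)`: the convolution invertible `μ : A → k` with `μ(1) = 1`. -/
def Reg1 : Subgroup (Conv1 k A) where
  carrier := {μ | (μ : WithConv (A →ₗ[k] k)) (1 : A) = 1}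
  one_mem' := by simp
  mul_mem' {a b} ha hb := by
    simp only [Set.mem_ofPred_eq] at ha hb ⊢
    simp [Algebra.TensorProduct.one_def, ha, hb]
  inv_mem' {a} ha := by
    simp only [Set.mem_ofPred_eq] at ha ⊢
    have h : ((a * a⁻¹ : Conv1 k A) : WithConv (A →ₗ[k] k)) (1 : A) = 1 := by
      rw [mul_inv_cancel]; simp
    rw [Units.val_mul, LinearMap.convMul_apply, Bialgebra.comul_one,
      Algebra.TensorProduct.one_def] at h
    simpa only [TensorProduct.map_tmul, LinearMap.mul'_apply, ha, one_mul] using h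

/-- The coalgebra morphism `a ↦ a ⊗ 1`. -/
def inlHom : A →ₗc[k] A ⊗[k] A where
  toLinearMap := (TensorProduct.mk k A A).flip 1
  counit_comp := by ext; simp
  map_comp_comul := by
    ext a
    simp [← (ℛ k a).eq, TensorProduct.sum_tmul, Algebra.TensorProduct.one_def]

/-- The coalgebra morphism `a ↦ 1 ⊗ a`. -/
def inrHom : A →ₗc[k] A ⊗[k] A where
  toLinearMap := TensorProduct.mk k A A 1
  counit_comp := by ext; simp
  map_comp_comul := by
    ext a
    simp [← (ℛ k a).eq, TensorProduct.tmul_sum, Algebra.TensorProduct.one_def]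

theorem mem_reg2_iff (σ : Conv2 k A) :
    (σ ∈ {σ : Conv2 k A |
      ∀ a : A, (σ : WithConv (A ⊗[k] A →ₗ[k] k)) (a ⊗ₜ 1) = counit (R := k) a ∧
        (σ : WithConv (A ⊗[k] A →ₗ[k] k)) (1 ⊗ₜ a) = counit (R := k) a}) ↔
    Units.map (convPull (inlHom k A)) σ = 1 ∧ Units.map (convPull (inrHom k A)) σ = 1 := by
  constructor
  · intro h
    refine ⟨Units.ext (WithConv.ext (LinearMap.ext fun a => ?_)),
      Units.ext (WithConv.ext (LinearMap.ext fun a => ?_))⟩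
    · exact (h a).1
    · exact (h a).2
  · intro h a
    have h1 := congrArg (fun f : Conv1 k A => (f : WithConv (A →ₗ[k] k)) a) h.1
    have h2 := congrArg (fun f : Conv1 k A => (f : WithConv (A →ₗ[k] k)) a) h.2
    exact ⟨h1, h2⟩

/-- `Reg²(A)`: the convolution invertible `σ : A ⊗ A → k` with `σ(a, 1) = ε(a) = σ(1, a)`. -/
def Reg2 : Subgroup (Conv2 k A) where
  carrier := {σ | ∀ a : A, (σ : WithConv (A ⊗[k] A →ₗ[k] k)) (a ⊗ₜ 1) = counit (R := k) a ∧
    (σ : WithConv (A ⊗[k] A →ₗ[k] k)) (1 ⊗ₜ a) = counit (R := k) a}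
  one_mem' := by intro a; simp
  mul_mem' {σ τ} hσ hτ := by
    rw [mem_reg2_iff] at hσ hτ ⊢
    simp only [map_mul, hσ.1, hσ.2, hτ.1, hτ.2, mul_one, and_self]
  inv_mem' {σ} hσ := by
    rw [mem_reg2_iff] at hσ ⊢
    simp only [map_inv, hσ.1, hσ.2, inv_one, and_self]

variable {k A}

/-- The lazy elements `μ` of `Hom(A, k)`: those with `μ * id = id * μ` in `Hom(A, A)`. -/
def IsLazy1 (μ : Conv1 k A) : Prop :=
  Commute (convScalar A (μ : WithConv (A →ₗ[k] k))) (WithConv.toConv (LinearMap.id : A →ₗ[k] A))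

/-- The lazy elements `σ` of `Hom(A ⊗ A, k)`: those with `σ * m = m * σ` in `Hom(A ⊗ A, A)`,
where `m` is the product of `A`; that is `σ(a₁, b₁) a₂ b₂ = σ(a₂, b₂) a₁ b₁`. -/
def IsLazy2 (σ : Conv2 k A) : Prop :=
  Commute (convScalar A (σ : WithConv (A ⊗[k] A →ₗ[k] k))) (WithConv.toConv (LinearMap.mul' k A))

/-- The form `σ(a, b) ε(c)` on `A ⊗ A ⊗ A`. -/
def face12 : Conv2 k A →* Conv3 k A :=
  Units.map (convPull (fstHom k (A ⊗[k] A) A))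

/-- The form `σ(ab, c)` on `A ⊗ A ⊗ A`. -/
def faceMulLeft : Conv2 k A →* Conv3 k A :=
  Units.map (convPull (Coalgebra.TensorProduct.map (Bialgebra.mulCoalgHom k A) (CoalgHom.id k A)))

/-- The form `ε(a) σ(b, c)` on `A ⊗ A ⊗ A`. -/
def face23 : Conv2 k A →* Conv3 k A :=
  (Units.map (convPull (Coalgebra.TensorProduct.assoc k k A A A :
    (A ⊗[k] A) ⊗[k] A →ₗc[k] A ⊗[k] (A ⊗[k] A)))).comp
    (Units.map (convPull (sndHom k A (A ⊗[k] A))))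

/-- The form `σ(a, bc)` on `A ⊗ A ⊗ A`. -/
def faceMulRight : Conv2 k A →* Conv3 k A :=
  (Units.map (convPull (Coalgebra.TensorProduct.assoc k k A A A :
    (A ⊗[k] A) ⊗[k] A →ₗc[k] A ⊗[k] (A ⊗[k] A)))).comp
    (Units.map (convPull (Coalgebra.TensorProduct.map (CoalgHom.id k A)
      (Bialgebra.mulCoalgHom k A))))

theorem face12_apply (σ : Conv2 k A) (a b c : A) :
    (face12 σ).val ((a ⊗ₜ b) ⊗ₜ c) = counit (R := k) c * σ.val (a ⊗ₜ b) := by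
  change σ.val.ofConv (fstHom k (A ⊗[k] A) A ((a ⊗ₜ b) ⊗ₜ c)) = _
  rw [fstHom_tmul, map_smul, smul_eq_mul]

theorem faceMulLeft_apply (σ : Conv2 k A) (a b c : A) :
    (faceMulLeft σ).val ((a ⊗ₜ b) ⊗ₜ c) = σ.val ((a * b) ⊗ₜ c) := rfl

theorem face23_apply (σ : Conv2 k A) (a b c : A) :
    (face23 σ).val ((a ⊗ₜ b) ⊗ₜ c) = counit (R := k) a * σ.val (b ⊗ₜ c) := by
  change σ.val.ofConv (sndHom k A (A ⊗[k] A) (a ⊗ₜ (b ⊗ₜ c))) = _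
  rw [sndHom_tmul, map_smul, smul_eq_mul]

theorem faceMulRight_apply (σ : Conv2 k A) (a b c : A) :
    (faceMulRight σ).val ((a ⊗ₜ b) ⊗ₜ c) = σ.val (a ⊗ₜ (b * c)) := rfl

/-- The left 2-cocycle identity `σ(a₁, b₁) σ(a₂ b₂, c) = σ(b₁, c₁) σ(a, b₂ c₂)`, as an equality
of convolution products of linear forms on `A ⊗ A ⊗ A`. -/
def IsLeftCocycle (σ : Conv2 k A) : Prop :=
  face12 σ * faceMulLeft σ = face23 σ * faceMulRight σ

/-- The form `∂μ = (μ ⊗ μ) * (μ⁻¹ ∘ m)`, i.e. `∂μ(a, b) = μ(a₁) μ(b₁) μ⁻¹(a₂ b₂)`. Here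
`μ ⊗ μ` is written as the convolution product of `μ ∘ (id ⊗ ε)` and `μ ∘ (ε ⊗ id)`. -/
def coboundary (μ : Conv1 k A) : Conv2 k A :=
  Units.map (convPull (fstHom k A A)) μ * Units.map (convPull (sndHom k A A)) μ *
    Units.map (convPull (Bialgebra.mulCoalgHom k A)) μ⁻¹

variable (k A)

/-- `Reg¹_L(A)`: the lazy elements of `Reg¹(A)`. -/
def Reg1L : Subgroup (Conv1 k A) where
  carrier := {μ | μ ∈ Reg1 k A ∧ IsLazy1 μ}
  one_mem' := ⟨one_mem _, by simp [IsLazy1]⟩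
  mul_mem' {a b} ha hb := ⟨mul_mem ha.1 hb.1, by
    have := Commute.mul_left ha.2 hb.2
    simpa [IsLazy1] using this⟩
  inv_mem' {a} ha := ⟨inv_mem ha.1, by
    have h : Commute ((Units.map (convScalar A) a : (WithConv (A →ₗ[k] A))ˣ) :
      WithConv (A →ₗ[k] A)) _ := ha.2
    exact h.units_inv_left⟩

/-- `Reg²_L(A)`: the lazy elements of `Reg²(A)`. -/
def Reg2L : Subgroup (Conv2 k A) where
  carrier := {σ | σ ∈ Reg2 k A ∧ IsLazy2 σ}
  one_mem' := ⟨one_mem _, by simp [IsLazy2]⟩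
  mul_mem' {a b} ha hb := ⟨mul_mem ha.1 hb.1, by
    have := Commute.mul_left ha.2 hb.2
    simpa [IsLazy2] using this⟩
  inv_mem' {a} ha := ⟨inv_mem ha.1, by
    have h : Commute ((Units.map (convScalar A) a : (WithConv (A ⊗[k] A →ₗ[k] A))ˣ) :
      WithConv (A ⊗[k] A →ₗ[k] A)) _ := ha.2
    exact h.units_inv_left⟩

variable {k A}

theorem IsLazy2.commute_left {σ : Conv2 k A} (hσ : IsLazy2 σ) (τ : Conv2 k A) :
    Commute (face12 σ) (faceMulLeft τ) :=
  Units.ext (commute_fst (Bialgebra.mulCoalgHom k A) σ.val hσ τ.val)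

theorem IsLazy2.commute_right {σ : Conv2 k A} (hσ : IsLazy2 σ) (τ : Conv2 k A) :
    Commute (face23 σ) (faceMulRight τ) := by
  have h : Commute (Units.map (convPull (sndHom k A (A ⊗[k] A))) σ)
      (Units.map (convPull (Coalgebra.TensorProduct.map (CoalgHom.id k A)
        (Bialgebra.mulCoalgHom k A))) τ) :=
    Units.ext (commute_snd (Bialgebra.mulCoalgHom k A) σ.val hσ τ.val)
  exact h.map (Units.map (convPull (Coalgebra.TensorProduct.assoc k k A A A :
    (A ⊗[k] A) ⊗[k] A →ₗc[k] A ⊗[k] (A ⊗[k] A))))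

theorem IsLazy1.commute_fst {μ : Conv1 k A} (hμ : IsLazy1 μ) (f : Conv2 k A) :
    Commute (Units.map (convPull (fstHom k A A)) μ) f := by
  have h := LazyCohomology.commute_fst (D := A) (CoalgHom.id k A) μ.val hμ f.val
  have e : convPull (Coalgebra.TensorProduct.map (CoalgHom.id k A) (CoalgHom.id k A)) f.val
      = f.val := by
    apply WithConv.ext
    ext a b
    rfl
  rw [e] at h
  exact Units.ext h

theorem IsLazy1.commute_snd {μ : Conv1 k A} (hμ : IsLazy1 μ) (f : Conv2 k A) :
    Commute (Units.map (convPull (sndHom k A A)) μ) f := by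
  have h := LazyCohomology.commute_snd (D := A) (CoalgHom.id k A) μ.val hμ f.val
  have e : convPull (Coalgebra.TensorProduct.map (CoalgHom.id k A) (CoalgHom.id k A)) f.val
      = f.val := by
    apply WithConv.ext
    ext a b
    rfl
  rw [e] at h
  exact Units.ext h

/-- Composition with a linear form `f : A → k`, as a map `Hom(C, A) → Hom(C, k)`. -/
theorem comp_scalar_mul {C : Type w} [AddCommGroup C] [Module k C] [Coalgebra k C]
    (f : A →ₗ[k] k) (ω : WithConv (C →ₗ[k] k)) (g : C →ₗ[k] A) :
    f ∘ₗ (convScalar A ω * WithConv.toConv g).ofConv =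
      (ω * WithConv.toConv (f ∘ₗ g)).ofConv := by
  ext x
  have h1 := (ℛ k x).convMul_apply (convScalar A ω) (WithConv.toConv g)
  have h2 := (ℛ k x).convMul_apply ω (WithConv.toConv (f ∘ₗ g))
  rw [h2, LinearMap.comp_apply, h1]
  simp [convScalar_apply, ← Algebra.smul_def]

theorem comp_mul_scalar {C : Type w} [AddCommGroup C] [Module k C] [Coalgebra k C]
    (f : A →ₗ[k] k) (ω : WithConv (C →ₗ[k] k)) (g : C →ₗ[k] A) :
    f ∘ₗ (WithConv.toConv g * convScalar A ω).ofConv =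
      (WithConv.toConv (f ∘ₗ g) * ω).ofConv := by
  ext x
  have h1 := (ℛ k x).convMul_apply (WithConv.toConv g) (convScalar A ω)
  have h2 := (ℛ k x).convMul_apply (WithConv.toConv (f ∘ₗ g)) ω
  rw [h2, LinearMap.comp_apply, h1]
  simp [convScalar_apply, ← Algebra.commutes, ← Algebra.smul_def, mul_comm]

theorem IsLazy1.commute {μ : Conv1 k A} (hμ : IsLazy1 μ) (φ : Conv1 k A) : Commute μ φ := by
  refine Units.ext (WithConv.ext ?_)
  have h1 := comp_scalar_mul φ.val.ofConv μ.val LinearMap.id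
  have h2 := comp_mul_scalar φ.val.ofConv μ.val LinearMap.id
  rw [hμ.eq, h2] at h1
  exact h1.symm

theorem IsLazy2.commute_mul {σ : Conv2 k A} (hσ : IsLazy2 σ) (μ : Conv1 k A) :
    Commute σ (Units.map (convPull (Bialgebra.mulCoalgHom k A)) μ) := by
  refine Units.ext (WithConv.ext ?_)
  have h1 := comp_scalar_mul μ.val.ofConv σ.val (LinearMap.mul' k A)
  have h2 := comp_mul_scalar μ.val.ofConv σ.val (LinearMap.mul' k A)
  rw [hσ.eq, h2] at h1
  exact h1.symm

theorem coboundary_one : coboundary (1 : Conv1 k A) = 1 := by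
  simp [coboundary]

theorem coboundary_mul {μ φ : Conv1 k A} (hμ : IsLazy1 μ) (hφ : IsLazy1 φ) :
    coboundary (μ * φ) = coboundary μ * coboundary φ := by
  have e : (μ * φ)⁻¹ = μ⁻¹ * φ⁻¹ := (hμ.commute φ).mul_inv
  have c1 := hμ.commute_snd (Units.map (convPull (fstHom k A A)) φ)
  simp only [coboundary, e, map_mul]
  generalize Units.map (convPull (Bialgebra.mulCoalgHom k A)) μ⁻¹ = x
  generalize Units.map (convPull (Bialgebra.mulCoalgHom k A)) φ⁻¹ = y
  have c2 := hφ.commute_fst x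
  have c3 := hφ.commute_snd x
  rw [c1.symm.mul_mul_mul_comm]
  exact ((c2.mul_left c3).mul_mul_mul_comm _ _)

theorem coboundary_inv {μ : Conv1 k A} (hμ : IsLazy1 μ) (hμ' : IsLazy1 μ⁻¹) :
    coboundary μ⁻¹ = (coboundary μ)⁻¹ := by
  rw [eq_inv_iff_mul_eq_one, ← coboundary_mul hμ' hμ, inv_mul_cancel, coboundary_one]

theorem IsLazy2.commute_coboundary {σ : Conv2 k A} (hσ : IsLazy2 σ) {μ : Conv1 k A}
    (hμ : IsLazy1 μ) : Commute σ (coboundary μ) :=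
  ((hμ.commute_fst σ).symm.mul_right (hμ.commute_snd σ).symm).mul_right (hσ.commute_mul _)

variable (k A)

/-- `Z²_L(A)`: the group of lazy (left) 2-cocycles, `Z²(A) ∩ Reg²_L(A)`. -/
def ZL2 : Subgroup (Conv2 k A) where
  carrier := {σ | σ ∈ Reg2L k A ∧ IsLeftCocycle σ}
  one_mem' := ⟨one_mem _, by simp [IsLeftCocycle]⟩
  mul_mem' {σ τ} hσ hτ := ⟨mul_mem hσ.1 hτ.1, by
    have h1 : face12 σ * faceMulLeft σ = _ := hσ.2
    have h2 : face12 τ * faceMulLeft τ = _ := hτ.2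
    simp only [IsLeftCocycle, map_mul]
    rw [(hτ.1.2.commute_left σ).mul_mul_mul_comm, h1, h2,
      (hτ.1.2.commute_right σ).symm.mul_mul_mul_comm]⟩
  inv_mem' {σ} hσ := ⟨inv_mem hσ.1, by
    have h : face12 σ * faceMulLeft σ = _ := hσ.2
    simp only [IsLeftCocycle, map_inv]
    rw [← (hσ.1.2.commute_left σ).mul_inv, h, (hσ.1.2.commute_right σ).mul_inv]⟩

/-- `B²_L(A)`: the elements of `Z²_L(A)` of the form `∂μ` with `μ ∈ Reg¹_L(A)`. -/
def BL2 : Subgroup (ZL2 k A) where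
  carrier := {σ | ∃ μ ∈ Reg1L k A, (σ : Conv2 k A) = coboundary μ}
  one_mem' := ⟨1, one_mem _, coboundary_one.symm⟩
  mul_mem' {σ τ} := by
    rintro ⟨μ, hμ, h⟩ ⟨φ, hφ, h'⟩
    exact ⟨μ * φ, mul_mem hμ hφ, by rw [coboundary_mul hμ.2 hφ.2, ← h, ← h']; rfl⟩
  inv_mem' {σ} := by
    rintro ⟨μ, hμ, h⟩
    exact ⟨μ⁻¹, inv_mem hμ, by rw [coboundary_inv hμ.2 (inv_mem hμ).2, ← h]; rfl⟩

instance BL2_normal : (BL2 k A).Normal where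
  conj_mem := by
    rintro σ ⟨μ, hμ, h⟩ τ
    refine ⟨μ, hμ, ?_⟩
    have c := τ.2.1.2.commute_coboundary hμ.2
    simp only [Subgroup.coe_mul, Subgroup.coe_inv, h]
    rw [c.eq, mul_inv_cancel_right]

/-- The second lazy cohomology group `H²_L(A) = Z²_L(A) / B²_L(A)`. -/
abbrev HL2 : Type (max u v) := ZL2 k A ⧸ BL2 k A

end Cohomology
/-! ### biGalois objects -/

section Galois

variable {k : Type u} [CommRing k]

/-- `β : Z → A ⊗ Z` makes the algebra `Z` a left `A`-Galois object: `Z` is a non-zero left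
`A`-comodule algebra whose algebra of coinvariants is `k`, and the map
`x ⊗ y ↦ x₍₋₁₎ ⊗ x₍₀₎ y` is bijective. -/
structure IsLeftGalois {A : Type v} [Ring A] [Bialgebra k A] {Z : Type w} [Ring Z] [Algebra k Z]
    (β : Z →ₐ[k] A ⊗[k] Z) : Prop where
  coassoc : (TensorProduct.assoc k A A Z).toLinearMap ∘ₗ (comul (R := k) (A := A)).rTensor Z ∘ₗ
    β.toLinearMap = β.toLinearMap.lTensor A ∘ₗ β.toLinearMap
  counit_comp : (TensorProduct.lid k Z).toLinearMap ∘ₗ (counit (R := k) (A := A)).rTensor Z ∘ₗ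
    β.toLinearMap = LinearMap.id
  nontrivial : Nontrivial Z
  injective_algebraMap : Function.Injective (algebraMap k Z)
  coinvariants : ∀ z : Z, β z = 1 ⊗ₜ[k] z ↔ z ∈ Set.range (algebraMap k Z)
  bijective : Function.Bijective ((LinearMap.mul' k Z).lTensor A ∘ₗ
    (TensorProduct.assoc k A Z Z).toLinearMap ∘ₗ β.toLinearMap.rTensor Z :
      Z ⊗[k] Z →ₗ[k] A ⊗[k] Z)

/-- `ρ : Z → Z ⊗ B` makes the algebra `Z` a right `B`-Galois object: `Z` is a non-zero right
`B`-comodule algebra whose algebra of coinvariants is `k`, and the map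
`x ⊗ y ↦ x y₍₀₎ ⊗ y₍₁₎` is bijective. -/
structure IsRightGalois {B : Type v} [Ring B] [Bialgebra k B] {Z : Type w} [Ring Z] [Algebra k Z]
    (ρ : Z →ₐ[k] Z ⊗[k] B) : Prop where
  coassoc : (TensorProduct.assoc k Z B B).toLinearMap ∘ₗ ρ.toLinearMap.rTensor B ∘ₗ
    ρ.toLinearMap = (comul (R := k) (A := B)).lTensor Z ∘ₗ ρ.toLinearMap
  counit_comp : (TensorProduct.rid k Z).toLinearMap ∘ₗ (counit (R := k) (A := B)).lTensor Z ∘ₗ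
    ρ.toLinearMap = LinearMap.id
  nontrivial : Nontrivial Z
  injective_algebraMap : Function.Injective (algebraMap k Z)
  coinvariants : ∀ z : Z, ρ z = z ⊗ₜ[k] 1 ↔ z ∈ Set.range (algebraMap k Z)
  bijective : Function.Bijective ((LinearMap.mul' k Z).rTensor B ∘ₗ
    (TensorProduct.assoc k Z Z B).symm.toLinearMap ∘ₗ ρ.toLinearMap.lTensor Z :
      Z ⊗[k] Z →ₗ[k] Z ⊗[k] B)

/-- `Z` with the coactions `β` and `ρ` is an `A`-`B`-biGalois object: it is a left `A`-Galois
object, a right `B`-Galois object and an `A`-`B`-bicomodule. -/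
structure IsBiGalois {A : Type v} [Ring A] [Bialgebra k A] {B : Type w} [Ring B] [Bialgebra k B]
    {Z : Type z} [Ring Z] [Algebra k Z] (β : Z →ₐ[k] A ⊗[k] Z) (ρ : Z →ₐ[k] Z ⊗[k] B) : Prop where
  left : IsLeftGalois β
  right : IsRightGalois ρ
  bicomodule : (TensorProduct.assoc k A Z B).toLinearMap ∘ₗ β.toLinearMap.rTensor B ∘ₗ
    ρ.toLinearMap = ρ.toLinearMap.lTensor A ∘ₗ β.toLinearMap

end Galois

/-! ### Cocycle twists -/

/-- `B` is isomorphic to the twist of `A` by some 2-cocycle `ω`, the bialgebra with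
the same coalgebra as `A` and with product `ω(a₁, b₁) a₂ b₂ ω⁻¹(a₃, b₃)`. The product is the
convolution product `ω * m * ω⁻¹` in `Hom(A ⊗ A, A)`. -/
def IsCocycleTwist (k : Type u) [CommRing k] (A : Type v) [Ring A] [Bialgebra k A]
    (B : Type w) [Ring B] [Bialgebra k B] : Prop :=
  ∃ ω : Conv2 k A, ω ∈ Reg2 k A ∧ IsLeftCocycle ω ∧ ∃ e : A ≃ₗc[k] B, e 1 = 1 ∧ ∀ a b : A,
    e a * e b = e ((convScalar A ω.val * WithConv.toConv (LinearMap.mul' k A) *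
      convScalar A (ω⁻¹).val) (a ⊗ₜ[k] b))

/-! ### The monoidal category of comodules -/

/-- A right comodule over `A`. -/
structure Comod (k A : Type u) [CommRing k] [Ring A] [Bialgebra k A] : Type (u + 1) where
  carrier : Type u
  [addCommGroup : AddCommGroup carrier]
  [module : Module k carrier]
  coact : carrier →ₗ[k] carrier ⊗[k] A
  coassoc : (TensorProduct.assoc k carrier A A).toLinearMap ∘ₗ coact.rTensor A ∘ₗ coact =
    (comul (R := k) (A := A)).lTensor carrier ∘ₗ coact
  counit_comp : (TensorProduct.rid k carrier).toLinearMap ∘ₗ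
    (counit (R := k) (A := A)).lTensor carrier ∘ₗ coact = LinearMap.id

namespace Comod

variable {k A : Type u} [CommRing k] [Ring A] [Bialgebra k A]

instance : CoeSort (Comod k A) (Type u) := ⟨Comod.carrier⟩

instance (V : Comod k A) : AddCommGroup V := V.addCommGroup

instance (V : Comod k A) : Module k V := V.module

/-- A colinear map. -/
@[ext]
structure Hom (V W : Comod k A) : Type u where
  lin : V →ₗ[k] W
  colinear : W.coact ∘ₗ lin = lin.rTensor A ∘ₗ V.coact

instance : Category (Comod k A) where
  Hom V W := Hom V W
  id V := ⟨LinearMap.id, by simp⟩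
  comp f g := ⟨g.lin ∘ₗ f.lin, by
    rw [← LinearMap.comp_assoc, g.colinear, LinearMap.comp_assoc, f.colinear,
      LinearMap.rTensor_comp, LinearMap.comp_assoc]⟩

@[ext]
theorem hom_ext {V W : Comod k A} {f g : V ⟶ W} (h : Hom.lin f = Hom.lin g) : f = g :=
  Hom.ext h

@[simp]
theorem id_lin (V : Comod k A) : Hom.lin (𝟙 V) = LinearMap.id := rfl

@[simp]
theorem comp_lin {V W X : Comod k A} (f : V ⟶ W) (g : W ⟶ X) :
    Hom.lin (f ≫ g) = Hom.lin g ∘ₗ Hom.lin f := rfl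

/-- Colinear maps as a submodule of the linear maps. -/
def homSubmodule (V W : Comod k A) : Submodule k (V →ₗ[k] W) where
  carrier := {f | W.coact ∘ₗ f = f.rTensor A ∘ₗ V.coact}
  add_mem' {f g} hf hg := by
    simp only [Set.mem_ofPred_eq] at hf hg ⊢
    rw [LinearMap.comp_add, hf, hg, LinearMap.rTensor_add, LinearMap.add_comp]
  zero_mem' := by simp
  smul_mem' r f hf := by
    simp only [Set.mem_ofPred_eq] at hf ⊢
    rw [LinearMap.comp_smul, hf, LinearMap.rTensor_smul, LinearMap.smul_comp]

/-- Morphisms of comodules are the elements of `homSubmodule`. -/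
def homEquiv (V W : Comod k A) : (V ⟶ W) ≃ homSubmodule V W where
  toFun f := ⟨Hom.lin f, Hom.colinear f⟩
  invFun f := ⟨f.1, f.2⟩

instance (V W : Comod k A) : AddCommGroup (V ⟶ W) := (homEquiv V W).addCommGroup

instance (V W : Comod k A) : Module k (V ⟶ W) := (homEquiv V W).module k

@[simp]
theorem add_lin {V W : Comod k A} (f g : V ⟶ W) :
    Hom.lin (f + g) = Hom.lin f + Hom.lin g := rfl

@[simp]
theorem smul_lin {V W : Comod k A} (r : k) (f : V ⟶ W) :
    Hom.lin (r • f) = r • Hom.lin f := rfl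

instance : Preadditive (Comod k A) where
  add_comp _ _ _ f g h := hom_ext (LinearMap.comp_add f.lin g.lin h.lin)
  comp_add _ _ _ f g h := hom_ext (LinearMap.add_comp f.lin h.lin g.lin)

instance : Linear k (Comod k A) where
  homModule V W := (homEquiv V W).module k
  smul_comp _ _ _ r f g := hom_ext (LinearMap.comp_smul g.lin r f.lin)
  comp_smul _ _ _ f r g := hom_ext (LinearMap.smul_comp r g.lin f.lin)

/-- The forgetful functor to `k`-modules. -/
def forgetful (k A : Type u) [CommRing k] [Ring A] [Bialgebra k A] :
    Comod k A ⥤ ModuleCat.{u} k where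
  obj V := ModuleCat.of k V
  map f := ModuleCat.ofHom (Hom.lin f)

instance : (forgetful k A).Faithful where
  map_injective h := hom_ext (congrArg ModuleCat.Hom.hom h)

/-- The codiagonal coaction `v ⊗ w ↦ v₀ ⊗ w₀ ⊗ v₁ w₁` on the tensor product. -/
def tensorCoact (V W : Comod k A) : V ⊗[k] W →ₗ[k] (V ⊗[k] W) ⊗[k] A :=
  (LinearMap.mul' k A).lTensor (V ⊗[k] W) ∘ₗ
    (TensorProduct.tensorTensorTensorComm k V A W A).toLinearMap ∘ₗ
      TensorProduct.map V.coact W.coact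

theorem coassoc_apply (V : Comod k A) (v : V) :
    TensorProduct.assoc k V A A (V.coact.rTensor A (V.coact v)) =
      (comul (R := k) (A := A)).lTensor V (V.coact v) :=
  LinearMap.congr_fun V.coassoc v

theorem counit_apply (V : Comod k A) (v : V) :
    TensorProduct.rid k V ((counit (R := k) (A := A)).lTensor V (V.coact v)) = v :=
  LinearMap.congr_fun V.counit_comp v

/-- The product map `(V ⊗ R) ⊗ (W ⊗ R) → (V ⊗ W) ⊗ R` for an algebra `R`. -/
def mulRight (V W R : Type u) [AddCommGroup V] [Module k V] [AddCommGroup W] [Module k W] [Ring R]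
    [Algebra k R] : (V ⊗[k] R) ⊗[k] (W ⊗[k] R) →ₗ[k] (V ⊗[k] W) ⊗[k] R :=
  (LinearMap.mul' k R).lTensor (V ⊗[k] W) ∘ₗ
    (TensorProduct.tensorTensorTensorComm k V R W R).toLinearMap

@[simp]
theorem mulRight_tmul {V W R : Type u} [AddCommGroup V] [Module k V] [AddCommGroup W] [Module k W]
    [Ring R] [Algebra k R] (v : V) (w : W) (a b : R) :
    mulRight (k := k) V W R ((v ⊗ₜ a) ⊗ₜ (w ⊗ₜ b)) = (v ⊗ₜ w) ⊗ₜ (a * b) := rfl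

theorem tensorCoact_tmul (V W : Comod k A) (v : V) (w : W) :
    tensorCoact V W (v ⊗ₜ w) = mulRight V W A (V.coact v ⊗ₜ W.coact w) := rfl

theorem rTensor_tensorCoact (V W : Comod k A) (t : V ⊗[k] A) (s : W ⊗[k] A) :
    TensorProduct.assoc k (V ⊗[k] W) A A ((tensorCoact V W).rTensor A (mulRight V W A (t ⊗ₜ s))) =
      mulRight V W (A ⊗[k] A) (TensorProduct.assoc k V A A (V.coact.rTensor A t) ⊗ₜ
        TensorProduct.assoc k W A A (W.coact.rTensor A s)) := by
  induction t with
  | zero => simp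
  | add x y hx hy => simp only [TensorProduct.add_tmul, map_add, hx, hy]
  | tmul v a =>
    induction s with
    | zero => simp
    | add x y hx hy => simp only [TensorProduct.tmul_add, map_add, hx, hy]
    | tmul w b =>
      rw [mulRight_tmul, LinearMap.rTensor_tmul, LinearMap.rTensor_tmul, LinearMap.rTensor_tmul,
        tensorCoact_tmul]
      generalize V.coact v = t
      generalize W.coact w = s
      induction t with
      | zero => simp
      | add x y hx hy => simp only [TensorProduct.add_tmul, map_add, hx, hy]
      | tmul v a =>
        induction s with
        | zero => simp
        | add x y hx hy => simp only [TensorProduct.tmul_add, TensorProduct.add_tmul, map_add,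
            hx, hy]
        | tmul w b => simp

theorem lTensor_mulRight {V W R S : Type u} [AddCommGroup V] [Module k V] [AddCommGroup W]
    [Module k W] [Ring R] [Algebra k R] [Ring S] [Algebra k S] (f : R →ₐ[k] S)
    (t : V ⊗[k] R) (s : W ⊗[k] R) :
    f.toLinearMap.lTensor (V ⊗[k] W) (mulRight V W R (t ⊗ₜ s)) =
      mulRight V W S (f.toLinearMap.lTensor V t ⊗ₜ f.toLinearMap.lTensor W s) := by
  induction t with
  | zero => simp
  | add x y hx hy => simp only [TensorProduct.add_tmul, map_add, hx, hy]
  | tmul v a =>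
    induction s with
    | zero => simp
    | add x y hx hy => simp only [TensorProduct.tmul_add, map_add, hx, hy]
    | tmul w b => simp

theorem rid_mulRight {V W : Type u} [AddCommGroup V] [Module k V] [AddCommGroup W]
    [Module k W] (t : V ⊗[k] k) (s : W ⊗[k] k) :
    TensorProduct.rid k (V ⊗[k] W) (mulRight V W k (t ⊗ₜ s)) =
      TensorProduct.rid k V t ⊗ₜ TensorProduct.rid k W s := by
  induction t with
  | zero => simp
  | add x y hx hy => simp only [TensorProduct.add_tmul, map_add, hx, hy]
  | tmul v a =>
    induction s with
    | zero => simp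
    | add x y hx hy => simp only [TensorProduct.tmul_add, map_add, hx, hy]
    | tmul w b =>
      simp only [mulRight_tmul, TensorProduct.rid_tmul, TensorProduct.smul_tmul_smul]

theorem rTensor_mulRight {V W V' W' R : Type u} [AddCommGroup V] [Module k V] [AddCommGroup W]
    [Module k W] [AddCommGroup V'] [Module k V'] [AddCommGroup W'] [Module k W'] [Ring R]
    [Algebra k R] (f : V →ₗ[k] V') (g : W →ₗ[k] W') (t : V ⊗[k] R) (s : W ⊗[k] R) :
    (TensorProduct.map f g).rTensor R (mulRight V W R (t ⊗ₜ s)) =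
      mulRight V' W' R (f.rTensor R t ⊗ₜ g.rTensor R s) := by
  induction t with
  | zero => simp
  | add x y hx hy => simp only [TensorProduct.add_tmul, map_add, hx, hy]
  | tmul v a =>
    induction s with
    | zero => simp
    | add x y hx hy => simp only [TensorProduct.tmul_add, map_add, hx, hy]
    | tmul w b => simp

/-- The tensor product of two comodules. -/
def tensor (V W : Comod k A) : Comod k A where
  carrier := V ⊗[k] W
  coact := tensorCoact V W
  coassoc := by
    ext v w
    simp only [TensorProduct.AlgebraTensorModule.curry_apply, LinearMap.restrictScalars_self,
      TensorProduct.curry_apply, LinearMap.comp_apply, LinearEquiv.coe_coe]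
    rw [tensorCoact_tmul, rTensor_tensorCoact, coassoc_apply, coassoc_apply]
    exact (lTensor_mulRight (Bialgebra.comulAlgHom k A) _ _).symm
  counit_comp := by
    ext v w
    simp only [TensorProduct.AlgebraTensorModule.curry_apply, LinearMap.restrictScalars_self,
      TensorProduct.curry_apply, LinearMap.comp_apply, LinearEquiv.coe_coe]
    rw [tensorCoact_tmul]
    refine (congrArg (TensorProduct.rid k (V ⊗[k] W))
      (lTensor_mulRight (Bialgebra.counitAlgHom k A) (V.coact v) (W.coact w))).trans ?_
    rw [rid_mulRight]
    exact congrArg₂ (fun x y => x ⊗ₜ[k] y) (counit_apply V v) (counit_apply W w)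

theorem map_colinear {V W V' W' : Comod k A} (f : V ⟶ V') (g : W ⟶ W') :
    tensorCoact V' W' ∘ₗ TensorProduct.map (Hom.lin f) (Hom.lin g) =
      (TensorProduct.map (Hom.lin f) (Hom.lin g)).rTensor A ∘ₗ tensorCoact V W := by
  ext v w
  have hf := LinearMap.congr_fun (Hom.colinear f) v
  have hg := LinearMap.congr_fun (Hom.colinear g) w
  simp only [LinearMap.comp_apply] at hf hg
  simp only [TensorProduct.AlgebraTensorModule.curry_apply, LinearMap.restrictScalars_self,
    TensorProduct.curry_apply, LinearMap.comp_apply, TensorProduct.map_tmul]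
  rw [tensorCoact_tmul, tensorCoact_tmul, rTensor_mulRight, hf, hg]

/-- The trivial comodule `k`, with coaction `r ↦ r ⊗ 1`. -/
def trivial (k A : Type u) [CommRing k] [Ring A] [Bialgebra k A] : Comod k A where
  carrier := k
  coact := (TensorProduct.mk k k A).flip 1
  coassoc := by ext; simp [Algebra.TensorProduct.one_def]
  counit_comp := by ext; simp

/-- A colinear bijection is an isomorphism of comodules. -/
def isoOfLinearEquiv {V W : Comod k A} (e : V ≃ₗ[k] W)
    (h : W.coact ∘ₗ e.toLinearMap = e.toLinearMap.rTensor A ∘ₗ V.coact) : V ≅ W where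
  hom := ⟨e.toLinearMap, h⟩
  inv := ⟨e.symm.toLinearMap, by
    ext w
    obtain ⟨v, rfl⟩ := e.surjective w
    have hv := LinearMap.congr_fun h v
    simp only [LinearMap.comp_apply, LinearEquiv.coe_coe] at hv ⊢
    rw [hv, ← LinearMap.rTensor_comp_apply]
    simp⟩
  hom_inv_id := by
    apply hom_ext; ext; simp
  inv_hom_id := by
    apply hom_ext; ext; simp

theorem assoc_colinear (U V W : Comod k A) :
    (tensor U (tensor V W)).coact ∘ₗ (TensorProduct.assoc k U V W).toLinearMap =
      (TensorProduct.assoc k U V W).toLinearMap.rTensor A ∘ₗ (tensor (tensor U V) W).coact := by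
  apply TensorProduct.ext_threefold
  intro u v w
  change mulRight U (V ⊗[k] W) A (U.coact u ⊗ₜ mulRight V W A (V.coact v ⊗ₜ W.coact w)) =
    (TensorProduct.assoc k U V W).toLinearMap.rTensor A
      (mulRight (U ⊗[k] V) W A (mulRight U V A (U.coact u ⊗ₜ V.coact v) ⊗ₜ W.coact w))
  generalize U.coact u = r
  generalize V.coact v = s
  generalize W.coact w = t
  induction r with
  | zero => simp
  | add x y hx hy => simp only [TensorProduct.add_tmul, map_add, hx, hy]
  | tmul u a =>
    induction s with
    | zero => simp
    | add x y hx hy => simp only [TensorProduct.tmul_add, TensorProduct.add_tmul, map_add, hx, hy]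
    | tmul v b =>
      induction t with
      | zero => simp
      | add x y hx hy => simp only [TensorProduct.tmul_add, map_add, hx, hy]
      | tmul w c => simp [mul_assoc]

theorem lid_colinear (V : Comod k A) :
    V.coact ∘ₗ (TensorProduct.lid k V).toLinearMap =
      (TensorProduct.lid k V).toLinearMap.rTensor A ∘ₗ (tensor (trivial k A) V).coact := by
  apply TensorProduct.ext'
  intro r v
  change V.coact (TensorProduct.lid k V (r ⊗ₜ v)) =
    (TensorProduct.lid k V).toLinearMap.rTensor A
      (mulRight k V A ((r ⊗ₜ 1) ⊗ₜ V.coact v))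
  rw [TensorProduct.lid_tmul, map_smul]
  generalize V.coact v = t
  induction t with
  | zero => simp
  | add x y hx hy => simp only [TensorProduct.tmul_add, smul_add, map_add, hx, hy]
  | tmul v a => simp [TensorProduct.smul_tmul']

theorem rid_colinear (V : Comod k A) :
    V.coact ∘ₗ (TensorProduct.rid k V).toLinearMap =
      (TensorProduct.rid k V).toLinearMap.rTensor A ∘ₗ (tensor V (trivial k A)).coact := by
  apply TensorProduct.ext'
  intro v r
  change V.coact (TensorProduct.rid k V (v ⊗ₜ r)) =
    (TensorProduct.rid k V).toLinearMap.rTensor A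
      (mulRight V k A (V.coact v ⊗ₜ (r ⊗ₜ 1)))
  rw [TensorProduct.rid_tmul, map_smul]
  generalize V.coact v = t
  induction t with
  | zero => simp
  | add x y hx hy => simp only [TensorProduct.add_tmul, smul_add, map_add, hx, hy]
  | tmul v a => simp [TensorProduct.smul_tmul']

instance : MonoidalCategoryStruct (Comod k A) where
  tensorObj V W := tensor V W
  whiskerLeft V _ _ f := ⟨(Hom.lin f).lTensor V, map_colinear (𝟙 V) f⟩
  whiskerRight f W := ⟨(Hom.lin f).rTensor W, map_colinear f (𝟙 W)⟩
  tensorHom f g := ⟨TensorProduct.map (Hom.lin f) (Hom.lin g), map_colinear f g⟩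
  tensorUnit := trivial k A
  associator U V W := isoOfLinearEquiv (V := tensor (tensor U V) W) (W := tensor U (tensor V W))
    (TensorProduct.assoc k U V W) (assoc_colinear U V W)
  leftUnitor V := isoOfLinearEquiv (V := tensor (trivial k A) V) (TensorProduct.lid k V)
    (lid_colinear V)
  rightUnitor V := isoOfLinearEquiv (V := tensor V (trivial k A)) (TensorProduct.rid k V)
    (rid_colinear V)

instance : MonoidalCategory (Comod k A) :=
  Monoidal.induced (forgetful k A)
  { μIso _ _ := .refl _
    εIso := .refl _
    associator_eq _ _ _ := by ext1; exact TensorProduct.ext (TensorProduct.ext rfl)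
    leftUnitor_eq _ := by ext1; exact TensorProduct.ext rfl
    rightUnitor_eq _ := by ext1; exact TensorProduct.ext rfl }

end Comod

/-- `A` and `B` are monoidally co-Morita equivalent: their categories of comodules are
equivalent as `k`-linear monoidal categories. -/
def MonoidallyCoMoritaEquivalent (k A B : Type u) [CommRing k] [Ring A] [Bialgebra k A]
    [Ring B] [Bialgebra k B] : Prop :=
  ∃ F : Comod k A ≌ Comod k B, Nonempty F.functor.Monoidal ∧ F.functor.Additive ∧
    F.functor.Linear k

end LazyCohomology

end

/-! Each of the three claims is proved by exhibiting a relation between convolution invertible forms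
on `A ⊗ A` and on `B ⊗ B` that is multiplicative, in which each side determines the other, and which
matches lazy cocycles with lazy cocycles and coboundaries of lazy `μ` with coboundaries of lazy `ν`.
Such a relation restricts to the graph of an isomorphism `Z²_L(A) ≅ Z²_L(B)` carrying `B²_L(A)` onto
`B²_L(B)` (`nonempty_HL2_mulEquiv_of_rel`). The second and third claims are not deduced from the
first: each has its own relation, and neither needs a biGalois object.

BiGalois objects. A form `σ` on `A ⊗ A` deforms the product of `Z` from the left, a form `τ` on `B ⊗
B` from the right; they are related when the two deformed products coincide, `σ(x₍₋₁₎, y₍₋₁₎) x₍₀₎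
y₍₀₎ = x₍₀₎ y₍₀₎ τ(x₍₁₎, y₍₁₎)`. If `σ` is lazy, the deformed product is still left `A`-colinear.
The iterated right Galois map `t ⊗ x ⊗ y ↦ t x₍₀₎ y₍₀₎ ⊗ x₍₁₎ ⊗ y₍₁₎` is bijective, so a colinear
map `Z ⊗ Z → Z` is the product followed by the action of a `Z`-valued function on `B ⊗ B`;
colinearity makes its values `A`-coinvariant, that is, scalar (`exists_eq_comp_act`). The resulting
`τ` is again lazy because the two coactions commute (`HasTrivialCoinvariants.exists_central`).
Uniqueness follows from surjectivity of the Galois maps and injectivity of `n ↦ 1 ⊗ n`, which is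
where faithful flatness enters. The same argument runs on `Z`, `Z ⊗ Z` and `Z ⊗ Z ⊗ Z`
(`IsGaloisLevel`): the first level handles `μ` and the normalization, the third the cocycle
identity, since every face of `σ` acts on a triple product through the deformed product alone.

Monoidal equivalences. Lazy forms on `A` are the natural endomorphisms of the identity functor of
the comodule category, and lazy forms on `A ⊗ A` those of the tensor product functor: a form acts by
`v₀ ⊗ w₀ τ(v₁, w₁)`, which is colinear exactly when `τ` is lazy, and naturality against cofree
comodules shows that nothing else occurs. The cocycle identity, normalization and coboundaries have
purely categorical descriptions, which a monoidal equivalence preserves.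

Twists. Here `τ` on `B` is related to `σ` when its pullback to `A` is `ω * σ * ω⁻¹`. The twisted
product is `ω * m * ω⁻¹`, so laziness is conjugated along; both sides of the cocycle identity are
conjugated by the two sides of the cocycle identity of `ω`, which are equal. -/

noncomputable section

namespace LazyCohomology

/-! ### Coactions and the action of linear forms -/

section Coaction

variable {k : Type*} [CommRing k]
  {M : Type*} [AddCommGroup M] [Module k M] {M' : Type*} [AddCommGroup M'] [Module k M']
  {C : Type*} [AddCommGroup C] [Module k C] {C' : Type*} [AddCommGroup C'] [Module k C']
  {D : Type*} [AddCommGroup D] [Module k D] {D' : Type*} [AddCommGroup D'] [Module k D']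
  {N : Type*} [AddCommGroup N] [Module k N]

/-- The endomorphism `x ↦ x₀ τ(x₁)` defined by a linear form `τ`, where `δ(x) = x₀ ⊗ x₁`. -/
def act (δ : M →ₗ[k] M ⊗[k] C) (τ : WithConv (C →ₗ[k] k)) : M →ₗ[k] M :=
  (TensorProduct.rid k M).toLinearMap ∘ₗ τ.ofConv.lTensor M ∘ₗ δ

/-- `δ` is a coaction of `C` with respect to the comultiplication `Δ`. A left coaction is treated
as a right coaction with respect to the opposite comultiplication. -/
structure IsCoaction (Δ : C →ₗ[k] C ⊗[k] C) (ε : C →ₗ[k] k) (δ : M →ₗ[k] M ⊗[k] C) : Prop where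
  coassoc : (TensorProduct.assoc k M C C).toLinearMap ∘ₗ δ.rTensor C ∘ₗ δ = Δ.lTensor M ∘ₗ δ
  counit_comp : (TensorProduct.rid k M).toLinearMap ∘ₗ ε.lTensor M ∘ₗ δ = LinearMap.id

theorem IsCoaction.coassoc_apply {Δ : C →ₗ[k] C ⊗[k] C} {ε : C →ₗ[k] k} {δ : M →ₗ[k] M ⊗[k] C}
    (h : IsCoaction Δ ε δ) (x : M) :
    TensorProduct.assoc k M C C (δ.rTensor C (δ x)) = Δ.lTensor M (δ x) :=
  LinearMap.congr_fun h.coassoc x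

/-- Coassociativity alone: acting first and then coacting gives `x₀ ⊗ g(x₁) τ(x₂)`. In
`IsCoaction.map_act` the form sits on the other side, `x₀ ⊗ τ(x₁) g(x₂)`. Laziness of `τ` is the
equality of these two, so the pair translates between laziness and colinearity of the action. -/
theorem IsCoaction.lTensor_act {Δ : C →ₗ[k] C ⊗[k] C} {ε : C →ₗ[k] k} {δ : M →ₗ[k] M ⊗[k] C}
    (h : IsCoaction Δ ε δ) (τ : WithConv (C →ₗ[k] k)) (g : C →ₗ[k] N) :
    g.lTensor M ∘ₗ δ ∘ₗ act δ τ =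
      ((TensorProduct.rid k N).toLinearMap ∘ₗ TensorProduct.map g τ.ofConv ∘ₗ Δ).lTensor M ∘ₗ
        δ := by
  have key : ∀ w : M ⊗[k] C, g.lTensor M (δ (TensorProduct.rid k M (τ.ofConv.lTensor M w))) =
      ((TensorProduct.rid k N).toLinearMap ∘ₗ TensorProduct.map g τ.ofConv).lTensor M
        (TensorProduct.assoc k M C C (δ.rTensor C w)) := by
    intro w
    induction w with
    | zero => simp
    | add x y hx hy => simp only [map_add, hx, hy]
    | tmul m c =>
      simp only [LinearMap.lTensor_tmul, TensorProduct.rid_tmul, map_smul, LinearMap.rTensor_tmul]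
      generalize δ m = t
      induction t with
      | zero => simp
      | add x y hx hy => simp only [TensorProduct.add_tmul, map_add, smul_add, hx, hy]
      | tmul m c => simp
  ext x
  simp only [LinearMap.comp_apply, act, LinearEquiv.coe_coe, key, h.coassoc_apply]
  rw [← LinearMap.lTensor_comp_apply, LinearMap.comp_assoc]

theorem IsCoaction.map_act {Δ : C →ₗ[k] C ⊗[k] C} {ε : C →ₗ[k] k} {δ : M →ₗ[k] M ⊗[k] C}
    (h : IsCoaction Δ ε δ) (τ : WithConv (C →ₗ[k] k)) (g : C →ₗ[k] N) :
    TensorProduct.map (act δ τ) g ∘ₗ δ =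
      ((TensorProduct.lid k N).toLinearMap ∘ₗ TensorProduct.map τ.ofConv g ∘ₗ Δ).lTensor M ∘ₗ
        δ := by
  have key : ∀ w : M ⊗[k] C, TensorProduct.map (act δ τ) g w =
      ((TensorProduct.lid k N).toLinearMap ∘ₗ TensorProduct.map τ.ofConv g).lTensor M
        (TensorProduct.assoc k M C C (δ.rTensor C w)) := by
    intro w
    induction w with
    | zero => simp
    | add x y hx hy => simp only [map_add, hx, hy]
    | tmul m c =>
      simp only [TensorProduct.map_tmul, act, LinearMap.comp_apply, LinearMap.rTensor_tmul]
      generalize δ m = t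
      induction t with
      | zero => simp
      | add x y hx hy => simp only [TensorProduct.add_tmul, map_add, hx, hy]
      | tmul m c => simp [TensorProduct.smul_tmul]
  ext x
  simp only [LinearMap.comp_apply, key, h.coassoc_apply]
  rw [← LinearMap.lTensor_comp_apply, LinearMap.comp_assoc]

theorem IsCoaction.act_comp_act {Δ : C →ₗ[k] C ⊗[k] C} {ε : C →ₗ[k] k} {δ : M →ₗ[k] M ⊗[k] C}
    (h : IsCoaction Δ ε δ) (τ φ : WithConv (C →ₗ[k] k)) :
    act δ τ ∘ₗ act δ φ =
      act δ (WithConv.toConv (LinearMap.mul' k k ∘ₗ TensorProduct.map τ.ofConv φ.ofConv ∘ₗ Δ)) := by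
  -- The outer action is the case `g = τ` of `IsCoaction.lTensor_act`, followed by `M ⊗ k ≅ M`.
  have h1 := congrArg (fun f => (TensorProduct.rid k M).toLinearMap ∘ₗ f)
    (h.lTensor_act φ τ.ofConv)
  have e : (TensorProduct.rid k k).toLinearMap = LinearMap.mul' k k := by
    ext; simp
  rw [e] at h1
  exact h1

/-- The outer tensor product of two coactions (or of two comultiplications). -/
def outer (δ : M →ₗ[k] M ⊗[k] C) (δ' : M' →ₗ[k] M' ⊗[k] C') :
    M ⊗[k] M' →ₗ[k] (M ⊗[k] M') ⊗[k] (C ⊗[k] C') :=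
  (TensorProduct.tensorTensorTensorComm k M C M' C').toLinearMap ∘ₗ TensorProduct.map δ δ'

theorem outer_tmul (δ : M →ₗ[k] M ⊗[k] C) (δ' : M' →ₗ[k] M' ⊗[k] C') (x : M) (y : M') :
    outer δ δ' (x ⊗ₜ y) = TensorProduct.tensorTensorTensorComm k M C M' C' (δ x ⊗ₜ δ' y) := rfl

theorem outer_comul [Coalgebra k C] [Coalgebra k C'] :
    outer (comul (R := k) (A := C)) (comul (R := k) (A := C')) =
      comul (R := k) (A := C ⊗[k] C') := rfl

/-- The co-opposite of a tensor product of coalgebras is the tensor product of the co-opposites, so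
left coactions can be multiplied by the same construction as right ones. -/
theorem outer_opComul [Coalgebra k C] [Coalgebra k C'] :
    outer ((TensorProduct.comm k C C).toLinearMap ∘ₗ comul (R := k) (A := C))
      ((TensorProduct.comm k C' C').toLinearMap ∘ₗ comul (R := k) (A := C')) =
      (TensorProduct.comm k _ _).toLinearMap ∘ₗ comul (R := k) (A := C ⊗[k] C') := by
  ext x y
  rw [← outer_comul]
  simp only [TensorProduct.AlgebraTensorModule.curry_apply, LinearMap.restrictScalars_self,
    TensorProduct.curry_apply, LinearMap.comp_apply, outer_tmul, LinearEquiv.coe_coe]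
  generalize comul (R := k) x = s
  generalize comul (R := k) y = t
  induction s with
  | zero => simp
  | add x y hx hy => simp only [TensorProduct.add_tmul, map_add, hx, hy]
  | tmul v a =>
    induction t with
    | zero => simp
    | add x y hx hy => simp only [TensorProduct.tmul_add, map_add, hx, hy]
    | tmul w b => simp

theorem outer_counit [Coalgebra k C] [Coalgebra k C'] :
    LinearMap.mul' k k ∘ₗ TensorProduct.map (counit (R := k) (A := C))
      (counit (R := k) (A := C')) = counit (R := k) (A := C ⊗[k] C') := by
  ext; simp [mul_comm]

theorem IsCoaction.outer {Δ : C →ₗ[k] C ⊗[k] C} {ε : C →ₗ[k] k} {δ : M →ₗ[k] M ⊗[k] C}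
    (h : IsCoaction Δ ε δ) {Δ' : C' →ₗ[k] C' ⊗[k] C'} {ε' : C' →ₗ[k] k}
    {δ' : M' →ₗ[k] M' ⊗[k] C'} (h' : IsCoaction Δ' ε' δ') :
    IsCoaction (outer Δ Δ') (LinearMap.mul' k k ∘ₗ TensorProduct.map ε ε') (outer δ δ') where
  coassoc := by
    -- Both sides of coassociativity are written as one fixed permutation applied to the tensor
    -- product of the corresponding sides for `δ` and `δ'`.
    have key1 : ∀ (s : M ⊗[k] C) (t : M' ⊗[k] C'),
        TensorProduct.assoc k _ _ _ ((LazyCohomology.outer δ δ').rTensor _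
          (TensorProduct.tensorTensorTensorComm k M C M' C' (s ⊗ₜ t))) =
        (TensorProduct.tensorTensorTensorComm k C C C' C').toLinearMap.lTensor _
          (TensorProduct.tensorTensorTensorComm k M (C ⊗[k] C) M' (C' ⊗[k] C')
          (TensorProduct.assoc k _ _ _ (δ.rTensor C s) ⊗ₜ
            TensorProduct.assoc k _ _ _ (δ'.rTensor C' t))) := by
      intro s t
      induction s with
      | zero => simp
      | add x y hx hy => simp only [TensorProduct.add_tmul, map_add, hx, hy]
      | tmul v a =>
        induction t with
        | zero => simp
        | add x y hx hy => simp only [TensorProduct.tmul_add, map_add, hx, hy]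
        | tmul w b =>
          simp only [TensorProduct.tensorTensorTensorComm_tmul, LinearMap.rTensor_tmul, outer_tmul]
          generalize δ v = s
          generalize δ' w = t
          induction s with
          | zero => simp
          | add x y hx hy => simp only [TensorProduct.add_tmul, map_add, hx, hy]
          | tmul v a =>
            induction t with
            | zero => simp
            | add x y hx hy => simp only [TensorProduct.tmul_add, TensorProduct.add_tmul, map_add,
                hx, hy]
            | tmul w b => simp
    have key2 : ∀ (s : M ⊗[k] C) (t : M' ⊗[k] C'),
        (LazyCohomology.outer Δ Δ').lTensor _
          (TensorProduct.tensorTensorTensorComm k M C M' C' (s ⊗ₜ t)) =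
        (TensorProduct.tensorTensorTensorComm k C C C' C').toLinearMap.lTensor _
          (TensorProduct.tensorTensorTensorComm k M (C ⊗[k] C) M' (C' ⊗[k] C')
          (Δ.lTensor M s ⊗ₜ Δ'.lTensor M' t)) := by
      intro s t
      induction s with
      | zero => simp
      | add x y hx hy => simp only [TensorProduct.add_tmul, map_add, hx, hy]
      | tmul v a =>
        induction t with
        | zero => simp
        | add x y hx hy => simp only [TensorProduct.tmul_add, map_add, hx, hy]
        | tmul w b => simp [outer_tmul]
    ext x y
    simp only [TensorProduct.AlgebraTensorModule.curry_apply, LinearMap.restrictScalars_self,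
      TensorProduct.curry_apply, LinearMap.comp_apply, outer_tmul, LinearEquiv.coe_coe]
    rw [key1, key2, h.coassoc_apply, h'.coassoc_apply]
  counit_comp := by
    have key : ∀ (s : M ⊗[k] C) (t : M' ⊗[k] C'),
        TensorProduct.rid k _ ((LinearMap.mul' k k ∘ₗ TensorProduct.map ε ε').lTensor _
          (TensorProduct.tensorTensorTensorComm k M C M' C' (s ⊗ₜ t))) =
        TensorProduct.rid k _ (ε.lTensor M s) ⊗ₜ TensorProduct.rid k _ (ε'.lTensor M' t) := by
      intro s t
      induction s with
      | zero => simp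
      | add x y hx hy => simp only [TensorProduct.add_tmul, map_add, hx, hy]
      | tmul v a =>
        induction t with
        | zero => simp
        | add x y hx hy => simp only [TensorProduct.tmul_add, map_add, hx, hy]
        | tmul w b => simp [TensorProduct.smul_tmul', smul_smul, mul_comm]
    ext x y
    simp only [TensorProduct.AlgebraTensorModule.curry_apply, LinearMap.restrictScalars_self,
      TensorProduct.curry_apply, LinearMap.comp_apply, outer_tmul, LinearEquiv.coe_coe]
    rw [key]
    exact congrArg₂ (fun x y => x ⊗ₜ[k] y) (LinearMap.congr_fun h.counit_comp x)
      (LinearMap.congr_fun h'.counit_comp y)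

/-- Naturality of the action: a map `f` covering a coalgebra morphism `g` exchanges `τ` and its
pullback along `g`. The face forms and the restrictions `σ(a, 1)`, `σ(1, a)` are pullbacks, so their
actions are mostly computed by choosing `f` and `g`. -/
theorem act_comp_of_comp [Coalgebra k C] [Coalgebra k C'] {δ : M →ₗ[k] M ⊗[k] C}
    {δ' : M' →ₗ[k] M' ⊗[k] C'} (f : M →ₗ[k] M') (g : C →ₗc[k] C')
    (hfg : δ' ∘ₗ f = TensorProduct.map f g.toLinearMap ∘ₗ δ) (τ : WithConv (C' →ₗ[k] k)) :
    act δ' τ ∘ₗ f = f ∘ₗ act δ (convPull g τ) := by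
  have key : ∀ w : M ⊗[k] C, TensorProduct.rid k M' (τ.ofConv.lTensor M'
      (TensorProduct.map f g.toLinearMap w)) =
      f (TensorProduct.rid k M ((convPull g τ).ofConv.lTensor M w)) := by
    intro w
    induction w with
    | zero => simp
    | add x y hx hy => simp only [map_add, hx, hy]
    | tmul m c =>
      simp only [TensorProduct.map_tmul, LinearMap.lTensor_tmul, TensorProduct.rid_tmul, map_smul]
      rfl
  ext x
  have h := LinearMap.congr_fun hfg x
  simp only [LinearMap.comp_apply] at h
  simp only [LinearMap.comp_apply, act, LinearEquiv.coe_coe, h, key]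

/-- The form ignores the second coaction except through its counit, and the counit axiom removes
that coaction. -/
theorem act_outer_fst [Coalgebra k C] [Coalgebra k C'] {δ : M →ₗ[k] M ⊗[k] C}
    {Δ' : C' →ₗ[k] C' ⊗[k] C'} {δ' : M' →ₗ[k] M' ⊗[k] C'} (h' : IsCoaction Δ' counit δ')
    (τ : WithConv (C →ₗ[k] k)) :
    act (outer δ δ') (convPull (fstHom k C C') τ) = (act δ τ).rTensor M' := by
  have key : ∀ (s : M ⊗[k] C) (t : M' ⊗[k] C'),
      TensorProduct.rid k _ ((convPull (fstHom k C C') τ).ofConv.lTensor _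
        (TensorProduct.tensorTensorTensorComm k M C M' C' (s ⊗ₜ t))) =
      TensorProduct.rid k _ (τ.ofConv.lTensor M s) ⊗ₜ
        TensorProduct.rid k _ ((counit (R := k) (A := C')).lTensor M' t) := by
    intro s t
    induction s with
    | zero => simp
    | add x y hx hy => simp only [TensorProduct.add_tmul, map_add, hx, hy]
    | tmul v a =>
      induction t with
      | zero => simp
      | add x y hx hy => simp only [TensorProduct.tmul_add, map_add, hx, hy]
      | tmul w b =>
        have e : (convPull (fstHom k C C') τ).ofConv (a ⊗ₜ b) =
            counit (R := k) b * τ.ofConv a := by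
          change τ.ofConv (fstHom k C C' (a ⊗ₜ b)) = _
          rw [fstHom_tmul, map_smul, smul_eq_mul]
        simp [TensorProduct.smul_tmul', smul_smul, e, mul_comm]
  ext x y
  simp only [TensorProduct.AlgebraTensorModule.curry_apply, LinearMap.restrictScalars_self,
    TensorProduct.curry_apply, LinearMap.comp_apply, act, outer_tmul, LinearEquiv.coe_coe,
    LinearMap.rTensor_tmul, key]
  congr 1
  exact LinearMap.congr_fun h'.counit_comp y

theorem act_outer_snd [Coalgebra k C] [Coalgebra k C'] {Δ : C →ₗ[k] C ⊗[k] C}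
    {δ : M →ₗ[k] M ⊗[k] C} {δ' : M' →ₗ[k] M' ⊗[k] C'} (h : IsCoaction Δ counit δ)
    (τ : WithConv (C' →ₗ[k] k)) :
    act (outer δ δ') (convPull (sndHom k C C') τ) = (act δ' τ).lTensor M := by
  have key : ∀ (s : M ⊗[k] C) (t : M' ⊗[k] C'),
      TensorProduct.rid k _ ((convPull (sndHom k C C') τ).ofConv.lTensor _
        (TensorProduct.tensorTensorTensorComm k M C M' C' (s ⊗ₜ t))) =
      TensorProduct.rid k _ ((counit (R := k) (A := C)).lTensor M s) ⊗ₜ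
        TensorProduct.rid k _ (τ.ofConv.lTensor M' t) := by
    intro s t
    induction s with
    | zero => simp
    | add x y hx hy => simp only [TensorProduct.add_tmul, map_add, hx, hy]
    | tmul v a =>
      induction t with
      | zero => simp
      | add x y hx hy => simp only [TensorProduct.tmul_add, map_add, hx, hy]
      | tmul w b =>
        have e : (convPull (sndHom k C C') τ).ofConv (a ⊗ₜ b) =
            counit (R := k) a * τ.ofConv b := by
          change τ.ofConv (sndHom k C C' (a ⊗ₜ b)) = _
          rw [sndHom_tmul, map_smul, smul_eq_mul]
        simp [TensorProduct.smul_tmul', smul_smul, e, mul_comm]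
  ext x y
  simp only [TensorProduct.AlgebraTensorModule.curry_apply, LinearMap.restrictScalars_self,
    TensorProduct.curry_apply, LinearMap.comp_apply, act, outer_tmul, LinearEquiv.coe_coe,
    LinearMap.lTensor_tmul, key]
  congr 1
  exact LinearMap.congr_fun h.counit_comp x

section Comul

variable [Coalgebra k C]

theorem act_one {Δ : C →ₗ[k] C ⊗[k] C} {δ : M →ₗ[k] M ⊗[k] C} (h : IsCoaction Δ counit δ) :
    act δ 1 = LinearMap.id := h.counit_comp

theorem act_mul {δ : M →ₗ[k] M ⊗[k] C} (h : IsCoaction comul counit δ)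
    (τ φ : WithConv (C →ₗ[k] k)) : act δ (τ * φ) = act δ τ ∘ₗ act δ φ :=
  (h.act_comp_act τ φ).symm

/-- For a coaction of the co-opposite coalgebra, that is, for a left coaction, the action reverses
products. Together with commuting left and right actions this is what makes intertwining of forms
multiplicative. -/
theorem act_mul_op {δ : M →ₗ[k] M ⊗[k] C}
    (h : IsCoaction ((TensorProduct.comm k C C).toLinearMap ∘ₗ comul) counit δ)
    (τ φ : WithConv (C →ₗ[k] k)) : act δ (τ * φ) = act δ φ ∘ₗ act δ τ := by
  rw [h.act_comp_act φ τ]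
  congr 1
  apply WithConv.ext
  have e : LinearMap.mul' k k ∘ₗ TensorProduct.map φ.ofConv τ.ofConv ∘ₗ
      (TensorProduct.comm k C C).toLinearMap = LinearMap.mul' k k ∘ₗ
        TensorProduct.map τ.ofConv φ.ofConv := by
    ext; simp [mul_comm]
  change _ = LinearMap.mul' k k ∘ₗ TensorProduct.map φ.ofConv τ.ofConv ∘ₗ
      (TensorProduct.comm k C C).toLinearMap ∘ₗ comul
  simp only [← LinearMap.comp_assoc] at e ⊢
  rw [e]
  rfl

variable {R : Type*} [Ring R] [Algebra k R]

/-- This identity and the three that follow identify the two sides of `IsCentralFor` with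
convolution products; passing to the co-opposite coalgebra exchanges the two sides. -/
theorem rid_map_comul (τ : WithConv (C →ₗ[k] k)) (g : C →ₗ[k] R) :
    (TensorProduct.rid k R).toLinearMap ∘ₗ TensorProduct.map g τ.ofConv ∘ₗ comul =
      (WithConv.toConv g * convScalar R τ).ofConv := by
  have e : (TensorProduct.rid k R).toLinearMap ∘ₗ TensorProduct.map g τ.ofConv =
      LinearMap.mul' k R ∘ₗ TensorProduct.map g (convScalar R τ).ofConv := by
    ext a b
    simp only [TensorProduct.AlgebraTensorModule.curry_apply, LinearMap.restrictScalars_self,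
      TensorProduct.curry_apply, LinearMap.comp_apply, TensorProduct.map_tmul, LinearEquiv.coe_coe,
      TensorProduct.rid_tmul, LinearMap.mul'_apply]
    rw [Algebra.smul_def, Algebra.commutes]
    rfl
  rw [← LinearMap.comp_assoc, e]
  rfl

theorem lid_map_comul (τ : WithConv (C →ₗ[k] k)) (g : C →ₗ[k] R) :
    (TensorProduct.lid k R).toLinearMap ∘ₗ TensorProduct.map τ.ofConv g ∘ₗ comul =
      (convScalar R τ * WithConv.toConv g).ofConv := by
  have e : (TensorProduct.lid k R).toLinearMap ∘ₗ TensorProduct.map τ.ofConv g =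
      LinearMap.mul' k R ∘ₗ TensorProduct.map (convScalar R τ).ofConv g := by
    ext a b
    simp only [TensorProduct.AlgebraTensorModule.curry_apply, LinearMap.restrictScalars_self,
      TensorProduct.curry_apply, LinearMap.comp_apply, TensorProduct.map_tmul, LinearEquiv.coe_coe,
      TensorProduct.lid_tmul, LinearMap.mul'_apply]
    rw [Algebra.smul_def]
    rfl
  rw [← LinearMap.comp_assoc, e]
  rfl

theorem rid_map_opComul (τ : WithConv (C →ₗ[k] k)) (g : C →ₗ[k] R) :
    (TensorProduct.rid k R).toLinearMap ∘ₗ TensorProduct.map g τ.ofConv ∘ₗ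
      (TensorProduct.comm k C C).toLinearMap ∘ₗ comul =
      (convScalar R τ * WithConv.toConv g).ofConv := by
  rw [← lid_map_comul]
  simp only [← LinearMap.comp_assoc]
  congr 1
  ext; simp

theorem lid_map_opComul (τ : WithConv (C →ₗ[k] k)) (g : C →ₗ[k] R) :
    (TensorProduct.lid k R).toLinearMap ∘ₗ TensorProduct.map τ.ofConv g ∘ₗ
      (TensorProduct.comm k C C).toLinearMap ∘ₗ comul =
      (WithConv.toConv g * convScalar R τ).ofConv := by
  rw [← rid_map_comul]
  simp only [← LinearMap.comp_assoc]
  congr 1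
  ext; simp

end Comul

/-- The two coactions `δ` and `lam` on `M` commute. -/
def CoactionsCommute (δ : M →ₗ[k] M ⊗[k] C) (lam : M →ₗ[k] M ⊗[k] D) : Prop :=
  lam.rTensor C ∘ₗ δ = (TensorProduct.rightComm k M C D).toLinearMap ∘ₗ δ.rTensor D ∘ₗ lam

theorem CoactionsCommute.symm {δ : M →ₗ[k] M ⊗[k] C} {lam : M →ₗ[k] M ⊗[k] D}
    (h : CoactionsCommute δ lam) : CoactionsCommute lam δ := by
  rw [CoactionsCommute, h, ← LinearMap.comp_assoc]
  ext x
  exact ((TensorProduct.rightComm k M C D).symm_apply_apply _).symm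

theorem CoactionsCommute.lTensor {δ : M →ₗ[k] M ⊗[k] C} {lam : M →ₗ[k] M ⊗[k] D}
    (h : CoactionsCommute δ lam) (g : D →ₗ[k] N) : CoactionsCommute δ (g.lTensor M ∘ₗ lam) := by
  have key : ∀ w : M ⊗[k] D, (TensorProduct.rightComm k M C N) (δ.rTensor N (g.lTensor M w)) =
      (g.lTensor M).rTensor C ((TensorProduct.rightComm k M C D) (δ.rTensor D w)) := by
    intro w
    induction w with
    | zero => simp
    | add x y hx hy => simp only [map_add, hx, hy]
    | tmul m d =>
      simp only [LinearMap.lTensor_tmul, LinearMap.rTensor_tmul]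
      generalize δ m = t
      induction t with
      | zero => simp
      | add x y hx hy => simp only [TensorProduct.add_tmul, map_add, hx, hy]
      | tmul m c => simp
  ext x
  have h := LinearMap.congr_fun h x
  simp only [LinearMap.comp_apply, LinearEquiv.coe_coe] at h
  simp only [LinearMap.comp_apply, LinearEquiv.coe_coe, key, ← h, LinearMap.rTensor_comp_apply]

/-- Since the coactions commute, acting through one of them is colinear for the other. -/
theorem CoactionsCommute.comp_act {δ : M →ₗ[k] M ⊗[k] C} {lam : M →ₗ[k] M ⊗[k] D}
    (h : CoactionsCommute δ lam) (σ : WithConv (D →ₗ[k] k)) :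
    δ ∘ₗ act lam σ = (act lam σ).rTensor C ∘ₗ δ := by
  have key1 : ∀ w : M ⊗[k] D, δ (TensorProduct.rid k M (σ.ofConv.lTensor M w)) =
      (((TensorProduct.rid k M).toLinearMap ∘ₗ σ.ofConv.lTensor M).rTensor C)
        (TensorProduct.rightComm k M C D (δ.rTensor D w)) := by
    intro w
    induction w with
    | zero => simp
    | add x y hx hy => simp only [map_add, hx, hy]
    | tmul m d =>
      simp only [LinearMap.lTensor_tmul, LinearMap.rTensor_tmul, TensorProduct.rid_tmul, map_smul]
      generalize δ m = t
      induction t with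
      | zero => simp
      | add x y hx hy => simp only [TensorProduct.add_tmul, map_add, smul_add, hx, hy]
      | tmul m c => simp [TensorProduct.smul_tmul']
  ext x
  have h := LinearMap.congr_fun h x
  simp only [LinearMap.comp_apply, LinearEquiv.coe_coe] at h
  simp only [LinearMap.comp_apply, act, LinearEquiv.coe_coe, key1, ← h,
    ← LinearMap.rTensor_comp_apply, LinearMap.comp_assoc]

theorem CoactionsCommute.act_comp_act {δ : M →ₗ[k] M ⊗[k] C} {lam : M →ₗ[k] M ⊗[k] D}
    (h : CoactionsCommute δ lam) (τ : WithConv (C →ₗ[k] k)) (σ : WithConv (D →ₗ[k] k)) :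
    act δ τ ∘ₗ act lam σ = act lam σ ∘ₗ act δ τ := by
  rw [act, LinearMap.comp_assoc, LinearMap.comp_assoc, h.comp_act]
  simp only [act, ← LinearMap.comp_assoc]
  congr 1
  ext x c
  simp

theorem CoactionsCommute.outer {δ : M →ₗ[k] M ⊗[k] C} {lam : M →ₗ[k] M ⊗[k] D}
    (h : CoactionsCommute δ lam) {δ' : M' →ₗ[k] M' ⊗[k] C'} {lam' : M' →ₗ[k] M' ⊗[k] D'}
    (h' : CoactionsCommute δ' lam') : CoactionsCommute (outer δ δ') (outer lam lam') := by
  have key1 : ∀ (s : M ⊗[k] C) (t : M' ⊗[k] C'), (LazyCohomology.outer lam lam').rTensor _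
      (TensorProduct.tensorTensorTensorComm k M C M' C' (s ⊗ₜ t)) =
      (TensorProduct.tensorTensorTensorComm k M D M' D').toLinearMap.rTensor _
        (TensorProduct.tensorTensorTensorComm k _ _ _ _
          (lam.rTensor C s ⊗ₜ lam'.rTensor C' t)) := by
    intro s t
    induction s with
    | zero => simp
    | add x y hx hy => simp only [TensorProduct.add_tmul, map_add, hx, hy]
    | tmul v a =>
      induction t with
      | zero => simp
      | add x y hx hy => simp only [TensorProduct.tmul_add, map_add, hx, hy]
      | tmul w b => simp [outer_tmul]
  have key2 : ∀ (s : M ⊗[k] D) (t : M' ⊗[k] D'), (TensorProduct.rightComm k _ _ _)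
      ((LazyCohomology.outer δ δ').rTensor _
        (TensorProduct.tensorTensorTensorComm k M D M' D' (s ⊗ₜ t))) =
      (TensorProduct.tensorTensorTensorComm k M D M' D').toLinearMap.rTensor _
        (TensorProduct.tensorTensorTensorComm k _ _ _ _
          (TensorProduct.rightComm k _ _ _ (δ.rTensor D s) ⊗ₜ
            TensorProduct.rightComm k _ _ _ (δ'.rTensor D' t))) := by
    intro s t
    induction s with
    | zero => simp
    | add x y hx hy => simp only [TensorProduct.add_tmul, map_add, hx, hy]
    | tmul v a =>
      induction t with
      | zero => simp
      | add x y hx hy => simp only [TensorProduct.tmul_add, map_add, hx, hy]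
      | tmul w b =>
        simp only [TensorProduct.tensorTensorTensorComm_tmul, LinearMap.rTensor_tmul, outer_tmul]
        generalize δ v = s
        generalize δ' w = t
        induction s with
        | zero => simp
        | add x y hx hy => simp only [TensorProduct.add_tmul, map_add, hx, hy]
        | tmul v a =>
          induction t with
          | zero => simp
          | add x y hx hy => simp only [TensorProduct.tmul_add, TensorProduct.add_tmul, map_add,
              hx, hy]
          | tmul w b => simp
  ext x y
  have e := LinearMap.congr_fun h x
  have e' := LinearMap.congr_fun h' y
  simp only [LinearMap.comp_apply, LinearEquiv.coe_coe] at e e'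
  simp only [TensorProduct.AlgebraTensorModule.curry_apply, LinearMap.restrictScalars_self,
    TensorProduct.curry_apply, LinearMap.comp_apply, outer_tmul, LinearEquiv.coe_coe]
  rw [key1, key2, e, e']

end Coaction

/-! ### Galois maps -/

section GaloisMap

variable {k : Type*} [CommRing k]
  {Z : Type*} [AddCommGroup Z] [Module k Z]
  {M : Type*} [AddCommGroup M] [Module k M] {M' : Type*} [AddCommGroup M'] [Module k M']
  {C : Type*} [AddCommGroup C] [Module k C] {C' : Type*} [AddCommGroup C'] [Module k C']
  {D : Type*} [AddCommGroup D] [Module k D]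
  {N : Type*} [AddCommGroup N] [Module k N]

/-- The Galois map `t ⊗ x ↦ t m(x₀) ⊗ x₁`, where the bilinear map `mZ` is the product of `Z`. -/
def galoisMap (mZ : Z →ₗ[k] Z →ₗ[k] Z) (m : M →ₗ[k] Z) (δ : M →ₗ[k] M ⊗[k] C) :
    Z ⊗[k] M →ₗ[k] Z ⊗[k] C :=
  (TensorProduct.lift (mZ.compl₂ m)).rTensor C ∘ₗ
    (TensorProduct.assoc k Z M C).symm.toLinearMap ∘ₗ δ.lTensor Z

theorem galoisMap_tmul (mZ : Z →ₗ[k] Z →ₗ[k] Z) (m : M →ₗ[k] Z) (δ : M →ₗ[k] M ⊗[k] C)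
    (t : Z) (x : M) : galoisMap mZ m δ (t ⊗ₜ x) = (mZ t ∘ₗ m).rTensor C (δ x) := by
  simp only [galoisMap, LinearMap.comp_apply, LinearMap.lTensor_tmul, LinearEquiv.coe_coe]
  generalize δ x = s
  induction s with
  | zero => simp
  | add x y hx hy => simp only [TensorProduct.tmul_add, map_add, hx, hy]
  | tmul v a => simp

/-- The Galois map of a product is the composite of the two Galois maps up to permutations: `t ⊗ x ⊗
y` goes to `t m(x₀) ⊗ x₁ ⊗ y`, and then `m'(y₀)` is absorbed by the second map. -/
theorem galoisMap_bijective_mul {mZ : Z →ₗ[k] Z →ₗ[k] Z}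
    (assoc : ∀ a b c, mZ (mZ a b) c = mZ a (mZ b c))
    {m : M →ₗ[k] Z} {δ : M →ₗ[k] M ⊗[k] C} (h : Function.Bijective (galoisMap mZ m δ))
    {m' : M' →ₗ[k] Z} {δ' : M' →ₗ[k] M' ⊗[k] C'} (h' : Function.Bijective (galoisMap mZ m' δ')) :
    Function.Bijective (galoisMap mZ (TensorProduct.lift (mZ.compl₁₂ m m')) (outer δ δ')) := by
  let e := LinearEquiv.ofBijective _ h
  let e' := LinearEquiv.ofBijective _ h'
  let E := (TensorProduct.assoc k Z M M').symm ≪≫ₗ e.rTensor M' ≪≫ₗ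
    TensorProduct.rightComm k Z C M' ≪≫ₗ e'.rTensor C ≪≫ₗ TensorProduct.rightComm k Z C' C ≪≫ₗ
    TensorProduct.assoc k Z C C'
  have hE : galoisMap mZ (TensorProduct.lift (mZ.compl₁₂ m m')) (outer δ δ') = E.toLinearMap := by
    apply TensorProduct.ext
    ext t x y
    simp only [TensorProduct.mk_apply, LinearMap.compr₂ₛₗ_apply,
      TensorProduct.AlgebraTensorModule.curry_apply, LinearMap.restrictScalars_self,
      TensorProduct.curry_apply, galoisMap_tmul, outer_tmul, LinearEquiv.coe_coe,
      LinearEquiv.trans_apply, TensorProduct.assoc_symm_tmul, LinearEquiv.rTensor_tmul, E, e, e',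
      LinearEquiv.ofBijective_apply]
    generalize δ x = s
    induction s with
    | zero => simp
    | add x y hx hy => simp only [TensorProduct.add_tmul, map_add, hx, hy]
    | tmul v a =>
      simp only [LinearMap.rTensor_tmul, TensorProduct.rightComm_tmul, LinearEquiv.rTensor_tmul,
        LinearEquiv.ofBijective_apply, galoisMap_tmul]
      generalize δ' y = t
      induction t with
      | zero => simp
      | add x y hx hy => simp only [TensorProduct.tmul_add, TensorProduct.add_tmul, map_add, hx, hy]
      | tmul w b => simp [assoc]
  rw [hE]
  exact E.bijective

/-- The version for left coactions, whose Galois map multiplies from the other side: now `m'(y)` is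
adjacent to `t`, so the second factor has to be absorbed first. -/
theorem galoisMap_bijective_mul_flip {mZ : Z →ₗ[k] Z →ₗ[k] Z}
    (assoc : ∀ a b c, mZ (mZ a b) c = mZ a (mZ b c))
    {m : M →ₗ[k] Z} {δ : M →ₗ[k] M ⊗[k] C} (h : Function.Bijective (galoisMap mZ m δ))
    {m' : M' →ₗ[k] Z} {δ' : M' →ₗ[k] M' ⊗[k] C'} (h' : Function.Bijective (galoisMap mZ m' δ')) :
    Function.Bijective (galoisMap mZ (TensorProduct.lift (mZ.flip.compl₁₂ m m')) (outer δ δ')) := by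
  let e := LinearEquiv.ofBijective _ h
  let e' := LinearEquiv.ofBijective _ h'
  let E := (TensorProduct.assoc k Z M M').symm ≪≫ₗ TensorProduct.rightComm k Z M M' ≪≫ₗ
    e'.rTensor M ≪≫ₗ TensorProduct.rightComm k Z C' M ≪≫ₗ e.rTensor C' ≪≫ₗ
    TensorProduct.assoc k Z C C'
  have hE : galoisMap mZ (TensorProduct.lift (mZ.flip.compl₁₂ m m')) (outer δ δ') =
      E.toLinearMap := by
    apply TensorProduct.ext
    ext t x y
    simp only [TensorProduct.mk_apply, LinearMap.compr₂ₛₗ_apply,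
      TensorProduct.AlgebraTensorModule.curry_apply, LinearMap.restrictScalars_self,
      TensorProduct.curry_apply, galoisMap_tmul, outer_tmul, LinearEquiv.coe_coe,
      LinearEquiv.trans_apply, TensorProduct.assoc_symm_tmul, LinearEquiv.rTensor_tmul, E, e, e',
      LinearEquiv.ofBijective_apply, TensorProduct.rightComm_tmul]
    generalize δ' y = t
    induction t with
    | zero => simp
    | add x y hx hy => simp only [TensorProduct.tmul_add, TensorProduct.add_tmul, map_add, hx, hy]
    | tmul v a =>
      simp only [LinearMap.rTensor_tmul, TensorProduct.rightComm_tmul, LinearEquiv.rTensor_tmul,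
        LinearEquiv.ofBijective_apply, galoisMap_tmul]
      generalize δ x = t
      induction t with
      | zero => simp
      | add x y hx hy => simp only [TensorProduct.add_tmul, map_add, hx, hy]
      | tmul w b => simp [assoc]
  rw [hE]
  exact E.bijective

/-- Multiplying the hypothesis by elements of `Z` shows that `φ` and `φ'` agree on the image of the
Galois map, hence after tensoring with `Z`. Injectivity of `n ↦ e ⊗ n` then descends the equality to
`N`. -/
theorem eq_of_map_comp_eq {mZ : Z →ₗ[k] Z →ₗ[k] Z} {e : Z}
    {m : M →ₗ[k] Z} {δ : M →ₗ[k] M ⊗[k] C} (h : Function.Surjective (galoisMap mZ m δ))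
    (hN : Function.Injective (TensorProduct.mk k Z N e)) {φ φ' : C →ₗ[k] N}
    (hφ : TensorProduct.map m φ ∘ₗ δ = TensorProduct.map m φ' ∘ₗ δ) : φ = φ' := by
  have h1 : ∀ (ψ : C →ₗ[k] N) (t : Z) (w : M ⊗[k] C), ψ.lTensor Z ((mZ t ∘ₗ m).rTensor C w) =
      (mZ t).rTensor N (TensorProduct.map m ψ w) := by
    intro ψ t w
    induction w with
    | zero => simp
    | add x y hx hy => simp only [map_add, hx, hy]
    | tmul v a => simp
  have key : φ.lTensor Z ∘ₗ galoisMap mZ m δ = φ'.lTensor Z ∘ₗ galoisMap mZ m δ := by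
    apply TensorProduct.ext'
    intro t x
    have h0 : TensorProduct.map m φ (δ x) = TensorProduct.map m φ' (δ x) :=
      LinearMap.congr_fun hφ x
    rw [LinearMap.comp_apply, LinearMap.comp_apply, galoisMap_tmul, h1, h1, h0]
  ext c
  obtain ⟨p, hp⟩ := h (e ⊗ₜ c)
  have h2 := LinearMap.congr_fun key p
  rw [LinearMap.comp_apply, LinearMap.comp_apply, hp] at h2
  exact hN h2

theorem act_injective {mZ : Z →ₗ[k] Z →ₗ[k] Z} {e : Z}
    {m : M →ₗ[k] Z} {δ : M →ₗ[k] M ⊗[k] C} (h : Function.Surjective (galoisMap mZ m δ))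
    (he : Function.Injective (TensorProduct.mk k Z k e)) {τ τ' : WithConv (C →ₗ[k] k)}
    (hτ : m ∘ₗ act δ τ = m ∘ₗ act δ τ') : τ = τ' := by
  have key : ∀ (φ : WithConv (C →ₗ[k] k)), TensorProduct.map m φ.ofConv ∘ₗ δ =
      (TensorProduct.rid k Z).symm.toLinearMap ∘ₗ m ∘ₗ act δ φ := by
    intro φ
    ext x
    simp only [LinearMap.comp_apply, act, LinearEquiv.coe_coe]
    generalize δ x = s
    induction s with
    | zero => simp
    | add x y hx hy => simp only [map_add, hx, hy]
    | tmul v a => simp [← TensorProduct.tmul_smul]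
  exact WithConv.ext (eq_of_map_comp_eq h he (by rw [key, key, hτ]))

/-- A map `f : M → Z` which is colinear for a coaction commuting with `δ` has the form
`x ↦ m(x₀) τ(x₁)`, provided that the Galois map is bijective and the coinvariants are trivial. -/
theorem exists_eq_comp_act {mZ : Z →ₗ[k] Z →ₗ[k] Z} {e : Z} {mD : D →ₗ[k] D →ₗ[k] D} {oneD : D}
    (assoc : ∀ a b c, mZ (mZ a b) c = mZ a (mZ b c)) (one_mZ : ∀ a, mZ e a = a)
    (mZ_one : ∀ a, mZ a e = a) {b : Z →ₗ[k] Z ⊗[k] D}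
    (hb : ∀ s t, b (mZ s t) = TensorProduct.map₂ mZ mD (b s) (b t)) (hbe : b e = e ⊗ₜ oneD)
    (coinv : ∀ z, b z = z ⊗ₜ oneD → ∃ r : k, r • e = z)
    (inj : Function.Injective (LinearMap.toSpanSingleton k Z e))
    {m f : M →ₗ[k] Z} {δ : M →ₗ[k] M ⊗[k] C} {lam : M →ₗ[k] M ⊗[k] D}
    (hm : b ∘ₗ m = m.rTensor D ∘ₗ lam) (hf : b ∘ₗ f = f.rTensor D ∘ₗ lam)
    (hcomm : CoactionsCommute δ lam) (h : Function.Bijective (galoisMap mZ m δ)) :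
    ∃ τ : WithConv (C →ₗ[k] k), f = m ∘ₗ act δ τ := by
  let can := LinearEquiv.ofBijective _ h
  have can_apply : ∀ p, can p = galoisMap mZ m δ p := fun p => rfl
  let g : Z ⊗[k] M →ₗ[k] Z := TensorProduct.lift (mZ.compl₂ f)
  have g_tmul : ∀ t x, g (t ⊗ₜ x) = mZ t (f x) := fun t x => by simp [g]
  -- The codiagonal `D`-coaction on `Z ⊗ M`. The map `g` is colinear for it (`hg`).
  let Lam : Z ⊗[k] M →ₗ[k] (Z ⊗[k] M) ⊗[k] D := (TensorProduct.lift mD).lTensor _ ∘ₗ outer b lam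
  have hg : ∀ p, b (g p) = g.rTensor D (Lam p) := by
    intro p
    induction p with
    | zero => simp
    | add x y hx hy => simp only [map_add, hx, hy]
    | tmul t x =>
      have hfx := LinearMap.congr_fun hf x
      simp only [LinearMap.comp_apply] at hfx
      simp only [g_tmul, hb, hfx, Lam, LinearMap.comp_apply, outer_tmul]
      generalize b t = s
      generalize lam x = r
      induction s with
      | zero => simp
      | add x y hx hy => simp only [TensorProduct.add_tmul, map_add, LinearMap.add_apply, hx, hy]
      | tmul v a =>
        induction r with
        | zero => simp
        | add x y hx hy => simp only [TensorProduct.tmul_add, map_add, hx, hy]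
        | tmul w c => simp [g_tmul]
  -- The Galois map is colinear when `D` coacts on `Z ⊗ C` through `Z` only: as `δ` commutes with
  -- `lam`, the `C`-leg carries no `D`-coaction.
  have hcan : ∀ p, can.toLinearMap.rTensor D (Lam p) =
      TensorProduct.rightComm k Z D C (b.rTensor C (can p)) := by
    intro p
    induction p with
    | zero => simp
    | add x y hx hy => simp only [map_add, hx, hy]
    | tmul t x =>
      have h1 : ∀ w : M ⊗[k] C, b.rTensor C ((mZ t ∘ₗ m).rTensor C w) =
          (TensorProduct.map₂ mZ mD (b t) ∘ₗ m.rTensor D).rTensor C (lam.rTensor C w) := by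
        intro w
        induction w with
        | zero => simp
        | add x y hx hy => simp only [map_add, hx, hy]
        | tmul y c =>
          have hmy := LinearMap.congr_fun hm y
          simp only [LinearMap.comp_apply] at hmy
          simp only [LinearMap.rTensor_tmul, LinearMap.comp_apply, hb, hmy]
      have hx := LinearMap.congr_fun hcomm x
      simp only [LinearMap.comp_apply, LinearEquiv.coe_coe] at hx
      rw [can_apply, galoisMap_tmul, h1, hx]
      simp only [Lam, LinearMap.comp_apply, outer_tmul]
      generalize b t = s
      generalize lam x = r
      induction s with
      | zero => simp
      | add x y hx hy => simp only [TensorProduct.add_tmul, map_add, LinearMap.add_comp,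
          LinearMap.rTensor_add, LinearMap.add_apply, hx, hy]
      | tmul v a =>
        induction r with
        | zero => simp
        | add x y hx hy => simp only [TensorProduct.tmul_add, map_add, hx, hy]
        | tmul w c =>
          simp only [TensorProduct.tensorTensorTensorComm_tmul, LinearMap.lTensor_tmul,
            LinearMap.rTensor_tmul, LinearEquiv.coe_coe, can_apply, galoisMap_tmul,
            TensorProduct.lift.tmul]
          generalize δ w = q
          induction q with
          | zero => simp
          | add x y hx hy => simp only [TensorProduct.add_tmul, map_add, hx, hy]
          | tmul y d => simp
  -- `e ⊗ c` is coinvariant in `Z ⊗ C`, so its preimage under the colinear bijection `can` is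
  -- coinvariant for `Lam`, and the colinear map `g` sends that preimage to a coinvariant of `Z`.
  have hinv : ∀ c : C, b (g (can.symm (e ⊗ₜ c))) = g (can.symm (e ⊗ₜ c)) ⊗ₜ oneD := by
    intro c
    have h2 : Lam (can.symm (e ⊗ₜ c)) = can.symm (e ⊗ₜ c) ⊗ₜ oneD := by
      apply (can.rTensor D).injective
      change can.toLinearMap.rTensor D _ = can.toLinearMap.rTensor D _
      rw [hcan, LinearMap.rTensor_tmul, LinearEquiv.coe_coe, LinearEquiv.apply_symm_apply,
        LinearMap.rTensor_tmul, hbe, TensorProduct.rightComm_tmul]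
    rw [hg, h2, LinearMap.rTensor_tmul]
  have can_left : ∀ (s : Z) (p : Z ⊗[k] M),
      can ((mZ s).rTensor M p) = (mZ s).rTensor C (can p) := by
    intro s p
    induction p with
    | zero => simp
    | add x y hx hy => simp only [map_add, hx, hy]
    | tmul t x =>
      simp only [LinearMap.rTensor_tmul, can_apply, galoisMap_tmul, ← LinearMap.rTensor_comp_apply]
      congr 1
      ext y
      simp [assoc]
  have g_left : ∀ (s : Z) (p : Z ⊗[k] M), g ((mZ s).rTensor M p) = mZ s (g p) := by
    intro s p
    induction p with
    | zero => simp
    | add x y hx hy => simp only [map_add, hx, hy]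
    | tmul t x => simp [g_tmul, assoc]
  let ι := LinearEquiv.ofInjective _ inj
  -- The coinvariant `g (can⁻¹ (e ⊗ c))` is a multiple of `e`; `τ c` is the coefficient, well
  -- defined because `r ↦ r • e` is injective.
  let τ : C →ₗ[k] k := ι.symm.toLinearMap ∘ₗ
    (g ∘ₗ can.symm.toLinearMap ∘ₗ TensorProduct.mk k Z C e).codRestrict
      (LinearMap.range (LinearMap.toSpanSingleton k Z e)) (fun c => coinv _ (hinv c))
  have hτ : ∀ c, τ c • e = g (can.symm (e ⊗ₜ c)) := by
    intro c
    have h3 : (ι (τ c) : Z) = g (can.symm (e ⊗ₜ c)) := by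
      simp only [τ, LinearMap.comp_apply, LinearEquiv.coe_coe, LinearEquiv.apply_symm_apply]
      rfl
    exact h3
  refine ⟨WithConv.toConv τ, ?_⟩
  -- Both `can` and `g` commute with left multiplication by `Z`, so the value at `m y ⊗ c` is `m y`
  -- times the scalar `τ c`. Applied to `can (e ⊗ x) = m(x₀) ⊗ x₁`, this gives the claim, since `g
  -- (e ⊗ x) = f x`.
  have key : ∀ w : M ⊗[k] C, g (can.symm (m.rTensor C w)) =
      m (TensorProduct.rid k M (τ.lTensor M w)) := by
    intro w
    induction w with
    | zero => simp
    | add x y hx hy => simp only [map_add, hx, hy]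
    | tmul y c =>
      have h4 : can.symm (m y ⊗ₜ c) = (mZ (m y)).rTensor M (can.symm (e ⊗ₜ c)) := by
        rw [LinearEquiv.symm_apply_eq, can_left, LinearEquiv.apply_symm_apply,
          LinearMap.rTensor_tmul, mZ_one]
      rw [LinearMap.rTensor_tmul, h4, g_left, ← hτ, map_smul, mZ_one]
      simp
  ext x
  change f x = m (TensorProduct.rid k M (τ.lTensor M (δ x)))
  rw [← key]
  have h5 : m.rTensor C (δ x) = can (e ⊗ₜ x) := by
    rw [can_apply, galoisMap_tmul]
    congr 2
    ext y
    simp [one_mZ]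
  rw [h5, LinearEquiv.symm_apply_apply, g_tmul, one_mZ]

end GaloisMap

/-! ### Transporting lazy cohomology along a relation -/

section Transport

/-- Related units, for a multiplicative relation `R` which is functional. -/
theorem exists_unit_of_rel {P Q : Type*} [Monoid P] [Monoid Q] {R : P → Q → Prop}
    (one : R 1 1) (mul : ∀ {σ σ' τ τ'}, R σ τ → R σ' τ' → R (σ * σ') (τ * τ'))
    (unique : ∀ {σ τ τ'}, R σ τ → R σ τ' → τ = τ') {σ : Pˣ} {τ τ' : Q} (h : R σ.val τ)
    (h' : R σ⁻¹.val τ') : ∃ φ : Qˣ, φ.val = τ ∧ φ⁻¹.val = τ' :=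
  ⟨⟨τ, τ', unique (by simpa using mul h h') one, unique (by simpa using mul h' h) one⟩, rfl, rfl⟩

/-- On lazy cocycles `R` is the graph of a bijection, and multiplicativity of `R` with uniqueness
makes that bijection a homomorphism. The coboundary hypotheses are needed in both directions so that
`B²_L(A)` maps onto `B²_L(B)`. -/
theorem nonempty_HL2_mulEquiv_of_rel {k : Type*} [CommRing k] {A : Type*} [Ring A] [Bialgebra k A]
    {B : Type*} [Ring B] [Bialgebra k B] (R : Conv2 k A → Conv2 k B → Prop)
    (mul : ∀ {σ σ' τ τ'}, R σ τ → R σ' τ' → R (σ * σ') (τ * τ'))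
    (unique_right : ∀ {σ τ τ'}, R σ τ → R σ τ' → τ = τ')
    (unique_left : ∀ {σ σ' τ}, R σ τ → R σ' τ → σ = σ')
    (exists_right : ∀ σ ∈ ZL2 k A, ∃ τ ∈ ZL2 k B, R σ τ)
    (exists_left : ∀ τ ∈ ZL2 k B, ∃ σ ∈ ZL2 k A, R σ τ)
    (coboundary_right : ∀ μ ∈ Reg1L k A, ∃ ν ∈ Reg1L k B, R (coboundary μ) (coboundary ν))
    (coboundary_left : ∀ ν ∈ Reg1L k B, ∃ μ ∈ Reg1L k A, R (coboundary μ) (coboundary ν)) :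
    Nonempty (HL2 k A ≃* HL2 k B) := by
  choose f hf hR using exists_right
  let F : ZL2 k A →* ZL2 k B := MonoidHom.mk' (fun σ => ⟨f σ.1 σ.2, hf σ.1 σ.2⟩) fun σ σ' =>
    Subtype.ext (unique_right (hR _ _) (mul (hR σ.1 σ.2) (hR σ'.1 σ'.2)))
  have hF : ∀ σ, R σ.1 (F σ).1 := fun σ => hR σ.1 σ.2
  have bij : Function.Bijective F := by
    refine ⟨fun σ σ' h => Subtype.ext (unique_left (hF σ) (h ▸ hF σ')), fun τ => ?_⟩
    obtain ⟨σ, hσ, h⟩ := exists_left τ.1 τ.2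
    exact ⟨⟨σ, hσ⟩, Subtype.ext (unique_right (hF _) h)⟩
  let e : ZL2 k A ≃* ZL2 k B := MulEquiv.ofBijective F bij
  refine ⟨QuotientGroup.congr (BL2 k A) (BL2 k B) e ?_⟩
  ext τ
  rw [Subgroup.mem_map]
  constructor
  · rintro ⟨σ, ⟨μ, hμ, h⟩, rfl⟩
    obtain ⟨ν, hν, h'⟩ := coboundary_right μ hμ
    exact ⟨ν, hν, unique_right (hF σ) (h ▸ h')⟩
  · rintro ⟨ν, hν, h⟩
    obtain ⟨μ, hμ, h'⟩ := coboundary_left ν hν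
    obtain ⟨σ, rfl⟩ := bij.2 τ
    refine ⟨σ, ⟨μ, hμ, unique_left (hF σ) (h ▸ h')⟩, rfl⟩

end Transport

/-! ### Lazy forms on the two sides of a biGalois object -/

section BiGalois

variable {k : Type*} [CommRing k] {Z : Type*} [Ring Z] [Algebra k Z]
  {M : Type*} [AddCommGroup M] [Module k M] {M' : Type*} [AddCommGroup M'] [Module k M']
  {C : Type*} [AddCommGroup C] [Module k C] {C' : Type*} [AddCommGroup C'] [Module k C']
  {D : Type*} [AddCommGroup D] [Module k D] {D' : Type*} [AddCommGroup D'] [Module k D']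

/-- The form `τ` is central with respect to `g`, for the comultiplication `Δ`. -/
def IsCentralFor {N : Type*} [AddCommGroup N] [Module k N] (Δ : C →ₗ[k] C ⊗[k] C)
    (g : C →ₗ[k] N) (τ : WithConv (C →ₗ[k] k)) : Prop :=
  (TensorProduct.rid k N).toLinearMap ∘ₗ TensorProduct.map g τ.ofConv ∘ₗ Δ =
    (TensorProduct.lid k N).toLinearMap ∘ₗ TensorProduct.map τ.ofConv g ∘ₗ Δ

theorem isCentralFor_comul_iff [Coalgebra k C] {R : Type*} [Ring R] [Algebra k R]
    {g : C →ₗ[k] R} {τ : WithConv (C →ₗ[k] k)} :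
    IsCentralFor comul g τ ↔ Commute (convScalar R τ) (WithConv.toConv g) := by
  rw [IsCentralFor, rid_map_comul, lid_map_comul]
  exact ⟨fun h => (WithConv.ext h).symm, fun h => congrArg WithConv.ofConv h.eq.symm⟩

/-- Centrality is symmetric under reversing the comultiplication, so laziness is the same condition
whether the form acts through a left or a right coaction. -/
theorem isCentralFor_opComul_iff [Coalgebra k C] {R : Type*} [Ring R] [Algebra k R]
    {g : C →ₗ[k] R} {τ : WithConv (C →ₗ[k] k)} :
    IsCentralFor ((TensorProduct.comm k C C).toLinearMap ∘ₗ comul) g τ ↔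
      Commute (convScalar R τ) (WithConv.toConv g) := by
  rw [IsCentralFor, rid_map_opComul, lid_map_opComul]
  exact ⟨fun h => WithConv.ext h, fun h => congrArg WithConv.ofConv h.eq⟩

/-- `b` is multiplicative for the products `mZ` and `mR` and has trivial coinvariants. -/
structure HasTrivialCoinvariants {Z R : Type*} [AddCommGroup Z] [Module k Z] [AddCommGroup R]
    [Module k R] (mZ : Z →ₗ[k] Z →ₗ[k] Z) (e : Z) (mR : R →ₗ[k] R →ₗ[k] R) (oneR : R)
    (b : Z →ₗ[k] Z ⊗[k] R) : Prop where
  assoc : ∀ x y z, mZ (mZ x y) z = mZ x (mZ y z)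
  one_mul : ∀ x, mZ e x = x
  mul_one : ∀ x, mZ x e = x
  map_mul : ∀ s t, b (mZ s t) = TensorProduct.map₂ mZ mR (b s) (b t)
  map_one : b e = e ⊗ₜ oneR
  coinv : ∀ z, b z = z ⊗ₜ oneR → ∃ r : k, r • e = z
  inj : Function.Injective (LinearMap.toSpanSingleton k Z e)

/-- The heart of the biGalois argument. Laziness of `σ` makes `m ∘ act lam σ` colinear on the
`D`-side, so trivial coinvariants there and the Galois map on the `C`-side produce `τ`. Conversely
`act lam σ` is always colinear on the `C`-side; read through `τ`, this says that `τ` is lazy. -/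
theorem HasTrivialCoinvariants.exists_central {Z R S : Type*} [AddCommGroup Z] [Module k Z]
    [AddCommGroup R] [Module k R] [AddCommGroup S] [Module k S] {mZ : Z →ₗ[k] Z →ₗ[k] Z} {e : Z}
    {mR : R →ₗ[k] R →ₗ[k] R} {oneR : R} {b : Z →ₗ[k] Z ⊗[k] R}
    (hZ : HasTrivialCoinvariants mZ e mR oneR b) {b' : Z →ₗ[k] Z ⊗[k] S}
    (hS : Function.Injective (TensorProduct.mk k Z S e))
    {m : M →ₗ[k] Z} {ΔC : C →ₗ[k] C ⊗[k] C} {εC : C →ₗ[k] k} {δ : M →ₗ[k] M ⊗[k] C}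
    (hδ : IsCoaction ΔC εC δ) {ΔD : D →ₗ[k] D ⊗[k] D} {εD : D →ₗ[k] k} {lam : M →ₗ[k] M ⊗[k] D}
    (hlam : IsCoaction ΔD εD lam) (hcomm : CoactionsCommute δ lam)
    {g : D →ₗ[k] R} {g' : C →ₗ[k] S} (hg : b ∘ₗ m = TensorProduct.map m g ∘ₗ lam)
    (hg' : b' ∘ₗ m = TensorProduct.map m g' ∘ₗ δ) (h : Function.Bijective (galoisMap mZ m δ))
    {σ : WithConv (D →ₗ[k] k)} (hσ : IsCentralFor ΔD g σ) :
    ∃ τ : WithConv (C →ₗ[k] k), m ∘ₗ act lam σ = m ∘ₗ act δ τ ∧ IsCentralFor ΔC g' τ := by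
  -- Laziness is used exactly here: it identifies the two expressions `x₀ ⊗ g(x₁) σ(x₂)` and `x₀ ⊗
  -- σ(x₁) g(x₂)`.
  have hlazy : g.lTensor M ∘ₗ lam ∘ₗ act lam σ = TensorProduct.map (act lam σ) g ∘ₗ lam := by
    rw [hlam.lTensor_act, hlam.map_act, hσ]
  have hm : b ∘ₗ m = m.rTensor R ∘ₗ g.lTensor M ∘ₗ lam := by
    rw [hg, ← LinearMap.comp_assoc, LinearMap.rTensor_comp_lTensor]
  have hf : b ∘ₗ m ∘ₗ act lam σ = (m ∘ₗ act lam σ).rTensor R ∘ₗ g.lTensor M ∘ₗ lam := by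
    rw [← LinearMap.comp_assoc, hm, LinearMap.comp_assoc, LinearMap.comp_assoc, hlazy,
      LinearMap.rTensor_comp, LinearMap.comp_assoc,
      ← LinearMap.comp_assoc lam (g.lTensor M) ((act lam σ).rTensor R),
      LinearMap.rTensor_comp_lTensor]
  obtain ⟨τ, hτ⟩ := exists_eq_comp_act hZ.assoc hZ.one_mul hZ.mul_one hZ.map_mul hZ.map_one
    hZ.coinv hZ.inj hm hf (hcomm.lTensor g) h
  refine ⟨τ, hτ, eq_of_map_comp_eq h.2 hS ?_⟩
  have key : ∀ φ : C →ₗ[k] S, TensorProduct.map m φ ∘ₗ δ = m.rTensor S ∘ₗ φ.lTensor M ∘ₗ δ := by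
    intro φ
    rw [← LinearMap.comp_assoc, LinearMap.rTensor_comp_lTensor]
  rw [key, key, ← hδ.lTensor_act, ← hδ.map_act]
  -- The two sides of the laziness of `τ`, tested against `m`, become `b'` after the deformed map
  -- and the deformed map after the coaction. They agree because `act lam σ` commutes with `δ`.
  have e1 : m.rTensor S ∘ₗ g'.lTensor M ∘ₗ δ ∘ₗ act δ τ = b' ∘ₗ m ∘ₗ act lam σ := by
    rw [hτ, ← LinearMap.comp_assoc _ m b', hg', ← LinearMap.comp_assoc,
      LinearMap.rTensor_comp_lTensor, LinearMap.comp_assoc]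
  have e2 : m.rTensor S ∘ₗ TensorProduct.map (act δ τ) g' ∘ₗ δ =
      TensorProduct.map (m ∘ₗ act lam σ) g' ∘ₗ δ := by
    rw [hτ, ← LinearMap.comp_assoc, LinearMap.rTensor_comp_map]
  rw [e1, e2, ← LinearMap.comp_assoc, hg', LinearMap.comp_assoc, hcomm.comp_act,
    ← LinearMap.comp_assoc, LinearMap.map_comp_rTensor]

/-- The product `x ⊗ y ↦ m(x) m'(y)` of two maps to an algebra. -/
def mulMap (m : M →ₗ[k] Z) (m' : M' →ₗ[k] Z) : M ⊗[k] M' →ₗ[k] Z :=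
  TensorProduct.lift ((LinearMap.mul k Z).compl₁₂ m m')

@[simp]
theorem mulMap_tmul (m : M →ₗ[k] Z) (m' : M' →ₗ[k] Z) (x : M) (y : M') :
    mulMap m m' (x ⊗ₜ y) = m x * m' y := rfl

theorem mulMap_outer {R : Type*} [Ring R] [Algebra k R] (b : Z →ₐ[k] Z ⊗[k] R)
    {m : M →ₗ[k] Z} {m' : M' →ₗ[k] Z} {δ : M →ₗ[k] M ⊗[k] C} {δ' : M' →ₗ[k] M' ⊗[k] C'}
    {g : C →ₗ[k] R} {g' : C' →ₗ[k] R} (h : b.toLinearMap ∘ₗ m = TensorProduct.map m g ∘ₗ δ)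
    (h' : b.toLinearMap ∘ₗ m' = TensorProduct.map m' g' ∘ₗ δ') :
    b.toLinearMap ∘ₗ mulMap m m' =
      TensorProduct.map (mulMap m m') (mulMap g g') ∘ₗ outer δ δ' := by
  ext x y
  have hx := LinearMap.congr_fun h x
  have hy := LinearMap.congr_fun h' y
  simp only [LinearMap.comp_apply, AlgHom.toLinearMap_apply] at hx hy
  simp only [TensorProduct.AlgebraTensorModule.curry_apply, LinearMap.restrictScalars_self,
    TensorProduct.curry_apply, LinearMap.comp_apply, outer_tmul, AlgHom.toLinearMap_apply,
    mulMap_tmul, map_mul, hx, hy]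
  generalize δ x = s
  generalize δ' y = t
  induction s with
  | zero => simp
  | add x y hx hy => simp only [TensorProduct.add_tmul, map_add, add_mul, hx, hy]
  | tmul v a =>
    induction t with
    | zero => simp
    | add x y hx hy => simp only [TensorProduct.tmul_add, map_add, mul_add, hx, hy]
    | tmul w b => simp

/-- A left coaction, written on the right. -/
def opCoaction {A : Type*} [Ring A] [Algebra k A] (β : Z →ₐ[k] A ⊗[k] Z) : Z →ₐ[k] Z ⊗[k] A :=
  (Algebra.TensorProduct.comm k A Z).toAlgHom.comp β

theorem opCoaction_apply {A : Type*} [Ring A] [Algebra k A] (β : Z →ₐ[k] A ⊗[k] Z) (x : Z) :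
    opCoaction β x = TensorProduct.comm k A Z (β x) := rfl

variable {A : Type*} [Ring A] [Bialgebra k A] {B : Type*} [Ring B] [Bialgebra k B]

theorem IsLeftGalois.isCoaction {β : Z →ₐ[k] A ⊗[k] Z} (h : IsLeftGalois β) :
    IsCoaction ((TensorProduct.comm k A A).toLinearMap ∘ₗ comul) counit
      (opCoaction β).toLinearMap where
  coassoc := by
    -- The permutation `a ⊗ (a' ⊗ z) ↦ z ⊗ (a' ⊗ a)`: it moves the coacting factors to the right and
    -- reverses their order, which accounts for the co-opposite comultiplication.
    let P : A ⊗[k] (A ⊗[k] Z) →ₗ[k] Z ⊗[k] (A ⊗[k] A) :=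
      (TensorProduct.assoc k Z A A).toLinearMap ∘ₗ
        (TensorProduct.comm k A Z).toLinearMap.rTensor A ∘ₗ
          (TensorProduct.comm k A (A ⊗[k] Z)).toLinearMap
    have key1 : ∀ w : A ⊗[k] Z, TensorProduct.assoc k Z A A
        ((opCoaction β).toLinearMap.rTensor A (TensorProduct.comm k A Z w)) =
        P (β.toLinearMap.lTensor A w) := by
      intro w
      induction w with
      | zero => simp
      | add x y hx hy => simp only [map_add, hx, hy]
      | tmul a z => simp [P, opCoaction_apply]
    have key2 : ∀ w : A ⊗[k] Z, ((TensorProduct.comm k A A).toLinearMap ∘ₗ comul).lTensor Z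
        (TensorProduct.comm k A Z w) =
        P (TensorProduct.assoc k A A Z ((comul (R := k) (A := A)).rTensor Z w)) := by
      intro w
      induction w with
      | zero => simp
      | add x y hx hy => simp only [map_add, hx, hy]
      | tmul a z =>
        simp only [TensorProduct.comm_tmul, LinearMap.lTensor_tmul, LinearMap.rTensor_tmul,
          LinearMap.comp_apply, LinearEquiv.coe_coe]
        generalize comul (R := k) a = s
        induction s with
        | zero => simp
        | add x y hx hy => simp only [TensorProduct.tmul_add, TensorProduct.add_tmul, map_add,
            hx, hy]
        | tmul v a => simp [P]
    ext x
    have hx := LinearMap.congr_fun h.coassoc x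
    simp only [LinearMap.comp_apply, LinearEquiv.coe_coe, AlgHom.toLinearMap_apply] at hx
    refine (key1 (β x)).trans (Eq.trans ?_ (key2 (β x)).symm)
    rw [hx]
  counit_comp := by
    have key : ∀ w : A ⊗[k] Z, TensorProduct.rid k Z ((counit (R := k) (A := A)).lTensor Z
        (TensorProduct.comm k A Z w)) =
        TensorProduct.lid k Z ((counit (R := k) (A := A)).rTensor Z w) := by
      intro w
      induction w with
      | zero => simp
      | add x y hx hy => simp only [map_add, hx, hy]
      | tmul a z => simp
    ext x
    exact (key (β x)).trans (LinearMap.congr_fun h.counit_comp x)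

theorem IsRightGalois.isCoaction {ρ : Z →ₐ[k] Z ⊗[k] B} (h : IsRightGalois ρ) :
    IsCoaction comul counit ρ.toLinearMap := ⟨h.coassoc, h.counit_comp⟩

/-- With the opposite product of `Z`, the left Galois map becomes `t ⊗ x ↦ x₍₀₎ t ⊗ x₍₋₁₎`; it is
the given bijection conjugated by flips. -/
theorem IsLeftGalois.galoisMap_bijective {β : Z →ₐ[k] A ⊗[k] Z} (h : IsLeftGalois β) :
    Function.Bijective
      (galoisMap (LinearMap.mul k Z).flip LinearMap.id (opCoaction β).toLinearMap) := by
  let E := TensorProduct.comm k Z Z ≪≫ₗ LinearEquiv.ofBijective _ h.bijective ≪≫ₗ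
    TensorProduct.comm k A Z
  have hE : galoisMap (LinearMap.mul k Z).flip LinearMap.id (opCoaction β).toLinearMap =
      E.toLinearMap := by
    apply TensorProduct.ext'
    intro t x
    simp only [galoisMap_tmul, E, LinearEquiv.coe_coe, LinearEquiv.trans_apply,
      TensorProduct.comm_tmul, LinearEquiv.ofBijective_apply, AlgHom.toLinearMap_apply,
      opCoaction_apply, LinearMap.comp_apply, LinearMap.rTensor_tmul]
    generalize β x = s
    induction s with
    | zero => simp
    | add x y hx hy => simp only [TensorProduct.add_tmul, map_add, hx, hy]
    | tmul v a => simp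
  rw [hE]
  exact E.bijective

theorem IsRightGalois.galoisMap_bijective {ρ : Z →ₐ[k] Z ⊗[k] B} (h : IsRightGalois ρ) :
    Function.Bijective (galoisMap (LinearMap.mul k Z) LinearMap.id ρ.toLinearMap) :=
  h.bijective

theorem IsLeftGalois.hasTrivialCoinvariants {β : Z →ₐ[k] A ⊗[k] Z} (h : IsLeftGalois β) :
    HasTrivialCoinvariants (LinearMap.mul k Z) 1 (LinearMap.mul k A) 1
      (opCoaction β).toLinearMap where
  assoc := mul_assoc
  one_mul := one_mul
  mul_one := mul_one
  map_mul s t := by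
    simp only [LinearMap.mul_apply', AlgHom.toLinearMap_apply, map_mul]
    generalize opCoaction β s = x
    generalize opCoaction β t = y
    induction x with
    | zero => simp
    | add x y hx hy => simp only [map_add, LinearMap.add_apply, add_mul, hx, hy]
    | tmul v a =>
      induction y with
      | zero => simp
      | add x y hx hy => simp only [map_add, mul_add, hx, hy]
      | tmul w b => simp
  map_one := by simp [Algebra.TensorProduct.one_def]
  coinv z hz := by
    obtain ⟨r, hr⟩ := (h.coinvariants z).1 ((TensorProduct.comm k A Z).injective
      (by simpa [opCoaction_apply] using hz))
    exact ⟨r, by rw [← hr, Algebra.algebraMap_eq_smul_one]⟩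
  inj r s hrs := h.injective_algebraMap (by
    simpa [Algebra.algebraMap_eq_smul_one] using hrs)

/-- The products are opposite here, and not in `IsLeftGalois.hasTrivialCoinvariants`, because
coinvariants on one side are paired with the Galois map of the other side, and the left Galois map
is written with the opposite product. -/
theorem IsRightGalois.hasTrivialCoinvariants {ρ : Z →ₐ[k] Z ⊗[k] B} (h : IsRightGalois ρ) :
    HasTrivialCoinvariants (LinearMap.mul k Z).flip 1 (LinearMap.mul k B).flip 1
      ρ.toLinearMap where
  assoc x y z := (mul_assoc z y x).symm
  one_mul := mul_one
  mul_one := one_mul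
  map_mul s t := by
    simp only [LinearMap.mul_apply', LinearMap.flip_apply, AlgHom.toLinearMap_apply, map_mul]
    generalize ρ s = x
    generalize ρ t = y
    induction x with
    | zero => simp
    | add x y hx hy => simp only [map_add, LinearMap.add_apply, mul_add, hx, hy]
    | tmul v a =>
      induction y with
      | zero => simp
      | add x y hx hy => simp only [map_add, add_mul, hx, hy]
      | tmul w b => simp
  map_one := by simp [Algebra.TensorProduct.one_def]
  coinv z hz := by
    obtain ⟨r, hr⟩ := (h.coinvariants z).1 hz
    exact ⟨r, by rw [← hr, Algebra.algebraMap_eq_smul_one]⟩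
  inj r s hrs := h.injective_algebraMap (by
    simpa [Algebra.algebraMap_eq_smul_one] using hrs)

theorem IsBiGalois.coactionsCommute {β : Z →ₐ[k] A ⊗[k] Z} {ρ : Z →ₐ[k] Z ⊗[k] B}
    (h : IsBiGalois β ρ) :
    CoactionsCommute ρ.toLinearMap (opCoaction β).toLinearMap := by
  let P : A ⊗[k] (Z ⊗[k] B) →ₗ[k] (Z ⊗[k] A) ⊗[k] B :=
    (TensorProduct.comm k A Z).toLinearMap.rTensor B ∘ₗ
      (TensorProduct.assoc k A Z B).symm.toLinearMap
  have key1 : ∀ w : Z ⊗[k] B, (opCoaction β).toLinearMap.rTensor B w =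
      P (TensorProduct.assoc k A Z B (β.toLinearMap.rTensor B w)) := by
    intro w
    induction w with
    | zero => simp
    | add x y hx hy => simp only [map_add, hx, hy]
    | tmul z b => simp [P, opCoaction_apply]
  have key2 : ∀ w : A ⊗[k] Z, TensorProduct.rightComm k Z B A
      (ρ.toLinearMap.rTensor A (TensorProduct.comm k A Z w)) = P (ρ.toLinearMap.lTensor A w) := by
    intro w
    induction w with
    | zero => simp
    | add x y hx hy => simp only [map_add, hx, hy]
    | tmul a z =>
      simp only [TensorProduct.comm_tmul, LinearMap.rTensor_tmul, LinearMap.lTensor_tmul]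
      generalize ρ.toLinearMap z = s
      induction s with
      | zero => simp
      | add x y hx hy => simp only [TensorProduct.tmul_add, TensorProduct.add_tmul, map_add, hx, hy]
      | tmul z b => simp [P]
  ext x
  have hx := LinearMap.congr_fun h.bicomodule x
  simp only [LinearMap.comp_apply, LinearEquiv.coe_coe] at hx
  simp only [LinearMap.comp_apply, LinearEquiv.coe_coe]
  rw [key1, hx]
  exact (key2 (β x)).symm

/-- The data by which forms on `D` and on `C` are compared: `D` and `C` coact on `M` (on opposite
sides), and `m : M → Z` induces bijective Galois maps for both coactions. -/
structure IsGaloisLevel [Coalgebra k C] [Coalgebra k D] (b : Z →ₐ[k] Z ⊗[k] A)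
    (ρ : Z →ₐ[k] Z ⊗[k] B) (m : M →ₗ[k] Z) (lam : M →ₗ[k] M ⊗[k] D) (δ : M →ₗ[k] M ⊗[k] C)
    (g : D →ₗ[k] A) (g' : C →ₗ[k] B) : Prop where
  left : IsCoaction ((TensorProduct.comm k D D).toLinearMap ∘ₗ comul) counit lam
  right : IsCoaction comul counit δ
  commute : CoactionsCommute δ lam
  map_left : b.toLinearMap ∘ₗ m = TensorProduct.map m g ∘ₗ lam
  map_right : ρ.toLinearMap ∘ₗ m = TensorProduct.map m g' ∘ₗ δ
  bijective_left : Function.Bijective (galoisMap (LinearMap.mul k Z).flip m lam)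
  bijective_right : Function.Bijective (galoisMap (LinearMap.mul k Z) m δ)

theorem IsBiGalois.isGaloisLevel {β : Z →ₐ[k] A ⊗[k] Z} {ρ : Z →ₐ[k] Z ⊗[k] B}
    (h : IsBiGalois β ρ) :
    IsGaloisLevel (opCoaction β) ρ LinearMap.id (opCoaction β).toLinearMap ρ.toLinearMap
      LinearMap.id LinearMap.id where
  left := h.left.isCoaction
  right := h.right.isCoaction
  commute := h.coactionsCommute
  map_left := by simp
  map_right := by simp
  bijective_left := h.left.galoisMap_bijective
  bijective_right := h.right.galoisMap_bijective

/-- Starting from `Z` itself, this supplies the levels `Z ⊗ Z` and `(Z ⊗ Z) ⊗ Z`. -/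
theorem IsGaloisLevel.mul [Coalgebra k C] [Coalgebra k D] [Coalgebra k C'] [Coalgebra k D']
    {b : Z →ₐ[k] Z ⊗[k] A} {ρ : Z →ₐ[k] Z ⊗[k] B} {m : M →ₗ[k] Z} {lam : M →ₗ[k] M ⊗[k] D}
    {δ : M →ₗ[k] M ⊗[k] C} {g₁ : D →ₗ[k] A} {g₂ : C →ₗ[k] B}
    (h : IsGaloisLevel b ρ m lam δ g₁ g₂) {m' : M' →ₗ[k] Z} {lam' : M' →ₗ[k] M' ⊗[k] D'}
    {δ' : M' →ₗ[k] M' ⊗[k] C'} {g₁' : D' →ₗ[k] A} {g₂' : C' →ₗ[k] B}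
    (h' : IsGaloisLevel b ρ m' lam' δ' g₁' g₂') :
    IsGaloisLevel b ρ (mulMap m m') (outer lam lam') (outer δ δ') (mulMap g₁ g₁')
      (mulMap g₂ g₂') where
  left := by
    have := h.left.outer h'.left
    rwa [outer_opComul, outer_counit] at this
  right := by
    have := h.right.outer h'.right
    rwa [outer_comul, outer_counit] at this
  commute := h.commute.outer h'.commute
  map_left := mulMap_outer b h.map_left h'.map_left
  map_right := mulMap_outer ρ h.map_right h'.map_right
  bijective_left := galoisMap_bijective_mul_flip (mZ := (LinearMap.mul k Z).flip)
    (fun x y z => (mul_assoc z y x).symm) h.bijective_left h'.bijective_left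
  bijective_right := galoisMap_bijective_mul (mZ := LinearMap.mul k Z) mul_assoc
    h.bijective_right h'.bijective_right

/-- The forms `σ` and `τ` define the same deformation of `m`. -/
def IsIntertwined (m : M →ₗ[k] Z) (lam : M →ₗ[k] M ⊗[k] D) (δ : M →ₗ[k] M ⊗[k] C)
    (σ : WithConv (D →ₗ[k] k)) (τ : WithConv (C →ₗ[k] k)) : Prop :=
  m ∘ₗ act lam σ = m ∘ₗ act δ τ

section Level

variable [Coalgebra k C] [Coalgebra k D] {β : Z →ₐ[k] A ⊗[k] Z} {ρ : Z →ₐ[k] Z ⊗[k] B}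
  {m : M →ₗ[k] Z} {lam : M →ₗ[k] M ⊗[k] D} {δ : M →ₗ[k] M ⊗[k] C} {g : D →ₗ[k] A} {g' : C →ₗ[k] B}

theorem IsGaloisLevel.intertwined_one (h : IsGaloisLevel (opCoaction β) ρ m lam δ g g') :
    IsIntertwined m lam δ 1 1 := by
  rw [IsIntertwined, act_one h.left, act_one h.right]

/-- The left action reverses products while the right one preserves them, and the two commute.
Replacing `σ'` by `τ'` next to `m`, moving `τ'` past `σ`, and then replacing `σ` by `τ` yields `τ *
τ'` in the correct order. -/
theorem IsGaloisLevel.intertwined_mul (h : IsGaloisLevel (opCoaction β) ρ m lam δ g g')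
    {σ σ' : WithConv (D →ₗ[k] k)} {τ τ' : WithConv (C →ₗ[k] k)} (h1 : IsIntertwined m lam δ σ τ)
    (h2 : IsIntertwined m lam δ σ' τ') : IsIntertwined m lam δ (σ * σ') (τ * τ') := by
  rw [IsIntertwined] at h1 h2 ⊢
  rw [act_mul_op h.left, act_mul h.right, ← LinearMap.comp_assoc, h2, LinearMap.comp_assoc,
    h.commute.act_comp_act, ← LinearMap.comp_assoc, h1, LinearMap.comp_assoc]

theorem IsGaloisLevel.unique_right (h : IsGaloisLevel (opCoaction β) ρ m lam δ g g')
    (hk : Function.Injective (TensorProduct.mk k Z k 1))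
    {σ : WithConv (D →ₗ[k] k)} {τ τ' : WithConv (C →ₗ[k] k)} (h1 : IsIntertwined m lam δ σ τ)
    (h2 : IsIntertwined m lam δ σ τ') : τ = τ' :=
  act_injective h.bijective_right.2 hk (h1.symm.trans h2)

theorem IsGaloisLevel.unique_left (h : IsGaloisLevel (opCoaction β) ρ m lam δ g g')
    (hk : Function.Injective (TensorProduct.mk k Z k 1))
    {σ σ' : WithConv (D →ₗ[k] k)} {τ : WithConv (C →ₗ[k] k)} (h1 : IsIntertwined m lam δ σ τ)
    (h2 : IsIntertwined m lam δ σ' τ) : σ = σ' :=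
  act_injective h.bijective_left.2 hk (h1.trans h2.symm)

/-- The left coinvariants of `Z` are combined with the right Galois map of the level;
`IsGaloisLevel.exists_left` exchanges the roles. -/
theorem IsGaloisLevel.exists_right (h : IsGaloisLevel (opCoaction β) ρ m lam δ g g')
    (hZ : IsBiGalois β ρ) (hB : Function.Injective (TensorProduct.mk k Z B 1))
    {σ : WithConv (D →ₗ[k] k)} (hσ : Commute (convScalar A σ) (WithConv.toConv g)) :
    ∃ τ, IsIntertwined m lam δ σ τ ∧ Commute (convScalar B τ) (WithConv.toConv g') := by
  obtain ⟨τ, h1, h2⟩ := hZ.left.hasTrivialCoinvariants.exists_central hB h.right h.left h.commute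
    h.map_left h.map_right h.bijective_right (isCentralFor_opComul_iff.2 hσ)
  exact ⟨τ, h1, isCentralFor_comul_iff.1 h2⟩

theorem IsGaloisLevel.exists_left (h : IsGaloisLevel (opCoaction β) ρ m lam δ g g')
    (hZ : IsBiGalois β ρ) (hA : Function.Injective (TensorProduct.mk k Z A 1))
    {τ : WithConv (C →ₗ[k] k)} (hτ : Commute (convScalar B τ) (WithConv.toConv g')) :
    ∃ σ, IsIntertwined m lam δ σ τ ∧ Commute (convScalar A σ) (WithConv.toConv g) := by
  obtain ⟨τ, h1, h2⟩ := hZ.right.hasTrivialCoinvariants.exists_central hA h.left h.right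
    h.commute.symm h.map_right h.map_left h.bijective_left (isCentralFor_comul_iff.2 hτ)
  exact ⟨τ, h1.symm, isCentralFor_opComul_iff.1 h2⟩

end Level

end BiGalois

/-! ### Naturality and associativity of outer coactions -/

section OuterNaturality

variable {k : Type*} [CommRing k]
  {M : Type*} [AddCommGroup M] [Module k M] {M' : Type*} [AddCommGroup M'] [Module k M']
  {M'' : Type*} [AddCommGroup M''] [Module k M'']
  {N : Type*} [AddCommGroup N] [Module k N] {N' : Type*} [AddCommGroup N'] [Module k N']
  {C : Type*} [AddCommGroup C] [Module k C] {C' : Type*} [AddCommGroup C'] [Module k C']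
  {C'' : Type*} [AddCommGroup C''] [Module k C'']
  {D : Type*} [AddCommGroup D] [Module k D] {D' : Type*} [AddCommGroup D'] [Module k D']

theorem outer_comp_map {δ : M →ₗ[k] M ⊗[k] C} {δ' : M' →ₗ[k] M' ⊗[k] C'} {d : N →ₗ[k] N ⊗[k] D}
    {d' : N' →ₗ[k] N' ⊗[k] D'} {f : M →ₗ[k] N} {f' : M' →ₗ[k] N'} {g : C →ₗ[k] D}
    {g' : C' →ₗ[k] D'} (h : d ∘ₗ f = TensorProduct.map f g ∘ₗ δ)
    (h' : d' ∘ₗ f' = TensorProduct.map f' g' ∘ₗ δ') :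
    outer d d' ∘ₗ TensorProduct.map f f' =
      TensorProduct.map (TensorProduct.map f f') (TensorProduct.map g g') ∘ₗ outer δ δ' := by
  rw [outer, outer, LinearMap.comp_assoc, ← TensorProduct.map_comp, h, h', TensorProduct.map_comp,
    ← LinearMap.comp_assoc, ← LinearMap.comp_assoc,
    TensorProduct.tensorTensorTensorComm_comp_map]

theorem outer_comp_assoc (δ : M →ₗ[k] M ⊗[k] C) (δ' : M' →ₗ[k] M' ⊗[k] C')
    (δ'' : M'' →ₗ[k] M'' ⊗[k] C'') :
    outer δ (outer δ' δ'') ∘ₗ (TensorProduct.assoc k M M' M'').toLinearMap =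
      TensorProduct.map (TensorProduct.assoc k M M' M'').toLinearMap
        (TensorProduct.assoc k C C' C'').toLinearMap ∘ₗ outer (outer δ δ') δ'' := by
  apply TensorProduct.ext_threefold
  intro x y z
  simp only [LinearMap.comp_apply, LinearEquiv.coe_coe, TensorProduct.assoc_tmul, outer_tmul]
  generalize δ x = r
  generalize δ' y = s
  generalize δ'' z = t
  induction r with
  | zero => simp
  | add x y hx hy => simp only [TensorProduct.add_tmul, map_add, hx, hy]
  | tmul u a =>
    induction s with
    | zero => simp
    | add x y hx hy => simp only [TensorProduct.tmul_add, TensorProduct.add_tmul, map_add, hx, hy]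
    | tmul v b =>
      induction t with
      | zero => simp
      | add x y hx hy => simp only [TensorProduct.tmul_add, map_add, hx, hy]
      | tmul w c => rfl

end OuterNaturality

/-! ### Pulled-back forms acting on a comodule algebra -/

section ComoduleAlgebra

variable {k : Type*} [CommRing k] {Z : Type*} [Ring Z] [Algebra k Z]
  {R : Type*} [Ring R] [Bialgebra k R] {Δ : R →ₗ[k] R ⊗[k] R} {b : Z →ₐ[k] Z ⊗[k] R}

theorem mulMap_id : mulMap (LinearMap.id : Z →ₗ[k] Z) LinearMap.id = LinearMap.mul' k Z := by
  ext; simp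

theorem comp_mul'_eq (b : Z →ₐ[k] Z ⊗[k] R) : b.toLinearMap ∘ₗ LinearMap.mul' k Z =
    TensorProduct.map (LinearMap.mul' k Z) (LinearMap.mul' k R) ∘ₗ
      outer b.toLinearMap b.toLinearMap := by
  have h := mulMap_outer b (m := LinearMap.id) (m' := LinearMap.id) (δ := b.toLinearMap)
    (δ' := b.toLinearMap) (g := LinearMap.id) (g' := LinearMap.id) (by simp) (by simp)
  rwa [mulMap_id, mulMap_id] at h

/-- The product of a comodule algebra covers the product of `R`, so a form composed with the product
of `R` acts on `x ⊗ y` as the form itself acts on `xy`. -/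
theorem act_comp_mul' (μ : WithConv (R →ₗ[k] k)) :
    LinearMap.mul' k Z ∘ₗ act (outer b.toLinearMap b.toLinearMap)
      (convPull (Bialgebra.mulCoalgHom k R) μ) = act b.toLinearMap μ ∘ₗ LinearMap.mul' k Z :=
  (act_comp_of_comp (LinearMap.mul' k Z) (Bialgebra.mulCoalgHom k R) (comp_mul'_eq b) μ).symm

theorem act_comp_inl (τ : WithConv (R ⊗[k] R →ₗ[k] k)) :
    act (outer b.toLinearMap b.toLinearMap) τ ∘ₗ (TensorProduct.mk k Z Z).flip 1 =
      (TensorProduct.mk k Z Z).flip 1 ∘ₗ act b.toLinearMap (convPull (inlHom k R) τ) := by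
  refine act_comp_of_comp _ (inlHom k R) ?_ τ
  ext x
  simp only [LinearMap.comp_apply, LinearMap.flip_apply, TensorProduct.mk_apply, outer_tmul,
    AlgHom.toLinearMap_apply, map_one, Algebra.TensorProduct.one_def]
  generalize b x = s
  induction s with
  | zero => simp
  | add x y hx hy => simp only [TensorProduct.add_tmul, map_add, hx, hy]
  | tmul v a => rfl

theorem act_comp_inr (τ : WithConv (R ⊗[k] R →ₗ[k] k)) :
    act (outer b.toLinearMap b.toLinearMap) τ ∘ₗ TensorProduct.mk k Z Z 1 =
      TensorProduct.mk k Z Z 1 ∘ₗ act b.toLinearMap (convPull (inrHom k R) τ) := by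
  refine act_comp_of_comp _ (inrHom k R) ?_ τ
  ext x
  simp only [LinearMap.comp_apply, TensorProduct.mk_apply, outer_tmul,
    AlgHom.toLinearMap_apply, map_one, Algebra.TensorProduct.one_def]
  generalize b x = s
  induction s with
  | zero => simp
  | add x y hx hy => simp only [TensorProduct.tmul_add, map_add, hx, hy]
  | tmul v a => rfl

theorem act_apply_one (μ : WithConv (R →ₗ[k] k)) :
    act b.toLinearMap μ 1 = algebraMap k Z (μ (1 : R)) := by
  simp only [act, LinearMap.comp_apply, AlgHom.toLinearMap_apply, map_one,
    Algebra.TensorProduct.one_def, LinearMap.lTensor_tmul, LinearEquiv.coe_coe,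
    TensorProduct.rid_tmul, Algebra.algebraMap_eq_smul_one]

/-- Expresses the action of `σ(-, 1)` through the deformed product, so equality of deformed products
passes to the normalization conditions. -/
theorem mul'_comp_act_inl (τ : WithConv (R ⊗[k] R →ₗ[k] k)) :
    act b.toLinearMap (convPull (inlHom k R) τ) = (LinearMap.mul' k Z ∘ₗ
      act (outer b.toLinearMap b.toLinearMap) τ) ∘ₗ (TensorProduct.mk k Z Z).flip 1 := by
  rw [LinearMap.comp_assoc, act_comp_inl]
  ext x; simp

theorem mul'_comp_act_inr (τ : WithConv (R ⊗[k] R →ₗ[k] k)) :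
    act b.toLinearMap (convPull (inrHom k R) τ) = (LinearMap.mul' k Z ∘ₗ
      act (outer b.toLinearMap b.toLinearMap) τ) ∘ₗ TensorProduct.mk k Z Z 1 := by
  rw [LinearMap.comp_assoc, act_comp_inr]
  ext x; simp

theorem mulMap_mul'_id : mulMap (LinearMap.mul' k Z) LinearMap.id =
    LinearMap.mul' k Z ∘ₗ (LinearMap.mul' k Z).rTensor Z := by
  ext; simp

/-- Writing `x · y` for the product deformed by `σ`, the four faces turn the triple product into `(x
· y) z`, `(xy) · z`, `x (y · z)` and `x · (yz)`. Hence forms defining the same deformed product have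
faces acting identically on triple products. -/
theorem act_face12 (hb : IsCoaction Δ counit b.toLinearMap) (σ : Conv2 k R) :
    mulMap (LinearMap.mul' k Z) LinearMap.id ∘ₗ
      act (outer (outer b.toLinearMap b.toLinearMap) b.toLinearMap) (face12 σ).val =
    LinearMap.mul' k Z ∘ₗ (LinearMap.mul' k Z ∘ₗ
      act (outer b.toLinearMap b.toLinearMap) σ.val).rTensor Z := by
  change mulMap (LinearMap.mul' k Z) LinearMap.id ∘ₗ
    act (outer (outer b.toLinearMap b.toLinearMap) b.toLinearMap)
      (convPull (fstHom k (R ⊗[k] R) R) σ.val) = _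
  rw [act_outer_fst hb, mulMap_mul'_id, LinearMap.comp_assoc, LinearMap.rTensor_comp]

theorem act_faceMulLeft (σ : Conv2 k R) :
    mulMap (LinearMap.mul' k Z) LinearMap.id ∘ₗ
      act (outer (outer b.toLinearMap b.toLinearMap) b.toLinearMap) (faceMulLeft σ).val =
    (LinearMap.mul' k Z ∘ₗ act (outer b.toLinearMap b.toLinearMap) σ.val) ∘ₗ
      (LinearMap.mul' k Z).rTensor Z := by
  rw [LinearMap.comp_assoc, act_comp_of_comp ((LinearMap.mul' k Z).rTensor Z)
    (Coalgebra.TensorProduct.map (Bialgebra.mulCoalgHom k R) (CoalgHom.id k R)) ?_,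
    ← LinearMap.comp_assoc, ← mulMap_mul'_id]
  · rfl
  · exact outer_comp_map (comp_mul'_eq b) (by simp)

theorem mulMap_mul'_id' : mulMap (LinearMap.mul' k Z) LinearMap.id =
    LinearMap.mul' k Z ∘ₗ (LinearMap.mul' k Z).lTensor Z ∘ₗ
      (TensorProduct.assoc k Z Z Z).toLinearMap := by
  ext; simp [mul_assoc]

theorem act_face23 (hb : IsCoaction Δ counit b.toLinearMap) (σ : Conv2 k R) :
    mulMap (LinearMap.mul' k Z) LinearMap.id ∘ₗ
      act (outer (outer b.toLinearMap b.toLinearMap) b.toLinearMap) (face23 σ).val =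
    LinearMap.mul' k Z ∘ₗ (LinearMap.mul' k Z ∘ₗ
      act (outer b.toLinearMap b.toLinearMap) σ.val).lTensor Z ∘ₗ
        (TensorProduct.assoc k Z Z Z).toLinearMap := by
  have h := act_comp_of_comp _ (Coalgebra.TensorProduct.assoc k k R R R :
    (R ⊗[k] R) ⊗[k] R →ₗc[k] R ⊗[k] (R ⊗[k] R))
    (outer_comp_assoc b.toLinearMap b.toLinearMap b.toLinearMap)
    (convPull (sndHom k R (R ⊗[k] R)) σ.val)
  rw [act_outer_snd hb] at h
  rw [mulMap_mul'_id', LinearMap.lTensor_comp, LinearMap.comp_assoc, LinearMap.comp_assoc,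
    LinearMap.comp_assoc, h]
  rfl

theorem act_faceMulRight (σ : Conv2 k R) :
    mulMap (LinearMap.mul' k Z) LinearMap.id ∘ₗ
      act (outer (outer b.toLinearMap b.toLinearMap) b.toLinearMap) (faceMulRight σ).val =
    (LinearMap.mul' k Z ∘ₗ act (outer b.toLinearMap b.toLinearMap) σ.val) ∘ₗ
      (LinearMap.mul' k Z).lTensor Z ∘ₗ (TensorProduct.assoc k Z Z Z).toLinearMap := by
  have h1 : act (outer b.toLinearMap b.toLinearMap) σ.val ∘ₗ (LinearMap.mul' k Z).lTensor Z =
      (LinearMap.mul' k Z).lTensor Z ∘ₗ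
        act (outer b.toLinearMap (outer b.toLinearMap b.toLinearMap))
        (convPull (Coalgebra.TensorProduct.map (CoalgHom.id k R)
          (Bialgebra.mulCoalgHom k R)) σ.val) := by
    refine act_comp_of_comp ((LinearMap.mul' k Z).lTensor Z)
      (Coalgebra.TensorProduct.map (CoalgHom.id k R) (Bialgebra.mulCoalgHom k R)) ?_ σ.val
    exact outer_comp_map (by simp) (comp_mul'_eq b)
  have h2 := act_comp_of_comp _ (Coalgebra.TensorProduct.assoc k k R R R :
    (R ⊗[k] R) ⊗[k] R →ₗc[k] R ⊗[k] (R ⊗[k] R))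
    (outer_comp_assoc b.toLinearMap b.toLinearMap b.toLinearMap)
    (convPull (Coalgebra.TensorProduct.map (CoalgHom.id k R) (Bialgebra.mulCoalgHom k R)) σ.val)
  rw [LinearMap.comp_assoc, ← LinearMap.comp_assoc _ _ (act _ _), h1, LinearMap.comp_assoc, h2,
    mulMap_mul'_id']
  rfl

end ComoduleAlgebra

/-! ### Invariance under faithfully flat biGalois objects -/

section BiGaloisTheorem

variable {k : Type*} [CommRing k] {Z : Type*} [Ring Z] [Algebra k Z]
  {A : Type*} [Ring A] [Bialgebra k A] {B : Type*} [Ring B] [Bialgebra k B]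
  {β : Z →ₐ[k] A ⊗[k] Z} {ρ : Z →ₐ[k] Z ⊗[k] B}

/-- The one consequence of faithful flatness that is needed; it is applied with `N` equal to `k`,
`A` and `B`. -/
theorem tmul_one_injective [Module.FaithfullyFlat k Z] (N : Type*) [AddCommGroup N] [Module k N] :
    Function.Injective (TensorProduct.mk k Z N 1) := by
  rw [injective_iff_map_eq_zero]
  intro n hn
  simpa using hn

/-- The relation `σ · m = m · τ` between forms on `A ⊗ A` and on `B ⊗ B`, for the product `m`
of `Z`. -/
abbrev IsIntertwined2 (β : Z →ₐ[k] A ⊗[k] Z) (ρ : Z →ₐ[k] Z ⊗[k] B)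
    (σ : WithConv (A ⊗[k] A →ₗ[k] k)) (τ : WithConv (B ⊗[k] B →ₗ[k] k)) : Prop :=
  IsIntertwined (LinearMap.mul' k Z)
    (outer (opCoaction β).toLinearMap (opCoaction β).toLinearMap)
    (outer ρ.toLinearMap ρ.toLinearMap) σ τ

/-- The relation `σ · id = id · τ` between forms on `A` and on `B`, for the identity of `Z`. -/
abbrev IsIntertwined1 (β : Z →ₐ[k] A ⊗[k] Z) (ρ : Z →ₐ[k] Z ⊗[k] B)
    (μ : WithConv (A →ₗ[k] k)) (ν : WithConv (B →ₗ[k] k)) : Prop :=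
  IsIntertwined (LinearMap.id : Z →ₗ[k] Z) (opCoaction β).toLinearMap ρ.toLinearMap μ ν

theorem IsBiGalois.isGaloisLevel_mul' (h : IsBiGalois β ρ) :
    IsGaloisLevel (opCoaction β) ρ (LinearMap.mul' k Z)
      (outer (opCoaction β).toLinearMap (opCoaction β).toLinearMap)
      (outer ρ.toLinearMap ρ.toLinearMap) (LinearMap.mul' k A) (LinearMap.mul' k B) := by
  have := h.isGaloisLevel.mul h.isGaloisLevel
  rwa [mulMap_id, mulMap_id, mulMap_id] at this

/-- At the level `(Z ⊗ Z) ⊗ Z` the faces of `σ` and `τ` are intertwined one by one, hence so are the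
two sides of the cocycle identity. As intertwined forms determine each other, the sides coincide for
`σ` exactly when they do for `τ`. -/
theorem IsIntertwined2.isLeftCocycle_iff [Module.FaithfullyFlat k Z] (h : IsBiGalois β ρ)
    {σ : Conv2 k A} {τ : Conv2 k B} (hR : IsIntertwined2 β ρ σ.val τ.val) : IsLeftCocycle σ ↔ IsLeftCocycle τ := by
  have h3 := h.isGaloisLevel_mul'.mul h.isGaloisLevel
  have c1 := h.left.isCoaction
  have c2 := h.right.isCoaction
  have e : LinearMap.mul' k Z ∘ₗ
      act (outer (opCoaction β).toLinearMap (opCoaction β).toLinearMap) σ.val =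
      LinearMap.mul' k Z ∘ₗ act (outer ρ.toLinearMap ρ.toLinearMap) τ.val := hR
  have f12 : IsIntertwined _ _ _ (face12 σ).val (face12 τ).val :=
    (act_face12 c1 σ).trans ((by rw [e] : _ = _).trans (act_face12 c2 τ).symm)
  have fl : IsIntertwined _ _ _ (faceMulLeft σ).val (faceMulLeft τ).val :=
    (act_faceMulLeft σ).trans ((by rw [e] : _ = _).trans (act_faceMulLeft τ).symm)
  have f23 : IsIntertwined _ _ _ (face23 σ).val (face23 τ).val :=
    (act_face23 c1 σ).trans ((by rw [e] : _ = _).trans (act_face23 c2 τ).symm)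
  have fr : IsIntertwined _ _ _ (faceMulRight σ).val (faceMulRight τ).val :=
    (act_faceMulRight σ).trans ((by rw [e] : _ = _).trans (act_faceMulRight τ).symm)
  have l := h3.intertwined_mul f12 fl
  have r := h3.intertwined_mul f23 fr
  have hk := tmul_one_injective (k := k) (Z := Z) k
  constructor
  · intro hσ
    have hσ' : (face12 σ).val * (faceMulLeft σ).val = (face23 σ).val * (faceMulRight σ).val :=
      congrArg Units.val hσ
    rw [hσ'] at l
    exact Units.ext (h3.unique_right hk l r)
  · intro hτ
    have hτ' : (face12 τ).val * (faceMulLeft τ).val = (face23 τ).val * (faceMulRight τ).val :=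
      congrArg Units.val hτ
    rw [hτ'] at l
    exact Units.ext (h3.unique_left hk l r)

/-- The restrictions to `- ⊗ 1` and to `1 ⊗ -` are intertwined on `Z`, and the counits are
intertwined with each other, so by uniqueness one restriction is the counit exactly when the other
is. -/
theorem IsIntertwined2.mem_reg2_iff [Module.FaithfullyFlat k Z] (h : IsBiGalois β ρ) {σ : Conv2 k A}
    {τ : Conv2 k B} (hR : IsIntertwined2 β ρ σ.val τ.val) : σ ∈ Reg2 k A ↔ τ ∈ Reg2 k B := by
  have h1 := h.isGaloisLevel
  have e : LinearMap.mul' k Z ∘ₗ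
      act (outer (opCoaction β).toLinearMap (opCoaction β).toLinearMap) σ.val =
      LinearMap.mul' k Z ∘ₗ act (outer ρ.toLinearMap ρ.toLinearMap) τ.val := hR
  have l : IsIntertwined1 β ρ (convPull (inlHom k A) σ.val) (convPull (inlHom k B) τ.val) := by
    change LinearMap.id ∘ₗ act _ _ = LinearMap.id ∘ₗ act _ _
    rw [mul'_comp_act_inl, mul'_comp_act_inl, e]
  have r : IsIntertwined1 β ρ (convPull (inrHom k A) σ.val) (convPull (inrHom k B) τ.val) := by
    change LinearMap.id ∘ₗ act _ _ = LinearMap.id ∘ₗ act _ _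
    rw [mul'_comp_act_inr, mul'_comp_act_inr, e]
  have hk := tmul_one_injective (k := k) (Z := Z) k
  have one := h1.intertwined_one
  have iff : ∀ {μ : WithConv (A →ₗ[k] k)} {ν : WithConv (B →ₗ[k] k)},
      IsIntertwined1 β ρ μ ν → (μ = 1 ↔ ν = 1) := by
    intro μ ν hμν
    constructor
    · rintro rfl
      exact h1.unique_right hk hμν one
    · rintro rfl
      exact h1.unique_left hk hμν one
  have h2 := LazyCohomology.mem_reg2_iff k A σ
  have h3 := LazyCohomology.mem_reg2_iff k B τ
  rw [Units.ext_iff, Units.ext_iff] at h2 h3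
  exact h2.trans ((and_congr (iff l) (iff r)).trans h3.symm)

theorem IsIntertwined1.mem_reg1_iff (h : IsBiGalois β ρ) {μ : Conv1 k A} {ν : Conv1 k B}
    (hR : IsIntertwined1 β ρ μ.val ν.val) : μ ∈ Reg1 k A ↔ ν ∈ Reg1 k B := by
  have e : μ.val (1 : A) = ν.val (1 : B) := by
    -- Both actions send `1 ∈ Z` to a scalar multiple of `1`, with coefficients `μ(1)` and `ν(1)`.
    apply h.left.injective_algebraMap
    rw [← act_apply_one (b := opCoaction β), ← act_apply_one (b := ρ)]
    exact LinearMap.congr_fun hR 1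
  change μ.val (1 : A) = 1 ↔ ν.val (1 : B) = 1
  rw [e]

theorem IsIntertwined1.coboundary (h : IsBiGalois β ρ) {μ : Conv1 k A} {ν : Conv1 k B}
    (hR : IsIntertwined1 β ρ μ.val ν.val) (hR' : IsIntertwined1 β ρ μ⁻¹.val ν⁻¹.val) :
    IsIntertwined2 β ρ (coboundary μ).val (coboundary ν).val := by
  have e : act (opCoaction β).toLinearMap μ.val = act ρ.toLinearMap ν.val := hR
  have e' : act (opCoaction β).toLinearMap μ⁻¹.val = act ρ.toLinearMap ν⁻¹.val := hR'
  refine h.isGaloisLevel_mul'.intertwined_mul (h.isGaloisLevel_mul'.intertwined_mul ?_ ?_) ?_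
  · change LinearMap.mul' k Z ∘ₗ act _ (convPull (fstHom k A A) μ.val) =
      LinearMap.mul' k Z ∘ₗ act _ (convPull (fstHom k B B) ν.val)
    rw [act_outer_fst h.left.isCoaction, act_outer_fst h.right.isCoaction, e]
  · change LinearMap.mul' k Z ∘ₗ act _ (convPull (sndHom k A A) μ.val) =
      LinearMap.mul' k Z ∘ₗ act _ (convPull (sndHom k B B) ν.val)
    rw [act_outer_snd h.left.isCoaction, act_outer_snd h.right.isCoaction, e]
  · change LinearMap.mul' k Z ∘ₗ act _ (convPull (Bialgebra.mulCoalgHom k A) μ⁻¹.val) =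
      LinearMap.mul' k Z ∘ₗ act _ (convPull (Bialgebra.mulCoalgHom k B) ν⁻¹.val)
    rw [act_comp_mul', act_comp_mul', e']

/-- A faithfully flat biGalois object induces an isomorphism of second lazy cohomology groups. -/
theorem IsBiGalois.nonempty_HL2_mulEquiv [Module.FaithfullyFlat k Z] (h : IsBiGalois β ρ) :
    Nonempty (HL2 k A ≃* HL2 k B) := by
  have h1 := h.isGaloisLevel
  have h2 := h.isGaloisLevel_mul'
  have hk := tmul_one_injective (k := k) (Z := Z) k
  have hA := tmul_one_injective (k := k) (Z := Z) A
  have hB := tmul_one_injective (k := k) (Z := Z) B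
  refine nonempty_HL2_mulEquiv_of_rel (fun σ τ => IsIntertwined2 β ρ σ.val τ.val)
    (fun {_ _ _ _} h3 h4 => h2.intertwined_mul h3 h4)
    (fun {_ _ _} h3 h4 => Units.ext (h2.unique_right hk h3 h4))
    (fun {_ _ _} h3 h4 => Units.ext (h2.unique_left hk h3 h4)) ?_ ?_ ?_ ?_
  · intro σ hσ
    obtain ⟨τ, hR, hτ⟩ := h2.exists_right h hB hσ.1.2
    -- The construction gives only a linear form `τ`. As `σ⁻¹` is lazy too, it has a partner, and
    -- multiplicativity with uniqueness shows that this partner is the convolution inverse of `τ`.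
    -- The other three cases proceed likewise.
    obtain ⟨τ', hR', -⟩ := h2.exists_right h hB (inv_mem hσ).1.2
    obtain ⟨φ, rfl, rfl⟩ := exists_unit_of_rel (R := IsIntertwined2 β ρ) h2.intertwined_one
      (fun {_ _ _ _} h3 h4 => h2.intertwined_mul h3 h4) (fun {_ _ _} => h2.unique_right hk) hR hR'
    exact ⟨φ, ⟨⟨(IsIntertwined2.mem_reg2_iff h hR).1 hσ.1.1, hτ⟩,
      (IsIntertwined2.isLeftCocycle_iff h hR).1 hσ.2⟩, hR⟩
  · intro τ hτ
    obtain ⟨σ, hR, hσ⟩ := h2.exists_left h hA hτ.1.2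
    obtain ⟨σ', hR', -⟩ := h2.exists_left h hA (inv_mem hτ).1.2
    obtain ⟨φ, rfl, rfl⟩ := exists_unit_of_rel (R := fun τ σ => IsIntertwined2 β ρ σ τ)
      h2.intertwined_one (fun {_ _ _ _} h3 h4 => h2.intertwined_mul h3 h4)
      (fun {_ _ _} => h2.unique_left hk) hR hR'
    exact ⟨φ, ⟨⟨(IsIntertwined2.mem_reg2_iff h hR).2 hτ.1.1, hσ⟩,
      (IsIntertwined2.isLeftCocycle_iff h hR).2 hτ.2⟩, hR⟩
  · intro μ hμ
    obtain ⟨ν, hR, hν⟩ := h1.exists_right h hB hμ.2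
    obtain ⟨ν', hR', -⟩ := h1.exists_right h hB (inv_mem hμ).2
    obtain ⟨φ, rfl, rfl⟩ := exists_unit_of_rel (R := IsIntertwined1 β ρ) h1.intertwined_one
      (fun {_ _ _ _} h3 h4 => h1.intertwined_mul h3 h4) (fun {_ _ _} => h1.unique_right hk) hR hR'
    exact ⟨φ, ⟨(IsIntertwined1.mem_reg1_iff h hR).1 hμ.1, hν⟩,
      IsIntertwined1.coboundary h hR hR'⟩
  · intro ν hν
    obtain ⟨μ, hR, hμ⟩ := h1.exists_left h hA hν.2
    obtain ⟨μ', hR', -⟩ := h1.exists_left h hA (inv_mem hν).2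
    obtain ⟨φ, rfl, rfl⟩ := exists_unit_of_rel (R := fun ν μ => IsIntertwined1 β ρ μ ν)
      h1.intertwined_one (fun {_ _ _ _} h3 h4 => h1.intertwined_mul h3 h4)
      (fun {_ _ _} => h1.unique_left hk) hR hR'
    exact ⟨φ, ⟨(IsIntertwined1.mem_reg1_iff h hR).2 hν.1, hμ⟩,
      IsIntertwined1.coboundary h hR hR'⟩

end BiGaloisTheorem

/-! ### Cocycle twists -/

section Twist

variable {k : Type*} [CommRing k]

section Central

variable {C : Type*} [AddCommGroup C] [Module k C] [Coalgebra k C]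
  {D : Type*} [AddCommGroup D] [Module k D] [Coalgebra k D]
  {N : Type*} [AddCommGroup N] [Module k N] {N' : Type*} [AddCommGroup N'] [Module k N']

/-- With its companion for injective maps of values, this transports laziness along a coalgebra
isomorphism even when that map is not multiplicative. -/
theorem isCentralFor_comp_iff (h : C →ₗc[k] D) (hh : Function.Surjective h) {g : D →ₗ[k] N}
    {τ : WithConv (D →ₗ[k] k)} :
    IsCentralFor comul (g ∘ₗ h.toLinearMap) (convPull h τ) ↔ IsCentralFor comul g τ := by
  have e1 : (TensorProduct.rid k N).toLinearMap ∘ₗ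
      TensorProduct.map (g ∘ₗ h.toLinearMap) (convPull h τ).ofConv ∘ₗ comul =
      ((TensorProduct.rid k N).toLinearMap ∘ₗ TensorProduct.map g τ.ofConv ∘ₗ comul) ∘ₗ
        h.toLinearMap := by
    change _ ∘ₗ TensorProduct.map (g ∘ₗ h.toLinearMap) (τ.ofConv ∘ₗ h.toLinearMap) ∘ₗ _ = _
    rw [TensorProduct.map_comp, LinearMap.comp_assoc, LinearMap.comp_assoc, LinearMap.comp_assoc,
      ← h.map_comp_comul]
  have e2 : (TensorProduct.lid k N).toLinearMap ∘ₗ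
      TensorProduct.map (convPull h τ).ofConv (g ∘ₗ h.toLinearMap) ∘ₗ comul =
      ((TensorProduct.lid k N).toLinearMap ∘ₗ TensorProduct.map τ.ofConv g ∘ₗ comul) ∘ₗ
        h.toLinearMap := by
    change _ ∘ₗ TensorProduct.map (τ.ofConv ∘ₗ h.toLinearMap) (g ∘ₗ h.toLinearMap) ∘ₗ _ = _
    rw [TensorProduct.map_comp, LinearMap.comp_assoc, LinearMap.comp_assoc, LinearMap.comp_assoc,
      ← h.map_comp_comul]
  rw [IsCentralFor, e1, e2, LinearMap.cancel_right hh]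
  rfl

theorem isCentralFor_injective_comp_iff (e : N →ₗ[k] N') (he : Function.Injective e)
    {g : C →ₗ[k] N} {τ : WithConv (C →ₗ[k] k)} :
    IsCentralFor comul (e ∘ₗ g) τ ↔ IsCentralFor comul g τ := by
  have e1 : (TensorProduct.rid k N').toLinearMap ∘ₗ TensorProduct.map (e ∘ₗ g) τ.ofConv =
      e ∘ₗ (TensorProduct.rid k N).toLinearMap ∘ₗ TensorProduct.map g τ.ofConv := by
    ext; simp
  have e2 : (TensorProduct.lid k N').toLinearMap ∘ₗ TensorProduct.map τ.ofConv (e ∘ₗ g) =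
      e ∘ₗ (TensorProduct.lid k N).toLinearMap ∘ₗ TensorProduct.map τ.ofConv g := by
    ext; simp
  rw [IsCentralFor, ← LinearMap.comp_assoc, e1, ← LinearMap.comp_assoc comul, e2]
  simp only [LinearMap.comp_assoc]
  exact LinearMap.cancel_left he

variable {A : Type*} [Ring A] [Bialgebra k A]

/-- Multiplying by `ω ⊗ ε` affects only the first argument, where it replaces `g` by `ω * g`.
Together with the three variants below, it turns the twisted product `ω * m * ω⁻¹` inside an
argument into conjugation by a face of `ω`. -/
theorem fst_mul_comp_map (ω : WithConv (C →ₗ[k] k)) (g : WithConv (C →ₗ[k] A))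
    (f : A ⊗[k] D →ₗ[k] k) : convPull (fstHom k C D) ω *
      WithConv.toConv (f ∘ₗ g.ofConv.rTensor D) =
      WithConv.toConv (f ∘ₗ (convScalar A ω * g).ofConv.rTensor D) := by
  apply WithConv.ext
  ext x d
  change (convPull (fstHom k C D) ω * WithConv.toConv (f ∘ₗ g.ofConv.rTensor D)) (x ⊗ₜ d) =
    f ((convScalar A ω * g) x ⊗ₜ d)
  have hd := Coalgebra.sum_counit_smul (ℛ k d)
  rw [convMul_tmul, (ℛ k x).convMul_apply, TensorProduct.sum_tmul, map_sum]
  refine Finset.sum_congr rfl fun i _ => ?_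
  conv_rhs => rw [← hd]
  simp [convPull_apply, convScalar_apply, fstHom_tmul, TensorProduct.tmul_sum,
    ← Algebra.smul_def, ← TensorProduct.smul_tmul']
  refine Finset.sum_congr rfl fun j _ => ?_
  ring

theorem comp_map_mul_fst (ω : WithConv (C →ₗ[k] k)) (g : WithConv (C →ₗ[k] A))
    (f : A ⊗[k] D →ₗ[k] k) : WithConv.toConv (f ∘ₗ g.ofConv.rTensor D) *
      convPull (fstHom k C D) ω =
      WithConv.toConv (f ∘ₗ (g * convScalar A ω).ofConv.rTensor D) := by
  apply WithConv.ext
  ext x d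
  change (WithConv.toConv (f ∘ₗ g.ofConv.rTensor D) * convPull (fstHom k C D) ω) (x ⊗ₜ d) =
    f ((g * convScalar A ω) x ⊗ₜ d)
  have hd := sum_smul_counit (k := k) d
  rw [convMul_tmul, (ℛ k x).convMul_apply, TensorProduct.sum_tmul, map_sum]
  refine Finset.sum_congr rfl fun i _ => ?_
  conv_rhs => rw [← hd]
  simp [convPull_apply, convScalar_apply, fstHom_tmul, TensorProduct.tmul_sum,
    ← Algebra.commutes, ← Algebra.smul_def, ← TensorProduct.smul_tmul']
  refine Finset.sum_congr rfl fun j _ => ?_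
  ring

theorem snd_mul_comp_map (ω : WithConv (C →ₗ[k] k)) (g : WithConv (C →ₗ[k] A))
    (f : D ⊗[k] A →ₗ[k] k) : convPull (sndHom k D C) ω *
      WithConv.toConv (f ∘ₗ g.ofConv.lTensor D) =
      WithConv.toConv (f ∘ₗ (convScalar A ω * g).ofConv.lTensor D) := by
  apply WithConv.ext
  ext d x
  change (convPull (sndHom k D C) ω * WithConv.toConv (f ∘ₗ g.ofConv.lTensor D)) (d ⊗ₜ x) =
    f (d ⊗ₜ (convScalar A ω * g) x)
  have hd := Coalgebra.sum_counit_smul (ℛ k d)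
  rw [convMul_tmul, (ℛ k x).convMul_apply, TensorProduct.tmul_sum, map_sum, Finset.sum_comm]
  refine Finset.sum_congr rfl fun i _ => ?_
  conv_rhs => rw [← hd]
  simp [convPull_apply, convScalar_apply, sndHom_tmul, TensorProduct.sum_tmul,
    ← Algebra.smul_def, ← TensorProduct.smul_tmul', Finset.mul_sum]
  refine Finset.sum_congr rfl fun j _ => ?_
  ring

theorem comp_map_mul_snd (ω : WithConv (C →ₗ[k] k)) (g : WithConv (C →ₗ[k] A))
    (f : D ⊗[k] A →ₗ[k] k) : WithConv.toConv (f ∘ₗ g.ofConv.lTensor D) *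
      convPull (sndHom k D C) ω =
      WithConv.toConv (f ∘ₗ (g * convScalar A ω).ofConv.lTensor D) := by
  apply WithConv.ext
  ext d x
  change (WithConv.toConv (f ∘ₗ g.ofConv.lTensor D) * convPull (sndHom k D C) ω) (d ⊗ₜ x) =
    f (d ⊗ₜ (g * convScalar A ω) x)
  have hd := sum_smul_counit (k := k) d
  rw [convMul_tmul, (ℛ k x).convMul_apply, TensorProduct.tmul_sum, map_sum, Finset.sum_comm]
  refine Finset.sum_congr rfl fun i _ => ?_
  conv_rhs => rw [← hd]
  simp [convPull_apply, convScalar_apply, sndHom_tmul, TensorProduct.sum_tmul,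
    ← Algebra.commutes, ← Algebra.smul_def, ← TensorProduct.smul_tmul', Finset.mul_sum]
  refine Finset.sum_congr rfl fun j _ => ?_
  ring

end Central

variable {A : Type*} [Ring A] [Bialgebra k A] {B : Type*} [Ring B] [Bialgebra k B]

/-- The product of the twist of `A` by `ω`. -/
def twistMul (ω : Conv2 k A) : WithConv (A ⊗[k] A →ₗ[k] A) :=
  convScalar A ω.val * WithConv.toConv (LinearMap.mul' k A) * convScalar A (ω⁻¹).val

/-- `e` is an isomorphism from the twist of `A` by `ω` to `B`. -/
structure IsTwistEquiv (ω : Conv2 k A) (e : A ≃ₗc[k] B) : Prop where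
  mem : ω ∈ Reg2 k A
  cocycle : IsLeftCocycle ω
  apply_one : e 1 = 1
  apply_mul : ∀ a b : A, e a * e b = e (twistMul ω (a ⊗ₜ[k] b))

/-- Pulling back forms on `B` along `e : A ≃ B`. -/
def pullConv1 (e : A ≃ₗc[k] B) : Conv1 k B →* Conv1 k A :=
  Units.map (convPull (e : A →ₗc[k] B))

/-- Pulling back forms on `B ⊗ B` along `e : A ≃ B`. -/
def pullConv2 (e : A ≃ₗc[k] B) : Conv2 k B →* Conv2 k A :=
  Units.map (convPull (Coalgebra.TensorProduct.map (e : A →ₗc[k] B) (e : A →ₗc[k] B)))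

/-- Pulling back forms on `B ⊗ B ⊗ B` along `e : A ≃ B`. -/
def pullConv3 (e : A ≃ₗc[k] B) : Conv3 k B →* Conv3 k A :=
  Units.map (convPull (Coalgebra.TensorProduct.map
    (Coalgebra.TensorProduct.map (e : A →ₗc[k] B) (e : A →ₗc[k] B)) (e : A →ₗc[k] B)))

theorem pullConv1_apply (e : A ≃ₗc[k] B) (ν : Conv1 k B) (a : A) :
    (pullConv1 e ν).val a = ν.val (e a) := rfl

theorem pullConv2_apply (e : A ≃ₗc[k] B) (τ : Conv2 k B) (a b : A) :
    (pullConv2 e τ).val (a ⊗ₜ b) = τ.val (e a ⊗ₜ e b) := rfl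

theorem pullConv3_apply (e : A ≃ₗc[k] B) (τ : Conv3 k B) (a b c : A) :
    (pullConv3 e τ).val ((a ⊗ₜ b) ⊗ₜ c) = τ.val ((e a ⊗ₜ e b) ⊗ₜ e c) := rfl

theorem Conv2.ext {σ τ : Conv2 k A} (h : ∀ a b : A, σ.val (a ⊗ₜ b) = τ.val (a ⊗ₜ b)) : σ = τ :=
  Units.ext (WithConv.ext (TensorProduct.ext' h))

theorem Conv3.ext {σ τ : Conv3 k A}
    (h : ∀ a b c : A, σ.val ((a ⊗ₜ b) ⊗ₜ c) = τ.val ((a ⊗ₜ b) ⊗ₜ c)) : σ = τ :=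
  Units.ext (WithConv.ext (TensorProduct.ext_threefold h))

theorem pullConv1_bijective (e : A ≃ₗc[k] B) :
    Function.Bijective (pullConv1 (k := k) e) :=
  Function.bijective_iff_has_inverse.2 ⟨pullConv1 e.symm,
    fun ν => Units.ext (WithConv.ext (LinearMap.ext fun b => by
      change ν.val (e (e.symm b)) = ν.val b
      rw [CoalgEquiv.apply_symm_apply])),
    fun ν => Units.ext (WithConv.ext (LinearMap.ext fun b => by
      change ν.val (e.symm (e b)) = ν.val b
      rw [CoalgEquiv.symm_apply_apply]))⟩

theorem pullConv2_bijective (e : A ≃ₗc[k] B) :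
    Function.Bijective (pullConv2 (k := k) e) :=
  Function.bijective_iff_has_inverse.2 ⟨pullConv2 e.symm,
    fun ν => Conv2.ext fun a b => by
      rw [pullConv2_apply, pullConv2_apply, CoalgEquiv.apply_symm_apply,
        CoalgEquiv.apply_symm_apply],
    fun ν => Conv2.ext fun a b => by
      rw [pullConv2_apply, pullConv2_apply, CoalgEquiv.symm_apply_apply,
        CoalgEquiv.symm_apply_apply]⟩

theorem pullConv3_injective (e : A ≃ₗc[k] B) : Function.Injective (pullConv3 (k := k) e) := by
  intro σ τ h
  refine Conv3.ext fun a b c => ?_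
  have h' := congrArg (fun φ : Conv3 k A => φ.val ((e.symm a ⊗ₜ e.symm b) ⊗ₜ e.symm c)) h
  simpa only [pullConv3_apply, CoalgEquiv.apply_symm_apply] using h'

theorem pullConv3_face12 (e : A ≃ₗc[k] B) (τ : Conv2 k B) :
    pullConv3 e (face12 τ) = face12 (pullConv2 e τ) :=
  Conv3.ext fun a b c => by
    rw [pullConv3_apply, face12_apply, face12_apply, pullConv2_apply,
      CoalgHomClass.counit_comp_apply]

theorem pullConv3_face23 (e : A ≃ₗc[k] B) (τ : Conv2 k B) :
    pullConv3 e (face23 τ) = face23 (pullConv2 e τ) :=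
  Conv3.ext fun a b c => by
    rw [pullConv3_apply, face23_apply, face23_apply, pullConv2_apply,
      CoalgHomClass.counit_comp_apply]

/-! ### Comparing lazy cohomology with that of a cocycle twist -/

namespace IsTwistEquiv

variable {ω : Conv2 k A} {e : A ≃ₗc[k] B}

theorem pullConv3_faceMulLeft (h : IsTwistEquiv ω e) (τ : Conv2 k B) :
    pullConv3 e (faceMulLeft τ) =
      face12 ω * faceMulLeft (pullConv2 e τ) * (face12 ω)⁻¹ := by
  have h1 := fst_mul_comp_map (D := A) ω.val (WithConv.toConv (LinearMap.mul' k A))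
    (pullConv2 e τ).val.ofConv
  have h2 := comp_map_mul_fst (D := A) (ω⁻¹).val (convScalar A ω.val *
    WithConv.toConv (LinearMap.mul' k A)) (pullConv2 e τ).val.ofConv
  rw [← h1] at h2
  refine Units.ext (Eq.trans ?_ h2.symm)
  apply WithConv.ext
  apply TensorProduct.ext_threefold
  intro a b c
  change τ.val ((e a * e b) ⊗ₜ e c) = τ.val (e (twistMul ω (a ⊗ₜ b)) ⊗ₜ e c)
  rw [h.apply_mul]

theorem pullConv3_faceMulRight (h : IsTwistEquiv ω e) (τ : Conv2 k B) :
    pullConv3 e (faceMulRight τ) =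
      face23 ω * faceMulRight (pullConv2 e τ) * (face23 ω)⁻¹ := by
  have h1 := snd_mul_comp_map (D := A) ω.val (WithConv.toConv (LinearMap.mul' k A))
    (pullConv2 e τ).val.ofConv
  have h2 := comp_map_mul_snd (D := A) (ω⁻¹).val (convScalar A ω.val *
    WithConv.toConv (LinearMap.mul' k A)) (pullConv2 e τ).val.ofConv
  rw [← h1] at h2
  have h3 := congrArg (convPull (Coalgebra.TensorProduct.assoc k k A A A :
    (A ⊗[k] A) ⊗[k] A →ₗc[k] A ⊗[k] (A ⊗[k] A))) h2
  rw [map_mul, map_mul] at h3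
  refine Units.ext (Eq.trans ?_ h3.symm)
  apply WithConv.ext
  apply TensorProduct.ext_threefold
  intro a b c
  change τ.val (e a ⊗ₜ (e b * e c)) = τ.val (e a ⊗ₜ e (twistMul ω (b ⊗ₜ c)))
  rw [h.apply_mul]

/-- After pullback to `A`, both sides of the identity for `τ` are those for `σ` conjugated by the
corresponding sides for `ω`. The latter agree, `ω` being a cocycle, so the conjugation cancels.
Laziness of `σ` is needed to move its faces past those of `ω`. -/
theorem isLeftCocycle_iff (h : IsTwistEquiv ω e) {σ : Conv2 k A} {τ : Conv2 k B}
    (hσ : IsLazy2 σ) (hR : pullConv2 e τ = ω * σ * ω⁻¹) :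
    IsLeftCocycle σ ↔ IsLeftCocycle τ := by
  have hω : face12 ω * faceMulLeft ω = face23 ω * faceMulRight ω := h.cocycle
  -- Used with `x`, `y` the two faces of `ω` and `s`, `t` those of `σ` on one side of the cocycle
  -- identity. The inner conjugation by `y` comes from `ω * σ * ω⁻¹`, the outer one by `x` from the
  -- twisted product.
  have key : ∀ {G : Type _} [Group G] (x y s t : G), Commute s y →
      (x * s * x⁻¹) * (x * (y * t * y⁻¹) * x⁻¹) = (x * y) * (s * t) * (x * y)⁻¹ := by
    intro G _ x y s t hc
    have : s * y = y * s := hc.eq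
    calc (x * s * x⁻¹) * (x * (y * t * y⁻¹) * x⁻¹) = x * (s * y) * t * y⁻¹ * x⁻¹ := by group
      _ = (x * y) * (s * t) * (x * y)⁻¹ := by rw [this]; group
  have l : pullConv3 e (face12 τ * faceMulLeft τ) = (face12 ω * faceMulLeft ω) *
      (face12 σ * faceMulLeft σ) * (face12 ω * faceMulLeft ω)⁻¹ := by
    rw [map_mul, pullConv3_face12, h.pullConv3_faceMulLeft, hR]
    simp only [map_mul, map_inv]
    exact key _ _ _ _ (hσ.commute_left ω)
  have r : pullConv3 e (face23 τ * faceMulRight τ) = (face23 ω * faceMulRight ω) *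
      (face23 σ * faceMulRight σ) * (face23 ω * faceMulRight ω)⁻¹ := by
    rw [map_mul, pullConv3_face23, h.pullConv3_faceMulRight, hR]
    simp only [map_mul, map_inv]
    exact key _ _ _ _ (hσ.commute_right ω)
  rw [← hω] at r
  rw [IsLeftCocycle, IsLeftCocycle, ← (pullConv3_injective e).eq_iff, l, r]
  simp

theorem mem_reg2_iff (h : IsTwistEquiv ω e) {σ : Conv2 k A} {τ : Conv2 k B}
    (hR : pullConv2 e τ = ω * σ * ω⁻¹) : σ ∈ Reg2 k A ↔ τ ∈ Reg2 k B := by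
  have h1 : σ ∈ Reg2 k A ↔ pullConv2 e τ ∈ Reg2 k A := by
    rw [hR, Subgroup.mul_mem_cancel_right _ (inv_mem h.mem), Subgroup.mul_mem_cancel_left _ h.mem]
  rw [h1]
  constructor
  · intro hτ b
    obtain ⟨a, rfl⟩ : ∃ a, e a = b := ⟨e.symm b, e.apply_symm_apply b⟩
    have ha := hτ a
    rw [← h.apply_one, CoalgHomClass.counit_comp_apply]
    exact ha
  · intro hτ a
    have ha := hτ (e a)
    rw [← h.apply_one, CoalgHomClass.counit_comp_apply] at ha
    exact ha

theorem _root_.LazyCohomology.commute_units_conj_iff {G : Type*} [Monoid G] (u : Gˣ) {x y : G} :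
    Commute (u.val * x * (u⁻¹).val) (u.val * y * (u⁻¹).val) ↔ Commute x y := by
  have e : ∀ x y : G, u.val * x * (u⁻¹).val * (u.val * y * (u⁻¹).val) =
      u.val * (x * y) * (u⁻¹).val := by
    intro x y
    simp [mul_assoc]
  rw [Commute, SemiconjBy, e, e, Units.mul_left_inj, Units.mul_right_inj]
  rfl

theorem isLazy2_iff (h : IsTwistEquiv ω e) {σ : Conv2 k A} {τ : Conv2 k B}
    (hR : pullConv2 e τ = ω * σ * ω⁻¹) : IsLazy2 σ ↔ IsLazy2 τ := by
  have hsurj : Function.Surjective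
      (Coalgebra.TensorProduct.map (e : A →ₗc[k] B) (e : A →ₗc[k] B)) :=
    TensorProduct.map_surjective e.surjective e.surjective
  have hmul : LinearMap.mul' k B ∘ₗ
      (Coalgebra.TensorProduct.map (e : A →ₗc[k] B) (e : A →ₗc[k] B)).toLinearMap =
      e.toCoalgHom.toLinearMap ∘ₗ (twistMul ω).ofConv := by
    ext a b
    exact h.apply_mul a b
  rw [IsLazy2, IsLazy2, ← isCentralFor_comul_iff (τ := τ.val), ← isCentralFor_comp_iff _ hsurj,
    hmul, isCentralFor_injective_comp_iff _ e.injective, isCentralFor_comul_iff]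
  have hs : convPull (Coalgebra.TensorProduct.map (e : A →ₗc[k] B) (e : A →ₗc[k] B)) τ.val =
      (ω * σ * ω⁻¹).val := congrArg Units.val hR
  let Ω : (WithConv (A ⊗[k] A →ₗ[k] A))ˣ := Units.map (convScalar A) ω
  have e1 : convScalar A (ω * σ * ω⁻¹).val = Ω.val * convScalar A σ.val * (Ω⁻¹).val := by
    simp only [Units.val_mul, map_mul]
    rfl
  have e2 : WithConv.toConv (twistMul ω).ofConv =
      Ω.val * WithConv.toConv (LinearMap.mul' k A) * (Ω⁻¹).val := rfl
  -- Both the form and the product have been conjugated by the same unit `Ω`, so commutation is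
  -- unchanged.
  rw [hs, e1, e2]
  exact (commute_units_conj_iff Ω).symm

/-- Laziness of a form on `A` involves only the coalgebra structure, and normalization only the
unit; `e` preserves both. -/
theorem mem_reg1L_iff (h : IsTwistEquiv ω e) {ν : Conv1 k B} :
    pullConv1 e ν ∈ Reg1L k A ↔ ν ∈ Reg1L k B := by
  have h1 : pullConv1 e ν ∈ Reg1 k A ↔ ν ∈ Reg1 k B := by
    change (pullConv1 e ν).val (1 : A) = 1 ↔ ν.val (1 : B) = 1
    rw [pullConv1_apply, h.apply_one]
  have h2 : IsLazy1 (pullConv1 e ν) ↔ IsLazy1 ν := by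
    rw [IsLazy1, IsLazy1, ← isCentralFor_comul_iff, ← isCentralFor_comul_iff,
      ← isCentralFor_comp_iff (e : A →ₗc[k] B) e.surjective,
      ← isCentralFor_injective_comp_iff e.toCoalgHom.toLinearMap e.injective]
    rfl
  exact and_congr h1 h2

/-- Only the factor `μ⁻¹(a₂ b₂)` sees the twisted product, and it is conjugated by `ω`. The other
two factors commute with `ω` because `μ` is lazy, so the whole coboundary is conjugated. -/
theorem pullConv2_coboundary (h : IsTwistEquiv ω e) {ν : Conv1 k B}
    (hμ : IsLazy1 (pullConv1 e ν)) :
    pullConv2 e (coboundary ν) = ω * coboundary (pullConv1 e ν) * ω⁻¹ := by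
  have e1 : pullConv2 e (Units.map (convPull (fstHom k B B)) ν) =
      Units.map (convPull (fstHom k A A)) (pullConv1 e ν) := by
    refine Conv2.ext fun a b => ?_
    change ν.val.ofConv (fstHom k B B (e a ⊗ₜ e b)) = ν.val.ofConv (e (fstHom k A A (a ⊗ₜ b)))
    rw [fstHom_tmul, fstHom_tmul, CoalgHomClass.counit_comp_apply]
    simp only [map_smul]
  have e2 : pullConv2 e (Units.map (convPull (sndHom k B B)) ν) =
      Units.map (convPull (sndHom k A A)) (pullConv1 e ν) := by
    refine Conv2.ext fun a b => ?_
    change ν.val.ofConv (sndHom k B B (e a ⊗ₜ e b)) = ν.val.ofConv (e (sndHom k A A (a ⊗ₜ b)))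
    rw [sndHom_tmul, sndHom_tmul, CoalgHomClass.counit_comp_apply]
    simp only [map_smul]
  have e3 : pullConv2 e (Units.map (convPull (Bialgebra.mulCoalgHom k B)) ν⁻¹) =
      ω * Units.map (convPull (Bialgebra.mulCoalgHom k A)) (pullConv1 e ν)⁻¹ * ω⁻¹ := by
    have h1 := comp_scalar_mul (pullConv1 e ν⁻¹).val.ofConv ω.val (LinearMap.mul' k A)
    have h2 := comp_mul_scalar (pullConv1 e ν⁻¹).val.ofConv (ω⁻¹).val
      (convScalar A ω.val * WithConv.toConv (LinearMap.mul' k A)).ofConv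
    rw [h1] at h2
    rw [← map_inv]
    refine Units.ext (WithConv.ext (Eq.trans ?_ h2))
    ext a b
    change ν⁻¹.val (e a * e b) = ν⁻¹.val (e (twistMul ω (a ⊗ₜ b)))
    rw [h.apply_mul]
  have c1 := (hμ.commute_fst ω).eq
  have c2 := (hμ.commute_snd ω).eq
  simp only [coboundary, map_mul, e1, e2]
  rw [e3]
  generalize Units.map (convPull (fstHom k A A)) (pullConv1 e ν) = x at c1 ⊢
  generalize Units.map (convPull (sndHom k A A)) (pullConv1 e ν) = y at c2 ⊢
  generalize Units.map (convPull (Bialgebra.mulCoalgHom k A)) (pullConv1 e ν)⁻¹ = t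
  calc x * y * (ω * t * ω⁻¹) = x * (y * ω) * t * ω⁻¹ := by group
    _ = (x * ω) * y * t * ω⁻¹ := by rw [c2]; group
    _ = ω * (x * y * t) * ω⁻¹ := by rw [c1]; group

theorem nonempty_HL2_mulEquiv (h : IsTwistEquiv ω e) : Nonempty (HL2 k A ≃* HL2 k B) := by
  have hmem : ∀ {σ : Conv2 k A} {τ : Conv2 k B}, pullConv2 e τ = ω * σ * ω⁻¹ →
      (σ ∈ ZL2 k A ↔ τ ∈ ZL2 k B) := by
    intro σ τ hR
    constructor
    · intro hσ
      exact ⟨⟨(h.mem_reg2_iff hR).1 hσ.1.1, (h.isLazy2_iff hR).1 hσ.1.2⟩,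
        (h.isLeftCocycle_iff hσ.1.2 hR).1 hσ.2⟩
    · intro hτ
      have hσ := (h.isLazy2_iff hR).2 hτ.1.2
      exact ⟨⟨(h.mem_reg2_iff hR).2 hτ.1.1, hσ⟩, (h.isLeftCocycle_iff hσ hR).2 hτ.2⟩
  refine nonempty_HL2_mulEquiv_of_rel (fun σ τ => pullConv2 e τ = ω * σ * ω⁻¹) ?_ ?_ ?_ ?_ ?_ ?_ ?_
  · intro σ σ' τ τ' h1 h2
    rw [map_mul, h1, h2]
    group
  · intro σ τ τ' h1 h2
    exact (pullConv2_bijective e).1 (h1.trans h2.symm)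
  · intro σ σ' τ h1 h2
    have := h1.symm.trans h2
    simpa using this
  · intro σ hσ
    obtain ⟨τ, hτ⟩ := (pullConv2_bijective e).2 (ω * σ * ω⁻¹)
    exact ⟨τ, (hmem hτ).1 hσ, hτ⟩
  · intro τ hτ
    have hR : pullConv2 e τ = ω * (ω⁻¹ * pullConv2 e τ * ω) * ω⁻¹ := by group
    exact ⟨_, (hmem hR).2 hτ, hR⟩
  · intro μ hμ
    obtain ⟨ν, rfl⟩ := (pullConv1_bijective e).2 μ
    exact ⟨ν, h.mem_reg1L_iff.1 hμ, h.pullConv2_coboundary hμ.2⟩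
  · intro ν hν
    have hμ := h.mem_reg1L_iff.2 hν
    exact ⟨_, hμ, h.pullConv2_coboundary hμ.2⟩

end IsTwistEquiv
end Twist

/-! ### Natural endomorphisms of the tensor product of a monoidal category -/

section TensorEnd

open MonoidalCategory Functor.LaxMonoidal Functor.Monoidal

variable {C : Type*} [Category* C] [MonoidalCategory C] {D : Type*} [Category* D]
  [MonoidalCategory D]

/-- A natural endomorphism of the tensor product functor. -/
structure TensorEnd (C : Type*) [Category* C] [MonoidalCategory C] where
  app : ∀ X Y : C, tensorObj X Y ⟶ tensorObj X Y
  natural : ∀ {X X' Y Y' : C} (f : X ⟶ X') (g : Y ⟶ Y'),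
    (f ⊗ₘ g) ≫ app X' Y' = app X Y ≫ (f ⊗ₘ g)

namespace TensorEnd

theorem whiskerRight_natural (θ : TensorEnd C) {X X' : C} (f : X ⟶ X') (Y : C) :
    f ▷ Y ≫ θ.app X' Y = θ.app X Y ≫ f ▷ Y := by
  simpa using θ.natural f (𝟙 Y)

theorem whiskerLeft_natural (θ : TensorEnd C) {Y Y' : C} (X : C) (g : Y ⟶ Y') :
    X ◁ g ≫ θ.app X Y' = θ.app X Y ≫ X ◁ g := by
  simpa using θ.natural (𝟙 X) g

/-- The 2-cocycle identity for a natural endomorphism of the tensor product. -/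
def IsCocycle (θ : TensorEnd C) : Prop :=
  ∀ X Y Z : C, θ.app (tensorObj X Y) Z ≫ θ.app X Y ▷ Z ≫ (α_ X Y Z).hom =
    (α_ X Y Z).hom ≫ θ.app X (tensorObj Y Z) ≫ X ◁ θ.app Y Z

/-- A natural endomorphism of the tensor product is normalized if it is trivial whenever one of
the factors is the unit object. -/
def IsNormalized (θ : TensorEnd C) : Prop :=
  ∀ X : C, θ.app X (𝟙_ C) = 𝟙 _ ∧ θ.app (𝟙_ C) X = 𝟙 _

/-- By naturality along isomorphisms, a natural endomorphism is determined on the essential image of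
`F`. -/
theorem eq_of_app_obj_eq {C : Type*} [Category* C] {F : C ⥤ D} [F.EssSurj] {φ φ' : TensorEnd D}
    (h : ∀ X Y : C, φ.app (F.obj X) (F.obj Y) = φ'.app (F.obj X) (F.obj Y)) (X Y : D) :
    φ.app X Y = φ'.app X Y := by
  let e := F.objObjPreimageIso X
  let e' := F.objObjPreimageIso Y
  rw [← cancel_epi (e.hom ⊗ₘ e'.hom), φ.natural, φ'.natural, h]

variable (F : C ⥤ D) [F.Monoidal]

/-- `θ` and `φ` correspond to each other under the monoidal functor `F`. -/
def Related (θ : TensorEnd C) (φ : TensorEnd D) : Prop :=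
  ∀ X Y : C, μ F X Y ≫ F.map (θ.app X Y) = φ.app (F.obj X) (F.obj Y) ≫ μ F X Y

variable {F} {θ θ' : TensorEnd C} {φ φ' : TensorEnd D}

theorem Related.unique_right [F.EssSurj] (h : Related F θ φ) (h' : Related F θ φ') (X Y : D) :
    φ.app X Y = φ'.app X Y :=
  eq_of_app_obj_eq (fun X Y => by
    rw [← cancel_mono (μ F X Y), ← h, ← h']) X Y

theorem Related.unique_left [F.Faithful] (h : Related F θ φ) (h' : Related F θ' φ) (X Y : C) :
    θ.app X Y = θ'.app X Y :=
  F.map_injective (by rw [← cancel_epi (μ F X Y), h, h'])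

theorem exists_related_left [F.Full] [F.Faithful] (φ : TensorEnd D) : ∃ θ, Related F θ φ := by
  have h : ∀ X Y, μ F X Y ≫ F.map (F.preimage (inv (μ F X Y) ≫ φ.app (F.obj X) (F.obj Y) ≫
      μ F X Y)) = φ.app (F.obj X) (F.obj Y) ≫ μ F X Y := by
    intro X Y
    rw [F.map_preimage, IsIso.hom_inv_id_assoc]
  refine ⟨⟨fun X Y => F.preimage (inv (μ F X Y) ≫ φ.app (F.obj X) (F.obj Y) ≫ μ F X Y), ?_⟩, h⟩
  intro X X' Y Y' f g
  apply F.map_injective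
  rw [← cancel_epi (μ F X Y), F.map_comp, F.map_comp, ← μ_natural_assoc, h, reassoc_of% (h X Y),
    ← μ_natural, ← Category.assoc, ← Category.assoc, φ.natural]

theorem exists_related_right [F.EssSurj] [F.Full] [F.Faithful] (θ : TensorEnd C) :
    ∃ φ, Related F θ φ := by
  let G : D → C := F.objPreimage
  let e : ∀ X, F.obj (G X) ≅ X := F.objObjPreimageIso
  let ψ : ∀ X Y : C, tensorObj (F.obj X) (F.obj Y) ⟶ tensorObj (F.obj X) (F.obj Y) :=
    fun X Y => μ F X Y ≫ F.map (θ.app X Y) ≫ inv (μ F X Y)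
  -- Fullness gives naturality of `ψ` for every morphism between objects `F.obj X`, not only for
  -- visible images. This makes the extension along chosen isomorphisms natural and independent of
  -- the choices.
  have hψ : ∀ {X X' Y Y' : C} (f : F.obj X ⟶ F.obj X') (g : F.obj Y ⟶ F.obj Y'),
      (f ⊗ₘ g) ≫ ψ X' Y' = ψ X Y ≫ (f ⊗ₘ g) := by
    intro X X' Y Y' f g
    obtain ⟨f, rfl⟩ := F.map_surjective f
    obtain ⟨g, rfl⟩ := F.map_surjective g
    rw [← cancel_mono (μ F X' Y')]
    simp only [ψ, Category.assoc, IsIso.inv_hom_id, Category.comp_id, μ_natural,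
      IsIso.inv_hom_id_assoc, μ_natural_assoc, ← F.map_comp, θ.natural]
  let E : ∀ X Y : D, tensorObj (F.obj (G X)) (F.obj (G Y)) ≅ tensorObj X Y :=
    fun X Y => e X ⊗ᵢ e Y
  let φ : TensorEnd D := ⟨fun X Y => (E X Y).inv ≫ ψ (G X) (G Y) ≫ (E X Y).hom, by
      intro X X' Y Y' f g
      have h : (((e X).hom ≫ f ≫ (e X').inv) ⊗ₘ ((e Y).hom ≫ g ≫ (e Y').inv)) =
          (E X Y).hom ≫ (f ⊗ₘ g) ≫ (E X' Y').inv := by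
        rw [← tensorHom_comp_tensorHom, ← tensorHom_comp_tensorHom]
        rfl
      have h' := hψ ((e X).hom ≫ f ≫ (e X').inv) ((e Y).hom ≫ g ≫ (e Y').inv)
      rw [h] at h'
      rw [← cancel_epi (E X Y).hom, ← cancel_mono (E X' Y').inv]
      simpa only [Category.assoc, Iso.hom_inv_id, Iso.hom_inv_id_assoc, Category.comp_id] using h'⟩
  refine ⟨φ, fun X Y => ?_⟩
  -- The chosen preimage of `F.obj X` need not be `X`; naturality of `ψ` along the chosen
  -- isomorphism compensates for this.
  have h := hψ (e (F.obj X)).hom (e (F.obj Y)).hom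
  change _ = (((e _).inv ⊗ₘ (e _).inv) ≫ ψ _ _ ≫ ((e _).hom ⊗ₘ (e _).hom)) ≫ _
  rw [← h]
  simp [ψ]

theorem Related.isCocycle_iff [F.EssSurj] [F.Faithful] (h : Related F θ φ) :
    θ.IsCocycle ↔ φ.IsCocycle := by
  -- The iterated tensorators for the two bracketings. Each of the four factors of the cocycle
  -- identity passes through them, as does the associator, so `F` carries one side for `θ` to the
  -- same side for `φ`.
  let m3 : ∀ X Y Z : C, _ ⟶ F.obj (tensorObj (tensorObj X Y) Z) :=
    fun X Y Z => μ F X Y ▷ F.obj Z ≫ μ F (tensorObj X Y) Z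
  let m3' : ∀ X Y Z : C, _ ⟶ F.obj (tensorObj X (tensorObj Y Z)) :=
    fun X Y Z => F.obj X ◁ μ F Y Z ≫ μ F X (tensorObj Y Z)
  have e1 : ∀ X Y Z, m3 X Y Z ≫ F.map (θ.app (tensorObj X Y) Z) =
      φ.app (tensorObj (F.obj X) (F.obj Y)) (F.obj Z) ≫ m3 X Y Z := by
    intro X Y Z
    simp only [m3]
    rw [Category.assoc, h, ← Category.assoc, φ.whiskerRight_natural, Category.assoc]
  have e2 : ∀ X Y Z, m3 X Y Z ≫ F.map (θ.app X Y ▷ Z) =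
      φ.app (F.obj X) (F.obj Y) ▷ F.obj Z ≫ m3 X Y Z := by
    intro X Y Z
    simp only [m3, Category.assoc, ← μ_natural_left]
    rw [← comp_whiskerRight_assoc, h, comp_whiskerRight_assoc]
  have e3 : ∀ X Y Z, m3' X Y Z ≫ F.map (θ.app X (tensorObj Y Z)) =
      φ.app (F.obj X) (tensorObj (F.obj Y) (F.obj Z)) ≫ m3' X Y Z := by
    intro X Y Z
    simp only [m3']
    rw [Category.assoc, h, ← Category.assoc, φ.whiskerLeft_natural, Category.assoc]
  have e4 : ∀ X Y Z, m3' X Y Z ≫ F.map (X ◁ θ.app Y Z) =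
      F.obj X ◁ φ.app (F.obj Y) (F.obj Z) ≫ m3' X Y Z := by
    intro X Y Z
    simp only [m3', Category.assoc, ← μ_natural_right]
    rw [← whiskerLeft_comp_assoc, h, whiskerLeft_comp_assoc]
  have e5 : ∀ X Y Z, m3 X Y Z ≫ F.map (α_ X Y Z).hom = (α_ _ _ _).hom ≫ m3' X Y Z := by
    intro X Y Z
    simp only [m3, m3', Category.assoc, associativity]
  have l : ∀ X Y Z, m3 X Y Z ≫ F.map (θ.app (tensorObj X Y) Z ≫ θ.app X Y ▷ Z ≫ (α_ X Y Z).hom) =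
      (φ.app (tensorObj (F.obj X) (F.obj Y)) (F.obj Z) ≫ φ.app (F.obj X) (F.obj Y) ▷ F.obj Z ≫
        (α_ _ _ _).hom) ≫ m3' X Y Z := by
    intro X Y Z
    simp only [F.map_comp, Category.assoc]
    rw [← Category.assoc, e1, Category.assoc, ← Category.assoc (m3 X Y Z), e2, Category.assoc, e5]
  have r : ∀ X Y Z, m3 X Y Z ≫ F.map ((α_ X Y Z).hom ≫ θ.app X (tensorObj Y Z) ≫ X ◁ θ.app Y Z) =
      ((α_ _ _ _).hom ≫ φ.app (F.obj X) (tensorObj (F.obj Y) (F.obj Z)) ≫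
        F.obj X ◁ φ.app (F.obj Y) (F.obj Z)) ≫ m3' X Y Z := by
    intro X Y Z
    simp only [F.map_comp, Category.assoc]
    rw [← Category.assoc, e5, Category.assoc, ← Category.assoc (m3' X Y Z), e3, Category.assoc, e4]
  have i3 : ∀ X Y Z, IsIso (m3 X Y Z) := fun X Y Z => by dsimp only [m3]; infer_instance
  have i3' : ∀ X Y Z, IsIso (m3' X Y Z) := fun X Y Z => by dsimp only [m3']; infer_instance
  constructor
  · intro hθ X Y Z
    let e := F.objObjPreimageIso X
    let e' := F.objObjPreimageIso Y
    let e'' := F.objObjPreimageIso Z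
    rw [← cancel_epi ((e.hom ⊗ₘ e'.hom) ⊗ₘ e''.hom)]
    have key : ∀ X Y Z : C, φ.app (tensorObj (F.obj X) (F.obj Y)) (F.obj Z) ≫
        φ.app (F.obj X) (F.obj Y) ▷ F.obj Z ≫ (α_ _ _ _).hom =
        (α_ _ _ _).hom ≫ φ.app (F.obj X) (tensorObj (F.obj Y) (F.obj Z)) ≫
          F.obj X ◁ φ.app (F.obj Y) (F.obj Z) := by
      intro X Y Z
      rw [← cancel_mono (m3' X Y Z), ← l, ← r, hθ]
    -- Both sides of the cocycle identity are natural in the three objects, so it suffices to verify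
    -- it on objects in the image of `F`.
    have n1 : ((e.hom ⊗ₘ e'.hom) ⊗ₘ e''.hom) ≫ φ.app (tensorObj X Y) Z ≫ φ.app X Y ▷ Z ≫
        (α_ X Y Z).hom = (φ.app _ _ ≫ φ.app _ _ ▷ _ ≫ (α_ _ _ _).hom) ≫
          (e.hom ⊗ₘ (e'.hom ⊗ₘ e''.hom)) := by
      rw [← Category.assoc, φ.natural, Category.assoc, Category.assoc, Category.assoc,
        ← associator_naturality, ← Category.assoc (_ ⊗ₘ _) (_ ▷ _), ← tensorHom_id,
        tensorHom_comp_tensorHom, φ.natural, Category.comp_id, ← tensorHom_id,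
        ← Category.assoc (_ ⊗ₘ _) (_ ⊗ₘ _), tensorHom_comp_tensorHom, Category.id_comp]
    have n2 : ((e.hom ⊗ₘ e'.hom) ⊗ₘ e''.hom) ≫ (α_ X Y Z).hom ≫ φ.app X (tensorObj Y Z) ≫
        X ◁ φ.app Y Z = ((α_ _ _ _).hom ≫ φ.app _ _ ≫ _ ◁ φ.app _ _) ≫
          (e.hom ⊗ₘ (e'.hom ⊗ₘ e''.hom)) := by
      rw [associator_naturality_assoc, ← Category.assoc (_ ⊗ₘ _) (φ.app _ _), φ.natural,
        Category.assoc, Category.assoc, Category.assoc, ← id_tensorHom, tensorHom_comp_tensorHom,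
        φ.natural, Category.comp_id, ← id_tensorHom, tensorHom_comp_tensorHom, Category.id_comp]
    rw [n1, n2, key]
  · intro hφ X Y Z
    apply F.map_injective
    rw [← cancel_epi (m3 X Y Z), l, r, hφ]

theorem Related.isNormalized_iff [F.EssSurj] [F.Faithful] (h : Related F θ φ) :
    θ.IsNormalized ↔ φ.IsNormalized := by
  have r : ∀ X : C, (F.obj X ◁ ε F ≫ μ F X (𝟙_ C)) ≫ F.map (θ.app X (𝟙_ C)) =
      φ.app (F.obj X) (𝟙_ D) ≫ F.obj X ◁ ε F ≫ μ F X (𝟙_ C) := by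
    intro X
    rw [Category.assoc, h, ← Category.assoc, φ.whiskerLeft_natural, Category.assoc]
  have l : ∀ X : C, (ε F ▷ F.obj X ≫ μ F (𝟙_ C) X) ≫ F.map (θ.app (𝟙_ C) X) =
      φ.app (𝟙_ D) (F.obj X) ≫ ε F ▷ F.obj X ≫ μ F (𝟙_ C) X := by
    intro X
    rw [Category.assoc, h, ← Category.assoc, φ.whiskerRight_natural, Category.assoc]
  constructor
  · intro hθ Y
    let e := F.objObjPreimageIso Y
    have key : ∀ X : C, φ.app (F.obj X) (𝟙_ D) = 𝟙 _ ∧ φ.app (𝟙_ D) (F.obj X) = 𝟙 _ := by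
      intro X
      constructor
      · rw [← cancel_mono (F.obj X ◁ ε F ≫ μ F X (𝟙_ C)), ← r, (hθ X).1]
        simp
      · rw [← cancel_mono (ε F ▷ F.obj X ≫ μ F (𝟙_ C) X), ← l, (hθ X).2]
        simp
    constructor
    · rw [← cancel_epi (e.hom ▷ _), φ.whiskerRight_natural, (key _).1]
      simp
    · rw [← cancel_epi (_ ◁ e.hom), φ.whiskerLeft_natural, (key _).2]
      simp
  · intro hφ X
    constructor
    · apply F.map_injective
      rw [← cancel_epi (F.obj X ◁ ε F ≫ μ F X (𝟙_ C)), r, (hφ _).1]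
      simp
    · apply F.map_injective
      rw [← cancel_epi (ε F ▷ F.obj X ≫ μ F (𝟙_ C) X), l, (hφ _).2]
      simp

end TensorEnd

/-- A natural endomorphism of the identity functor. -/
structure IdEnd (C : Type*) [Category* C] where
  app : ∀ X : C, X ⟶ X
  natural : ∀ {X Y : C} (f : X ⟶ Y), f ≫ app Y = app X ≫ f

namespace IdEnd

section

variable {C : Type*} [Category* C] {D : Type*} [Category* D]

/-- `u` and `v` correspond to each other under the functor `F`. -/
def Related (F : C ⥤ D) (u : IdEnd C) (v : IdEnd D) : Prop :=
  ∀ X : C, F.map (u.app X) = v.app (F.obj X)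

variable {F : C ⥤ D} {u u' : IdEnd C} {v v' : IdEnd D}

theorem Related.unique_right [F.EssSurj] (h : Related F u v) (h' : Related F u v') (X : D) :
    v.app X = v'.app X := by
  rw [← cancel_epi (F.objObjPreimageIso X).hom, v.natural, v'.natural, ← h, ← h']

theorem Related.unique_left [F.Faithful] (h : Related F u v) (h' : Related F u' v) (X : C) :
    u.app X = u'.app X :=
  F.map_injective (by rw [h, h'])

theorem exists_related_left [F.Full] [F.Faithful] (v : IdEnd D) : ∃ u, Related F u v :=
  ⟨⟨fun X => F.preimage (v.app (F.obj X)), fun f => F.map_injective (by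
    simp [v.natural])⟩, fun X => by simp⟩

theorem exists_related_right [F.EssSurj] [F.Full] (u : IdEnd C) :
    ∃ v, Related F u v := by
  let e := F.objObjPreimageIso
  have hu : ∀ {X Y : C} (f : F.obj X ⟶ F.obj Y), f ≫ F.map (u.app Y) = F.map (u.app X) ≫ f := by
    intro X Y f
    obtain ⟨f, rfl⟩ := F.map_surjective f
    rw [← F.map_comp, u.natural, F.map_comp]
  refine ⟨⟨fun X => (e X).inv ≫ F.map (u.app _) ≫ (e X).hom, ?_⟩, fun X => ?_⟩
  · intro X Y f
    have h := hu ((e X).hom ≫ f ≫ (e Y).inv)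
    rw [← cancel_epi (e X).hom, ← cancel_mono (e Y).inv]
    simpa using h
  · change F.map (u.app X) = (e (F.obj X)).inv ≫ F.map (u.app _) ≫ (e (F.obj X)).hom
    rw [← hu, Iso.inv_hom_id_assoc]

end

variable {F : C ⥤ D} {u u' : IdEnd C} {v v' : IdEnd D}

theorem Related.app_unit_iff [F.Monoidal] [F.Faithful] (h : Related F u v) :
    u.app (𝟙_ C) = 𝟙 _ ↔ v.app (𝟙_ D) = 𝟙 _ := by
  have e : ε F ≫ F.map (u.app (𝟙_ C)) = v.app (𝟙_ D) ≫ ε F := by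
    rw [h, v.natural]
  constructor
  · intro hu
    rw [← cancel_mono (ε F), ← e, hu]
    simp
  · intro hv
    apply F.map_injective
    rw [← cancel_epi (ε F), e, hv]
    simp

/-- The coboundary of `u`, where `u'` is the inverse of `u`. -/
def coboundary (u u' : IdEnd C) : TensorEnd C where
  app X Y := u'.app (tensorObj X Y) ≫ X ◁ u.app Y ≫ u.app X ▷ Y
  natural {X X' Y Y'} f g := by
    -- The naturality of `u'` is separate from that of the two whiskered copies of `u`; being
    -- mutually inverse plays no role.
    have h : (f ⊗ₘ g) ≫ X' ◁ u.app Y' ≫ u.app X' ▷ Y' =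
        (X ◁ u.app Y ≫ u.app X ▷ Y) ≫ (f ⊗ₘ g) := by
      rw [← id_tensorHom, ← tensorHom_id, ← id_tensorHom, ← tensorHom_id]
      simp only [tensorHom_comp_tensorHom, Category.comp_id, u.natural]
    rw [← Category.assoc, u'.natural, Category.assoc, h]
    simp only [Category.assoc]

theorem Related.coboundary [F.Monoidal] (h : Related F u v) (h' : Related F u' v') :
    TensorEnd.Related F (coboundary u u') (IdEnd.coboundary v v') := by
  intro X Y
  simp only [IdEnd.coboundary, F.map_comp]
  rw [h', ← Category.assoc, v'.natural, Category.assoc, Category.assoc, Category.assoc,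
    ← μ_natural_right_assoc, ← μ_natural_left, h, h]

end IdEnd

end TensorEnd

/-! ### Natural endomorphisms in the category of comodules -/

section RegularCoaction

variable {k : Type*} [CommRing k] {C : Type*} [AddCommGroup C] [Module k C] [Coalgebra k C]
  {N : Type*} [AddCommGroup N] [Module k N]

/-- A lazy form acts by colinear maps. The converse, tested on the regular comodule alone, is
`isCentralFor_comul_of_act`. -/
theorem IsCoaction.lTensor_comp_act {C : Type*} [AddCommGroup C] [Module k C]
    {M : Type*} [AddCommGroup M] [Module k M]
    {Δ : C →ₗ[k] C ⊗[k] C} {ε : C →ₗ[k] k} {δ : M →ₗ[k] M ⊗[k] C} (h : IsCoaction Δ ε δ)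
    {g : C →ₗ[k] N} {τ : WithConv (C →ₗ[k] k)} (hτ : IsCentralFor Δ g τ) :
    (g.lTensor M ∘ₗ δ) ∘ₗ act δ τ = (act δ τ).rTensor N ∘ₗ g.lTensor M ∘ₗ δ := by
  rw [LinearMap.comp_assoc, h.lTensor_act, hτ, ← h.map_act, ← LinearMap.comp_assoc,
    LinearMap.rTensor_comp_lTensor]

theorem isCoaction_comul : IsCoaction (comul (R := k) (A := C)) counit comul where
  coassoc := Coalgebra.coassoc
  counit_comp := by
    ext x
    have h := LinearMap.congr_fun (Coalgebra.lTensor_counit_comp_comul (R := k) (A := C)) x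
    simp only [LinearMap.comp_apply] at h
    simp [h]

theorem lid_counit_lTensor_comul (f : C →ₗ[k] N) (c : C) :
    TensorProduct.lid k N ((counit (R := k) (A := C)).rTensor N (f.lTensor C (comul c))) = f c := by
  have e : (counit (R := k) (A := C)).rTensor N ∘ₗ f.lTensor C =
      f.lTensor k ∘ₗ (counit (R := k) (A := C)).rTensor C := by
    rw [LinearMap.rTensor_comp_lTensor, LinearMap.lTensor_comp_rTensor]
  have h := LinearMap.congr_fun e (comul c)
  simp only [LinearMap.comp_apply] at h
  rw [h, Coalgebra.rTensor_counit_comul]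
  simp

/-- Applying the counit to the first leg recovers `f`. Hence a form is determined by its action on
the regular comodule. -/
theorem lTensor_comul_injective {f g : C →ₗ[k] N}
    (h : f.lTensor C ∘ₗ comul = g.lTensor C ∘ₗ comul) : f = g := by
  ext c
  have hc := LinearMap.congr_fun h c
  simp only [LinearMap.comp_apply] at hc
  rw [← lid_counit_lTensor_comul f, hc, lid_counit_lTensor_comul]

theorem act_comul_injective {τ τ' : WithConv (C →ₗ[k] k)}
    (h : act (comul (R := k) (A := C)) τ = act comul τ') : τ = τ' := by
  refine WithConv.ext (lTensor_comul_injective ?_)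
  ext c
  apply (TensorProduct.rid k C).injective
  exact LinearMap.congr_fun h c

theorem isCentralFor_comul_of_act {g : C →ₗ[k] N} {τ : WithConv (C →ₗ[k] k)}
    (h : g.lTensor C ∘ₗ comul ∘ₗ act comul τ = TensorProduct.map (act comul τ) g ∘ₗ comul) :
    IsCentralFor comul g τ := by
  rw [isCoaction_comul.lTensor_act, isCoaction_comul.map_act] at h
  exact lTensor_comul_injective h

theorem act_comp_of_colinear {M M' : Type*} [AddCommGroup M] [Module k M] [AddCommGroup M']
    [Module k M'] {δ : M →ₗ[k] M ⊗[k] C} {δ' : M' →ₗ[k] M' ⊗[k] C} {f : M →ₗ[k] M'}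
    (hf : δ' ∘ₗ f = f.rTensor C ∘ₗ δ) (τ : WithConv (C →ₗ[k] k)) :
    act δ' τ ∘ₗ f = f ∘ₗ act δ τ :=
  act_comp_of_comp f (CoalgHom.id k C) hf τ

end RegularCoaction

/-! ### Regular and cofree comodules -/

namespace Comod

open MonoidalCategory

variable {k A B : Type u} [CommRing k] [Ring A] [Bialgebra k A] [Ring B] [Bialgebra k B]

theorem isCoaction (V : Comod k A) : IsCoaction comul counit V.coact :=
  ⟨V.coassoc, V.counit_comp⟩

theorem isCoaction_outer (V W : Comod k A) :
    IsCoaction comul counit (outer V.coact W.coact) := by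
  have h := V.isCoaction.outer W.isCoaction
  rwa [outer_comul, outer_counit] at h

variable (k A) in
/-- The regular comodule. -/
def regular : Comod k A where
  carrier := A
  coact := comul
  coassoc := isCoaction_comul.coassoc
  counit_comp := isCoaction_comul.counit_comp

/-- The cofree comodule on a module. -/
def cofree (A : Type u) [Ring A] [Bialgebra k A] (M : Type u) [AddCommGroup M] [Module k M] :
    Comod k A where
  carrier := M ⊗[k] A
  coact := (TensorProduct.assoc k M A A).symm.toLinearMap ∘ₗ comul.lTensor M
  coassoc := by
    ext x a
    have h := LinearMap.congr_fun (isCoaction_comul (k := k) (C := A)).coassoc a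
    simp only [LinearMap.comp_apply, LinearEquiv.coe_coe] at h
    simp only [TensorProduct.AlgebraTensorModule.curry_apply, LinearMap.restrictScalars_self,
      TensorProduct.curry_apply, LinearMap.comp_apply, LinearMap.lTensor_tmul, LinearEquiv.coe_coe]
    have e1 : ∀ s : A ⊗[k] A, TensorProduct.assoc k (M ⊗[k] A) A A
        (((TensorProduct.assoc k M A A).symm.toLinearMap ∘ₗ comul.lTensor M).rTensor A
          ((TensorProduct.assoc k M A A).symm (x ⊗ₜ s))) =
        (TensorProduct.assoc k M A (A ⊗[k] A)).symm
          (x ⊗ₜ TensorProduct.assoc k A A A (comul.rTensor A s)) := by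
      intro s
      induction s with
      | zero => simp
      | add x y hx hy => simp only [TensorProduct.tmul_add, map_add, hx, hy]
      | tmul a b =>
        simp only [TensorProduct.assoc_symm_tmul, LinearMap.rTensor_tmul, LinearMap.comp_apply,
          LinearMap.lTensor_tmul, LinearEquiv.coe_coe]
        generalize comul (R := k) a = s
        induction s with
        | zero => simp
        | add x y hx hy => simp only [TensorProduct.tmul_add, TensorProduct.add_tmul, map_add,
            hx, hy]
        | tmul a c => simp
    have e2 : ∀ s : A ⊗[k] A, comul.lTensor (M ⊗[k] A) ((TensorProduct.assoc k M A A).symm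
          (x ⊗ₜ s)) = (TensorProduct.assoc k M A (A ⊗[k] A)).symm (x ⊗ₜ comul.lTensor A s) := by
      intro s
      induction s with
      | zero => simp
      | add x y hx hy => simp only [TensorProduct.tmul_add, map_add, hx, hy]
      | tmul a b => simp
    rw [e1, e2, h]
  counit_comp := by
    ext x a
    have h := LinearMap.congr_fun (isCoaction_comul (k := k) (C := A)).counit_comp a
    simp only [LinearMap.comp_apply, LinearEquiv.coe_coe, LinearMap.id_apply] at h
    simp only [TensorProduct.AlgebraTensorModule.curry_apply, LinearMap.restrictScalars_self,
      TensorProduct.curry_apply, LinearMap.comp_apply, LinearMap.lTensor_tmul, LinearEquiv.coe_coe,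
      LinearMap.id_apply]
    have e : ∀ s : A ⊗[k] A, TensorProduct.rid k (M ⊗[k] A) ((counit (R := k) (A := A)).lTensor _
        ((TensorProduct.assoc k M A A).symm (x ⊗ₜ s))) =
        x ⊗ₜ TensorProduct.rid k A ((counit (R := k) (A := A)).lTensor _ s) := by
      intro s
      induction s with
      | zero => simp
      | add x y hx hy => simp only [TensorProduct.tmul_add, map_add, hx, hy]
      | tmul a b => simp
    rw [e, h]

/-- The coaction, as a morphism to the cofree comodule. -/
def coactHom (V : Comod k A) : V ⟶ cofree A V where
  lin := V.coact
  colinear := by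
    have h := V.coassoc
    change ((TensorProduct.assoc k V A A).symm.toLinearMap ∘ₗ comul.lTensor V) ∘ₗ V.coact = _
    rw [LinearMap.comp_assoc, ← h]
    ext v
    exact (TensorProduct.assoc k V A A).symm_apply_apply _

/-- The map `a ↦ x ⊗ a`, as a morphism from the regular to the cofree comodule. -/
def regularToCofree {M : Type u} [AddCommGroup M] [Module k M] (x : M) :
    regular k A ⟶ cofree A M where
  lin := TensorProduct.mk k M A x
  colinear := by
    refine LinearMap.ext fun (a : A) => ?_
    change (TensorProduct.assoc k M A A).symm (x ⊗ₜ comul a) =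
      (TensorProduct.mk k M A x).rTensor A (comul a)
    generalize comul (R := k) a = s
    induction s with
    | zero => simp
    | add x y hx hy => simp only [TensorProduct.tmul_add, map_add, hx, hy]
    | tmul a c => simp

end Comod

/-! ### Lazy forms on `A` as natural endomorphisms of the identity functor -/

namespace IdEnd

open MonoidalCategory Comod

variable {k A B : Type u} [CommRing k] [Ring A] [Bialgebra k A] [Ring B] [Bialgebra k B]

/-- `u` is given by the action of the linear form `τ`. -/
def IsAct (u : IdEnd (Comod k A)) (τ : WithConv (A →ₗ[k] k)) : Prop :=
  ∀ V : Comod k A, Hom.lin (u.app V) = act V.coact τ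

/-- The coaction maps `V` into the cofree comodule `V ⊗ A`, and the morphisms `x ⊗ -` from the
regular comodule show that `u` acts there as `id ⊗ g`. So `u` is determined by `g`; since the counit
splits the coaction, only `ε ∘ g` matters. -/
theorem exists_isAct (u : IdEnd (Comod k A)) : ∃ τ, u.IsAct τ := by
  let g : A →ₗ[k] A := Hom.lin (u.app (regular k A))
  let τ : A →ₗ[k] k := counit ∘ₗ g
  refine ⟨WithConv.toConv τ, fun V => ?_⟩
  let f : V ⊗[k] A →ₗ[k] V ⊗[k] A := Hom.lin (u.app (cofree A V))
  have h1 : f ∘ₗ V.coact = V.coact ∘ₗ Hom.lin (u.app V) :=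
    congrArg Hom.lin (u.natural (coactHom V))
  have hfg : ∀ (x : V) (a : A), f (x ⊗ₜ a) = x ⊗ₜ g a := fun x a =>
    LinearMap.congr_fun (congrArg Hom.lin (u.natural (regularToCofree (A := A) x))) a
  have h2 : (counit (R := k) (A := A)).lTensor V ∘ₗ f = τ.lTensor V := by
    ext x a
    simp [hfg, τ]
  calc
    Hom.lin (u.app V) = ((TensorProduct.rid k V).toLinearMap ∘ₗ
        (counit (R := k) (A := A)).lTensor V ∘ₗ V.coact) ∘ₗ Hom.lin (u.app V) := by
      rw [V.counit_comp, LinearMap.id_comp]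
    _ = (TensorProduct.rid k V).toLinearMap ∘ₗ
        ((counit (R := k) (A := A)).lTensor V ∘ₗ f) ∘ₗ V.coact := by
      simp only [LinearMap.comp_assoc, h1]
    _ = _ := by rw [h2]; rfl

variable {u u' : IdEnd (Comod k A)} {τ τ' : WithConv (A →ₗ[k] k)}

theorem IsAct.unique (h : u.IsAct τ) (h' : u.IsAct τ') : τ = τ' :=
  act_comul_injective ((h (regular k A)).symm.trans (h' (regular k A)))

theorem IsAct.app_eq (h : u.IsAct τ) (h' : u'.IsAct τ) (V : Comod k A) : u.app V = u'.app V :=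
  hom_ext ((h V).trans (h' V).symm)

/-- Colinearity of the component at the regular comodule already forces laziness. -/
theorem IsAct.commute (h : u.IsAct τ) :
    Commute (convScalar A τ) (WithConv.toConv (LinearMap.id : A →ₗ[k] A)) := by
  rw [← isCentralFor_comul_iff]
  apply isCentralFor_comul_of_act
  have e : Hom.lin (u.app (regular k A)) = act (comul (R := k) (A := A)) τ := h (regular k A)
  rw [← e]
  have hc := Hom.colinear (u.app (regular k A))
  rw [LinearMap.lTensor_id, LinearMap.id_comp]
  exact hc

theorem exists_of_commute
    (h : Commute (convScalar A τ) (WithConv.toConv (LinearMap.id : A →ₗ[k] A))) :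
    ∃ u : IdEnd (Comod k A), u.IsAct τ := by
  rw [← isCentralFor_comul_iff] at h
  refine ⟨⟨fun V => ⟨act V.coact τ, ?_⟩, fun f => hom_ext (act_comp_of_colinear f.colinear τ)⟩,
    fun V => rfl⟩
  have e := V.isCoaction.lTensor_comp_act h
  rwa [LinearMap.lTensor_id, LinearMap.id_comp] at e

theorem IsAct.app_unit_iff (h : u.IsAct τ) : u.app (𝟙_ (Comod k A)) = 𝟙 _ ↔ τ (1 : A) = 1 := by
  have e : ∀ r : k, Hom.lin (u.app (𝟙_ (Comod k A))) r = r * τ (1 : A) := by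
    intro r
    have h1 := LinearMap.congr_fun (h (𝟙_ (Comod k A))) r
    refine h1.trans ?_
    change TensorProduct.rid k k (r ⊗ₜ τ (1 : A)) = _
    rw [TensorProduct.rid_tmul, smul_eq_mul, mul_comm]
  constructor
  · intro hu
    have h1 := e 1
    rw [hu, one_mul] at h1
    exact h1.symm
  · intro hτ
    apply hom_ext
    refine LinearMap.ext fun (r : k) => (e r).trans ?_
    rw [hτ, mul_one]
    rfl

theorem IsAct.mem_Reg1L_iff {μ : Conv1 k A} (h : u.IsAct μ.val) :
    μ ∈ Reg1L k A ↔ u.app (𝟙_ (Comod k A)) = 𝟙 _ := by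
  rw [h.app_unit_iff]
  exact ⟨fun hμ => hμ.1, fun hμ => ⟨hμ, h.commute⟩⟩

/-- The linear forms `τ` and `φ` act by corresponding endomorphisms. -/
def Rel (F : Comod k A ⥤ Comod k B) (τ : WithConv (A →ₗ[k] k)) (φ : WithConv (B →ₗ[k] k)) : Prop :=
  ∃ (u : IdEnd (Comod k A)) (v : IdEnd (Comod k B)), u.IsAct τ ∧ v.IsAct φ ∧ Related F u v

variable {F : Comod k A ⥤ Comod k B} {φ φ' : WithConv (B →ₗ[k] k)}

theorem Rel.unique_right [F.EssSurj] (h : Rel F τ φ) (h' : Rel F τ φ') : φ = φ' := by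
  obtain ⟨u, v, hu, hv, huv⟩ := h
  obtain ⟨u', v', hu', hv', huv'⟩ := h'
  have e : Related F u v' := fun X => by rw [hu.app_eq hu', huv']
  exact hv.unique fun X => by rw [huv.unique_right e, hv']

theorem Rel.unique_left [F.Faithful] (h : Rel F τ φ) (h' : Rel F τ' φ) : τ = τ' := by
  obtain ⟨u, v, hu, hv, huv⟩ := h
  obtain ⟨u', v', hu', hv', huv'⟩ := h'
  have e : Related F u' v := fun X => by rw [huv', hv'.app_eq hv]
  exact hu.unique fun X => by rw [huv.unique_left e, hu']

theorem rel_one (F : Comod k A ⥤ Comod k B) : Rel F 1 1 :=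
  ⟨⟨fun X => 𝟙 X, by simp⟩, ⟨fun X => 𝟙 X, by simp⟩, fun V => (act_one V.isCoaction).symm,
    fun V => (act_one V.isCoaction).symm, fun X => by simp⟩

theorem Rel.mul (h : Rel F τ φ) (h' : Rel F τ' φ') : Rel F (τ * τ') (φ * φ') := by
  obtain ⟨u, v, hu, hv, huv⟩ := h
  obtain ⟨u', v', hu', hv', huv'⟩ := h'
  refine ⟨⟨fun X => u'.app X ≫ u.app X, fun f => ?_⟩, ⟨fun X => v'.app X ≫ v.app X, fun f => ?_⟩,
    fun V => ?_, fun V => ?_, fun X => ?_⟩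
  · rw [← Category.assoc, u'.natural, Category.assoc, Category.assoc, u.natural]
  · rw [← Category.assoc, v'.natural, Category.assoc, Category.assoc, v.natural]
  · rw [comp_lin, hu, hu', act_mul V.isCoaction]
  · rw [comp_lin, hv, hv', act_mul V.isCoaction]
  · rw [F.map_comp, huv, huv']

theorem exists_rel_right [F.EssSurj] [F.Full] {μ : Conv1 k A} (hμ : IsLazy1 μ)
    (hμ' : IsLazy1 μ⁻¹) : ∃ ν : Conv1 k B, Rel F μ.val ν.val ∧ Rel F μ⁻¹.val ν⁻¹.val := by
  obtain ⟨u, hu⟩ := exists_of_commute hμ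
  obtain ⟨u', hu'⟩ := exists_of_commute hμ'
  obtain ⟨v, hv⟩ := exists_related_right (F := F) u
  obtain ⟨v', hv'⟩ := exists_related_right (F := F) u'
  obtain ⟨τ, hτ⟩ := v.exists_isAct
  obtain ⟨τ', hτ'⟩ := v'.exists_isAct
  have h : Rel F μ.val τ := ⟨u, v, hu, hτ, hv⟩
  have h' : Rel F μ⁻¹.val τ' := ⟨u', v', hu', hτ', hv'⟩
  obtain ⟨ν, rfl, rfl⟩ := exists_unit_of_rel (rel_one F) Rel.mul Rel.unique_right h h'
  exact ⟨ν, h, h'⟩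

theorem exists_rel_left [F.Full] [F.Faithful] {ν : Conv1 k B} (hν : IsLazy1 ν)
    (hν' : IsLazy1 ν⁻¹) : ∃ μ : Conv1 k A, Rel F μ.val ν.val ∧ Rel F μ⁻¹.val ν⁻¹.val := by
  obtain ⟨v, hv⟩ := exists_of_commute hν
  obtain ⟨v', hv'⟩ := exists_of_commute hν'
  obtain ⟨u, hu⟩ := exists_related_left (F := F) v
  obtain ⟨u', hu'⟩ := exists_related_left (F := F) v'
  obtain ⟨τ, hτ⟩ := u.exists_isAct
  obtain ⟨τ', hτ'⟩ := u'.exists_isAct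
  have h : Rel F τ ν.val := ⟨u, v, hτ, hv, hu⟩
  have h' : Rel F τ' ν⁻¹.val := ⟨u', v', hτ', hv', hu'⟩
  obtain ⟨μ, rfl, rfl⟩ := exists_unit_of_rel (R := fun φ τ => Rel F τ φ) (rel_one F) Rel.mul
    (fun h h' => Rel.unique_left h h') h h'
  exact ⟨μ, h, h'⟩

theorem Rel.mem_Reg1L_iff [F.Monoidal] [F.Faithful] {μ : Conv1 k A} {ν : Conv1 k B}
    (h : Rel F μ.val ν.val) : μ ∈ Reg1L k A ↔ ν ∈ Reg1L k B := by
  obtain ⟨u, v, hu, hv, huv⟩ := h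
  rw [hu.mem_Reg1L_iff, hv.mem_Reg1L_iff, huv.app_unit_iff]

end IdEnd

/-! ### Forms acting on tensor products of comodules -/

section Codiagonal

variable {k : Type*} [CommRing k] {R : Type*} [Ring R] [Bialgebra k R]
  {M : Type*} [AddCommGroup M] [Module k M] {M' : Type*} [AddCommGroup M'] [Module k M']
  {M'' : Type*} [AddCommGroup M''] [Module k M'']

/-- The codiagonal coaction on a tensor product. -/
def codiagonal (δ : M →ₗ[k] M ⊗[k] R) (δ' : M' →ₗ[k] M' ⊗[k] R) :
    M ⊗[k] M' →ₗ[k] (M ⊗[k] M') ⊗[k] R :=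
  (LinearMap.mul' k R).lTensor (M ⊗[k] M') ∘ₗ outer δ δ'

variable (δ : M →ₗ[k] M ⊗[k] R) (δ' : M' →ₗ[k] M' ⊗[k] R) (δ'' : M'' →ₗ[k] M'' ⊗[k] R)

theorem act_codiagonal (τ : WithConv (R →ₗ[k] k)) :
    act (codiagonal δ δ') τ = act (outer δ δ') (convPull (Bialgebra.mulCoalgHom k R) τ) :=
  act_comp_of_comp LinearMap.id (Bialgebra.mulCoalgHom k R) rfl τ

theorem act_outer_codiagonal_left (τ : WithConv (R ⊗[k] R →ₗ[k] k)) :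
    act (outer (codiagonal δ δ') δ'') τ = act (outer (outer δ δ') δ'')
      (convPull (Coalgebra.TensorProduct.map (Bialgebra.mulCoalgHom k R) (CoalgHom.id k R)) τ) := by
  refine act_comp_of_comp LinearMap.id
    (Coalgebra.TensorProduct.map (Bialgebra.mulCoalgHom k R) (CoalgHom.id k R)) ?_ τ
  have h := outer_comp_map (f := LinearMap.id) (f' := LinearMap.id) (g := LinearMap.mul' k R)
    (g' := LinearMap.id) (δ := outer δ δ') (δ' := δ'') (d := codiagonal δ δ')
    (d' := δ'') rfl (by rw [TensorProduct.map_id]; rfl)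
  rw [TensorProduct.map_id] at h
  exact h

theorem act_outer_codiagonal_right (τ : WithConv (R ⊗[k] R →ₗ[k] k)) :
    act (outer δ (codiagonal δ' δ'')) τ = act (outer δ (outer δ' δ''))
      (convPull (Coalgebra.TensorProduct.map (CoalgHom.id k R) (Bialgebra.mulCoalgHom k R)) τ) := by
  refine act_comp_of_comp LinearMap.id
    (Coalgebra.TensorProduct.map (CoalgHom.id k R) (Bialgebra.mulCoalgHom k R)) ?_ τ
  have h := outer_comp_map (f := LinearMap.id) (f' := LinearMap.id) (g := LinearMap.id)
    (g' := LinearMap.mul' k R) (δ := δ) (δ' := outer δ' δ'') (d := δ)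
    (d' := codiagonal δ' δ'') (by rw [TensorProduct.map_id]; rfl) rfl
  rw [TensorProduct.map_id] at h
  exact h

theorem act_outer_assoc (τ : WithConv (R ⊗[k] (R ⊗[k] R) →ₗ[k] k)) :
    act (outer δ (outer δ' δ'')) τ ∘ₗ (TensorProduct.assoc k M M' M'').toLinearMap =
      (TensorProduct.assoc k M M' M'').toLinearMap ∘ₗ act (outer (outer δ δ') δ'')
        (convPull (Coalgebra.TensorProduct.assoc k k R R R :
          (R ⊗[k] R) ⊗[k] R →ₗc[k] R ⊗[k] (R ⊗[k] R)) τ) :=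
  act_comp_of_comp _ (Coalgebra.TensorProduct.assoc k k R R R :
          (R ⊗[k] R) ⊗[k] R →ₗc[k] R ⊗[k] (R ⊗[k] R)) (outer_comp_assoc δ δ' δ'') τ

variable {δ δ' δ''}

/-- The codiagonal coaction merges two coacting factors by the product, which is the pullback
defining `faceMulLeft`. Thus the iterated action corresponds to one side of the cocycle identity, in
the same order. -/
theorem act_face12_mul_faceMulLeft (h : IsCoaction comul counit δ) (h' : IsCoaction comul counit δ')
    (h'' : IsCoaction comul counit δ'') (σ : Conv2 k R) :
    (act (outer δ δ') σ.val).rTensor M'' ∘ₗ act (outer (codiagonal δ δ') δ'') σ.val =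
      act (outer (outer δ δ') δ'') (face12 σ * faceMulLeft σ).val := by
  have h3 := (h.outer h').outer h''
  rw [outer_counit, outer_counit] at h3
  rw [act_outer_codiagonal_left, ← act_outer_fst h'', ← act_mul h3]
  rfl

theorem act_face23_mul_faceMulRight (h : IsCoaction comul counit δ)
    (h' : IsCoaction comul counit δ') (h'' : IsCoaction comul counit δ'') (σ : Conv2 k R) :
    ((act (outer δ' δ'') σ.val).lTensor M ∘ₗ act (outer δ (codiagonal δ' δ'')) σ.val) ∘ₗ
      (TensorProduct.assoc k M M' M'').toLinearMap =
      (TensorProduct.assoc k M M' M'').toLinearMap ∘ₗ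
        act (outer (outer δ δ') δ'') (face23 σ * faceMulRight σ).val := by
  have h3 := h.outer (h'.outer h'')
  rw [outer_counit, outer_counit] at h3
  rw [act_outer_codiagonal_right, ← act_outer_snd h, ← act_mul h3, act_outer_assoc, map_mul]
  rfl

end Codiagonal

/-! ### Lazy forms on `A ⊗ A` as natural endomorphisms of the tensor product -/

namespace TensorEnd

open MonoidalCategory Comod

variable {k A B : Type u} [CommRing k] [Ring A] [Bialgebra k A] [Ring B] [Bialgebra k B]

/-- `θ` is given by the action of the linear form `τ`. -/
def IsAct (θ : TensorEnd (Comod k A)) (τ : WithConv (A ⊗[k] A →ₗ[k] k)) : Prop :=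
  ∀ V W : Comod k A, Hom.lin (θ.app V W) = act (outer V.coact W.coact) τ

theorem exists_isAct (θ : TensorEnd (Comod k A)) : ∃ τ, θ.IsAct τ := by
  let g : A ⊗[k] A →ₗ[k] A ⊗[k] A := Hom.lin (θ.app (regular k A) (regular k A))
  let τ : A ⊗[k] A →ₗ[k] k := counit ∘ₗ g
  refine ⟨WithConv.toConv τ, fun V W => ?_⟩
  let f : (V ⊗[k] A) ⊗[k] (W ⊗[k] A) →ₗ[k] (V ⊗[k] A) ⊗[k] (W ⊗[k] A) :=
    Hom.lin (θ.app (cofree A V) (cofree A W))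
  let h : V ⊗[k] W →ₗ[k] V ⊗[k] W := Hom.lin (θ.app V W)
  have h1 : f ∘ₗ TensorProduct.map V.coact W.coact = TensorProduct.map V.coact W.coact ∘ₗ h :=
    congrArg Hom.lin (θ.natural (coactHom V) (coactHom W))
  have hfg : ∀ (x : V) (a : A) (y : W) (b : A), f ((x ⊗ₜ a) ⊗ₜ (y ⊗ₜ b)) =
      TensorProduct.map (TensorProduct.mk k V A x) (TensorProduct.mk k W A y) (g (a ⊗ₜ b)) :=
    fun x a y b => LinearMap.congr_fun (congrArg Hom.lin
      (θ.natural (regularToCofree (A := A) x) (regularToCofree (A := A) y))) (a ⊗ₜ b)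
  -- The splitting of the coaction by the counit. Applied in both variables, it recovers `θ.app V W`
  -- from its value on a pair of cofree comodules, where naturality reduces everything to `g`.
  let ε (V : Comod k A) : V ⊗[k] A →ₗ[k] V :=
    (TensorProduct.rid k V).toLinearMap ∘ₗ (counit (R := k) (A := A)).lTensor V
  have hε : TensorProduct.map (ε V) (ε W) ∘ₗ TensorProduct.map V.coact W.coact =
      LinearMap.id := by
    have e : ∀ V : Comod k A, ε V ∘ₗ V.coact = LinearMap.id := fun V => V.counit_comp
    rw [← TensorProduct.map_comp, e, e, TensorProduct.map_id]
  have h2 : TensorProduct.map (ε V) (ε W) ∘ₗ f = (TensorProduct.rid k _).toLinearMap ∘ₗ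
      τ.lTensor (V ⊗[k] W) ∘ₗ (TensorProduct.tensorTensorTensorComm k V A W A).toLinearMap := by
    ext x a y b
    simp only [TensorProduct.AlgebraTensorModule.curry_apply, LinearMap.restrictScalars_self,
      TensorProduct.curry_apply, LinearMap.comp_apply, LinearEquiv.coe_coe, hfg,
      TensorProduct.tensorTensorTensorComm_tmul, LinearMap.lTensor_tmul, τ]
    generalize g (a ⊗ₜ b) = s
    induction s with
    | zero => simp
    | add x y hx hy => simp only [TensorProduct.tmul_add, map_add, hx, hy]
    | tmul a b => simp [ε, TensorProduct.smul_tmul', smul_smul, mul_comm]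
  change h = _
  calc
    h = (TensorProduct.map (ε V) (ε W) ∘ₗ TensorProduct.map V.coact W.coact) ∘ₗ h := by
      rw [hε, LinearMap.id_comp]
    _ = (TensorProduct.map (ε V) (ε W) ∘ₗ f) ∘ₗ TensorProduct.map V.coact W.coact := by
      rw [LinearMap.comp_assoc, ← h1, LinearMap.comp_assoc]
    _ = _ := by rw [h2]; rfl

variable {θ θ' : TensorEnd (Comod k A)} {τ τ' : WithConv (A ⊗[k] A →ₗ[k] k)}

theorem IsAct.regular (h : θ.IsAct τ) :
    Hom.lin (θ.app (regular k A) (regular k A)) = act (comul (R := k) (A := A ⊗[k] A)) τ :=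
  h (Comod.regular k A) (Comod.regular k A)

theorem IsAct.unique (h : θ.IsAct τ) (h' : θ.IsAct τ') : τ = τ' :=
  act_comul_injective (h.regular.symm.trans h'.regular)

theorem IsAct.app_eq (h : θ.IsAct τ) (h' : θ'.IsAct τ) (V W : Comod k A) :
    θ.app V W = θ'.app V W :=
  hom_ext ((h V W).trans (h' V W).symm)

theorem IsAct.commute (h : θ.IsAct τ) :
    Commute (convScalar A τ) (WithConv.toConv (LinearMap.mul' k A)) := by
  rw [← isCentralFor_comul_iff]
  apply isCentralFor_comul_of_act
  have hc := Hom.colinear (θ.app (Comod.regular k A) (Comod.regular k A))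
  rw [h.regular] at hc
  rw [← LinearMap.rTensor_comp_lTensor, LinearMap.comp_assoc]
  exact hc

theorem exists_of_commute
    (h : Commute (convScalar A τ) (WithConv.toConv (LinearMap.mul' k A))) :
    ∃ θ : TensorEnd (Comod k A), θ.IsAct τ := by
  rw [← isCentralFor_comul_iff] at h
  exact ⟨⟨fun V W => ⟨act (outer V.coact W.coact) τ, (V.isCoaction_outer W).lTensor_comp_act h⟩,
    fun f g => hom_ext (act_comp_of_colinear
      ((outer_comp_map (g := LinearMap.id) (g' := LinearMap.id) f.colinear g.colinear).trans
        (by rw [TensorProduct.map_id]; rfl)) τ)⟩, fun V W => rfl⟩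

/-- The two composites in the categorical identity are the actions of the two sides of the identity
for `σ`. Evaluating on three regular comodules, where forms act faithfully, gives the converse. -/
theorem IsAct.isCocycle_iff {σ : Conv2 k A} (h : θ.IsAct σ.val) :
    θ.IsCocycle ↔ IsLeftCocycle σ := by
  have l : ∀ V W X : Comod k A, Hom.lin (θ.app (tensorObj V W) X ≫ θ.app V W ▷ X ≫
      (α_ V W X).hom) = (TensorProduct.assoc k V W X).toLinearMap ∘ₗ
        act (outer (outer V.coact W.coact) X.coact) (face12 σ * faceMulLeft σ).val := by
    intro V W X
    rw [← act_face12_mul_faceMulLeft V.isCoaction W.isCoaction X.isCoaction, ← h V W]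
    change ((TensorProduct.assoc k V W X).toLinearMap ∘ₗ (Hom.lin (θ.app V W)).rTensor X) ∘ₗ
      Hom.lin (θ.app (tensorObj V W) X) = _
    rw [h (tensorObj V W) X]
    rfl
  have r : ∀ V W X : Comod k A, Hom.lin ((α_ V W X).hom ≫ θ.app V (tensorObj W X) ≫
      V ◁ θ.app W X) = (TensorProduct.assoc k V W X).toLinearMap ∘ₗ
        act (outer (outer V.coact W.coact) X.coact) (face23 σ * faceMulRight σ).val := by
    intro V W X
    refine Eq.trans ?_ (act_face23_mul_faceMulRight V.isCoaction W.isCoaction X.isCoaction σ)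
    rw [← h W X]
    change ((Hom.lin (θ.app W X)).lTensor V ∘ₗ Hom.lin (θ.app V (tensorObj W X))) ∘ₗ
      (TensorProduct.assoc k V W X).toLinearMap = _
    rw [h V (tensorObj W X)]
    rfl
  constructor
  · intro hθ
    have e := congrArg Hom.lin (hθ (Comod.regular k A) (Comod.regular k A) (Comod.regular k A))
    rw [l, r] at e
    refine Units.ext (act_comul_injective (C := (A ⊗[k] A) ⊗[k] A) ?_)
    refine LinearMap.ext fun x => ?_
    exact (TensorProduct.assoc k A A A).injective (LinearMap.congr_fun e x)
  · intro hσ V W X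
    apply hom_ext
    rw [l, r, hσ]

/-- The trivial comodule coacts by `1`, so under `V ⊗ k ≅ V` the form `τ` acts as `τ(-, 1)`. This is
how normalization at the unit object becomes membership in `Reg2`. -/
theorem act_outer_trivial (V : Comod k A) (τ : WithConv (A ⊗[k] A →ₗ[k] k)) :
    act (outer V.coact (Comod.trivial k A).coact) τ ∘ₗ (TensorProduct.rid k V).symm.toLinearMap =
      (TensorProduct.rid k V).symm.toLinearMap ∘ₗ act V.coact (convPull (inlHom k A) τ) := by
  refine act_comp_of_comp (δ' := outer V.coact (Comod.trivial k A).coact)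
    (TensorProduct.rid k V).symm.toLinearMap (inlHom k A) ?_ τ
  refine LinearMap.ext fun v => ?_
  change TensorProduct.tensorTensorTensorComm k V A k A (V.coact v ⊗ₜ ((1 : k) ⊗ₜ (1 : A))) =
    TensorProduct.map (TensorProduct.rid k V).symm.toLinearMap (inlHom k A).toLinearMap (V.coact v)
  generalize V.coact v = s
  induction s with
  | zero => simp
  | add x y hx hy => simp only [TensorProduct.add_tmul, map_add, hx, hy]
  | tmul v a => rfl

theorem act_trivial_outer (V : Comod k A) (τ : WithConv (A ⊗[k] A →ₗ[k] k)) :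
    act (outer (Comod.trivial k A).coact V.coact) τ ∘ₗ (TensorProduct.lid k V).symm.toLinearMap =
      (TensorProduct.lid k V).symm.toLinearMap ∘ₗ act V.coact (convPull (inrHom k A) τ) := by
  refine act_comp_of_comp (δ' := outer (Comod.trivial k A).coact V.coact)
    (TensorProduct.lid k V).symm.toLinearMap (inrHom k A) ?_ τ
  refine LinearMap.ext fun v => ?_
  change TensorProduct.tensorTensorTensorComm k k A V A (((1 : k) ⊗ₜ (1 : A)) ⊗ₜ V.coact v) =
    TensorProduct.map (TensorProduct.lid k V).symm.toLinearMap (inrHom k A).toLinearMap (V.coact v)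
  generalize V.coact v = s
  induction s with
  | zero => simp
  | add x y hx hy => simp only [TensorProduct.tmul_add, map_add, hx, hy]
  | tmul v a => rfl

theorem comp_symm_eq_iff {M N : Type*} [AddCommGroup M] [Module k M] [AddCommGroup N] [Module k N]
    (e : M ≃ₗ[k] N) {f : M →ₗ[k] M} {g : N →ₗ[k] N}
    (h : f ∘ₗ e.symm.toLinearMap = e.symm.toLinearMap ∘ₗ g) :
    f = LinearMap.id ↔ g = LinearMap.id := by
  constructor
  · rintro rfl
    ext x
    have hx := LinearMap.congr_fun h x
    exact (e.symm.injective hx).symm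
  · rintro rfl
    ext x
    have hx := LinearMap.congr_fun h (e x)
    simpa using hx

theorem act_coact_eq_id_iff (τ : WithConv (A →ₗ[k] k)) :
    (∀ V : Comod k A, act V.coact τ = LinearMap.id) ↔ τ = 1 :=
  ⟨fun h => act_comul_injective (k := k) (C := A) ((h (Comod.regular k A)).trans
    (act_one (isCoaction_comul (k := k) (C := A))).symm),
    fun h V => h ▸ act_one V.isCoaction⟩

theorem IsAct.isNormalized_iff {σ : Conv2 k A} (h : θ.IsAct σ.val) :
    θ.IsNormalized ↔ σ ∈ Reg2 k A := by
  have e1 : ∀ V : Comod k A, θ.app V (𝟙_ (Comod k A)) = 𝟙 _ ↔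
      act V.coact (convPull (inlHom k A) σ.val) = LinearMap.id := by
    intro V
    rw [← comp_symm_eq_iff _ (act_outer_trivial V σ.val)]
    exact ⟨fun e => (h V (𝟙_ _)).symm.trans (congrArg Hom.lin e),
      fun e => hom_ext ((h V (𝟙_ _)).trans e)⟩
  have e2 : ∀ V : Comod k A, θ.app (𝟙_ (Comod k A)) V = 𝟙 _ ↔
      act V.coact (convPull (inrHom k A) σ.val) = LinearMap.id := by
    intro V
    rw [← comp_symm_eq_iff _ (act_trivial_outer V σ.val)]
    exact ⟨fun e => (h (𝟙_ _) V).symm.trans (congrArg Hom.lin e),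
      fun e => hom_ext ((h (𝟙_ _) V).trans e)⟩
  refine Iff.trans ?_ (mem_reg2_iff k A σ).symm
  simp only [IsNormalized, e1, e2, forall_and, act_coact_eq_id_iff, Units.ext_iff]
  rfl

theorem IsAct.mem_ZL2_iff {σ : Conv2 k A} (h : θ.IsAct σ.val) :
    σ ∈ ZL2 k A ↔ θ.IsNormalized ∧ θ.IsCocycle := by
  rw [h.isNormalized_iff, h.isCocycle_iff]
  exact ⟨fun hσ => ⟨hσ.1.1, hσ.2⟩, fun hσ => ⟨⟨hσ.1, h.commute⟩, hσ.2⟩⟩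

/-- The first map applied is `u'` on `V ⊗ W`, which acts through the codiagonal coaction and gives
the factor `μ⁻¹(a₂ b₂)`; the whiskered copies of `u` give the other two factors. -/
theorem isAct_coboundary {u u' : IdEnd (Comod k A)} {μ : Conv1 k A} (h : u.IsAct μ.val)
    (h' : u'.IsAct μ⁻¹.val) : (IdEnd.coboundary u u').IsAct (coboundary μ).val := by
  intro V W
  change ((Hom.lin (u.app V)).rTensor W ∘ₗ (Hom.lin (u.app W)).lTensor V) ∘ₗ
    Hom.lin (u'.app (tensorObj V W)) = _
  rw [h', h, h]
  change _ ∘ₗ act (codiagonal V.coact W.coact) _ = _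
  rw [act_codiagonal, ← act_outer_fst W.isCoaction, ← act_outer_snd V.isCoaction,
    ← act_mul (V.isCoaction_outer W), ← act_mul (V.isCoaction_outer W)]
  rfl

/-- The linear forms `τ` and `φ` act by corresponding endomorphisms. -/
def Rel (F : Comod k A ⥤ Comod k B) [F.Monoidal] (τ : WithConv (A ⊗[k] A →ₗ[k] k))
    (φ : WithConv (B ⊗[k] B →ₗ[k] k)) : Prop :=
  ∃ (θ : TensorEnd (Comod k A)) (χ : TensorEnd (Comod k B)), θ.IsAct τ ∧ χ.IsAct φ ∧ Related F θ χ

variable {F : Comod k A ⥤ Comod k B} [F.Monoidal] {φ φ' : WithConv (B ⊗[k] B →ₗ[k] k)}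

theorem Rel.unique_right [F.EssSurj] (h : Rel F τ φ) (h' : Rel F τ φ') : φ = φ' := by
  obtain ⟨u, v, hu, hv, huv⟩ := h
  obtain ⟨u', v', hu', hv', huv'⟩ := h'
  have e : Related F u v' := fun X Y => by rw [hu.app_eq hu', huv']
  exact hv.unique fun X Y => by rw [huv.unique_right e, hv']

theorem Rel.unique_left [F.Faithful] (h : Rel F τ φ) (h' : Rel F τ' φ) : τ = τ' := by
  obtain ⟨u, v, hu, hv, huv⟩ := h
  obtain ⟨u', v', hu', hv', huv'⟩ := h'
  have e : Related F u' v := fun X Y => by rw [huv', hv'.app_eq hv]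
  exact hu.unique fun X Y => by rw [huv.unique_left e, hu']

theorem rel_one (F : Comod k A ⥤ Comod k B) [F.Monoidal] : Rel F 1 1 :=
  ⟨⟨fun X Y => 𝟙 _, by simp⟩, ⟨fun X Y => 𝟙 _, by simp⟩,
    fun V W => (act_one (V.isCoaction_outer W)).symm,
    fun V W => (act_one (V.isCoaction_outer W)).symm, fun X Y => by simp⟩

theorem Rel.mul (h : Rel F τ φ) (h' : Rel F τ' φ') : Rel F (τ * τ') (φ * φ') := by
  obtain ⟨u, v, hu, hv, huv⟩ := h
  obtain ⟨u', v', hu', hv', huv'⟩ := h'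
  refine ⟨⟨fun X Y => u'.app X Y ≫ u.app X Y, fun f g => ?_⟩,
    ⟨fun X Y => v'.app X Y ≫ v.app X Y, fun f g => ?_⟩, fun V W => ?_, fun V W => ?_, fun X Y => ?_⟩
  · rw [← Category.assoc, u'.natural, Category.assoc, Category.assoc, u.natural]
  · rw [← Category.assoc, v'.natural, Category.assoc, Category.assoc, v.natural]
  · rw [act_mul (V.isCoaction_outer W), ← hu, ← hu']
    rfl
  · rw [act_mul (V.isCoaction_outer W), ← hv, ← hv']
    rfl
  · rw [F.map_comp, ← Category.assoc, huv', Category.assoc, huv, Category.assoc]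

theorem Rel.mem_ZL2_iff [F.EssSurj] [F.Faithful] {σ : Conv2 k A} {τ : Conv2 k B}
    (h : Rel F σ.val τ.val) : σ ∈ ZL2 k A ↔ τ ∈ ZL2 k B := by
  obtain ⟨θ, χ, hθ, hχ, h⟩ := h
  rw [hθ.mem_ZL2_iff, hχ.mem_ZL2_iff, h.isNormalized_iff, h.isCocycle_iff]

theorem exists_rel_right [F.EssSurj] [F.Full] [F.Faithful] {σ : Conv2 k A} (hσ : IsLazy2 σ)
    (hσ' : IsLazy2 σ⁻¹) : ∃ τ : Conv2 k B, Rel F σ.val τ.val := by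
  obtain ⟨u, hu⟩ := exists_of_commute hσ
  obtain ⟨u', hu'⟩ := exists_of_commute hσ'
  obtain ⟨v, hv⟩ := exists_related_right (F := F) u
  obtain ⟨v', hv'⟩ := exists_related_right (F := F) u'
  obtain ⟨τ, hτ⟩ := v.exists_isAct
  obtain ⟨τ', hτ'⟩ := v'.exists_isAct
  have h : Rel F σ.val τ := ⟨u, v, hu, hτ, hv⟩
  have h' : Rel F σ⁻¹.val τ' := ⟨u', v', hu', hτ', hv'⟩
  obtain ⟨ν, rfl, rfl⟩ := exists_unit_of_rel (rel_one F) Rel.mul Rel.unique_right h h'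
  exact ⟨ν, h⟩

theorem exists_rel_left [F.Full] [F.Faithful] {τ : Conv2 k B} (hτ : IsLazy2 τ)
    (hτ' : IsLazy2 τ⁻¹) : ∃ σ : Conv2 k A, Rel F σ.val τ.val := by
  obtain ⟨v, hv⟩ := exists_of_commute hτ
  obtain ⟨v', hv'⟩ := exists_of_commute hτ'
  obtain ⟨u, hu⟩ := exists_related_left (F := F) v
  obtain ⟨u', hu'⟩ := exists_related_left (F := F) v'
  obtain ⟨σ, hσ⟩ := u.exists_isAct
  obtain ⟨σ', hσ'⟩ := u'.exists_isAct
  have h : Rel F σ τ.val := ⟨u, v, hσ, hv, hu⟩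
  have h' : Rel F σ' τ⁻¹.val := ⟨u', v', hσ', hv', hu'⟩
  obtain ⟨μ, rfl, rfl⟩ := exists_unit_of_rel (R := fun φ τ => Rel F τ φ) (rel_one F) Rel.mul
    (fun h h' => Rel.unique_left h h') h h'
  exact ⟨μ, h⟩

theorem rel_coboundary {μ : Conv1 k A} {ν : Conv1 k B} (h : IdEnd.Rel F μ.val ν.val)
    (h' : IdEnd.Rel F μ⁻¹.val ν⁻¹.val) : Rel F (coboundary μ).val (coboundary ν).val := by
  obtain ⟨u, v, hu, hv, huv⟩ := h
  obtain ⟨u', v', hu', hv', huv'⟩ := h'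
  exact ⟨_, _, isAct_coboundary hu hu', isAct_coboundary hv hv', huv.coboundary huv'⟩

end TensorEnd

/-! ### Invariance under monoidal equivalence of comodule categories -/

theorem nonempty_HL2_mulEquiv_of_monoidal {k A B : Type u} [CommRing k] [Ring A] [Bialgebra k A]
    [Ring B] [Bialgebra k B] (F : Comod k A ⥤ Comod k B) [F.Monoidal] [F.IsEquivalence] :
    Nonempty (HL2 k A ≃* HL2 k B) :=
  nonempty_HL2_mulEquiv_of_rel (fun σ τ => TensorEnd.Rel F σ.val τ.val)
    TensorEnd.Rel.mul
    (fun h h' => Units.ext (h.unique_right h'))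
    (fun h h' => Units.ext (h.unique_left h'))
    (fun σ hσ => by
      obtain ⟨τ, h⟩ := TensorEnd.exists_rel_right (F := F) hσ.1.2 (inv_mem hσ).1.2
      exact ⟨τ, h.mem_ZL2_iff.1 hσ, h⟩)
    (fun τ hτ => by
      obtain ⟨σ, h⟩ := TensorEnd.exists_rel_left (F := F) hτ.1.2 (inv_mem hτ).1.2
      exact ⟨σ, h.mem_ZL2_iff.2 hτ, h⟩)
    (fun μ hμ => by
      obtain ⟨ν, h, h'⟩ := IdEnd.exists_rel_right (F := F) hμ.2 (inv_mem hμ).2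
      exact ⟨ν, h.mem_Reg1L_iff.1 hμ, TensorEnd.rel_coboundary h h'⟩)
    (fun ν hν => by
      obtain ⟨μ, h, h'⟩ := IdEnd.exists_rel_left (F := F) hν.2 (inv_mem hν).2
      exact ⟨μ, h.mem_Reg1L_iff.2 hν, TensorEnd.rel_coboundary h h'⟩)

theorem MonoidallyCoMoritaEquivalent.nonempty_HL2_mulEquiv {k A B : Type u} [CommRing k] [Ring A]
    [Bialgebra k A] [Ring B] [Bialgebra k B] (h : MonoidallyCoMoritaEquivalent k A B) :
    Nonempty (HL2 k A ≃* HL2 k B) := by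
  obtain ⟨F, ⟨_⟩, -, -⟩ := h
  exact nonempty_HL2_mulEquiv_of_monoidal F.functor

end LazyCohomology

end

theorem corollary3p10 {k A B : Type u} [CommRing k] [Ring A] [HopfAlgebra k A] [Ring B]
    [HopfAlgebra k B] [Module.Flat k A] [Module.Flat k B] :
    -- a `k`-faithfully flat `A`-`B`-biGalois object yields an isomorphism of groups
    ((∃ (Z : Type w) (_ : Ring Z) (_ : Algebra k Z) (β : Z →ₐ[k] A ⊗[k] Z) (ρ : Z →ₐ[k] Z ⊗[k] B),
        Module.FaithfullyFlat k Z ∧ LazyCohomology.IsBiGalois β ρ) →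
      Nonempty (LazyCohomology.HL2 k A ≃* LazyCohomology.HL2 k B)) ∧
    -- invariance under monoidal co-Morita equivalence
    (LazyCohomology.MonoidallyCoMoritaEquivalent k A B →
      Nonempty (LazyCohomology.HL2 k A ≃* LazyCohomology.HL2 k B)) ∧
    -- invariance under cocycle twists
    (LazyCohomology.IsCocycleTwist k A B →
      Nonempty (LazyCohomology.HL2 k A ≃* LazyCohomology.HL2 k B)) :=
  ⟨fun ⟨_, _, _, _, _, _, h⟩ => h.nonempty_HL2_mulEquiv, fun h => h.nonempty_HL2_mulEquiv,
    fun ⟨_, mem, cocycle, _, e1, mul⟩ =>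
      (⟨mem, cocycle, e1, mul⟩ : LazyCohomology.IsTwistEquiv _ _).nonempty_HL2_mulEquiv⟩
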